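/- Consider a game of $N$ players with actions $a^i\in\mathbb R^{d_i}$, joint action $a\in\mathbb R^D$, $D=\sum_i d_i$, costs $J^i:\mathbb R^D\to\mathbb R$, and the coupling constraint set $C=\{a\in\mathbb R^D: g(a)=Ka-l\le 0\}$, $K\in\mathbb R^{n\times D}$, $l\in\mathbb R^n$. Assume: (1) each $J^i$ is continuously differentiable on $\mathbb R^D$ and convex in $a^i$ for fixed $a^{-i}$; (2) the pseudo-gradient $M$, $M^{i,j}=\partial J^i/\partial a^{i,j}$, is strongly monotone on $\mathbb R^D$: for some $\nu>0$, $\langle M(a)-M(b),a-b\rangle\ge\nu\|a-b\|^2$ for all $a,b$; (3) Slater's condition: $Ka<l$ componentwise for some $a$; (4) $J^i(x)=O(\|x\|^2)$ and $\nabla J^i(x)=O(\|x\|)$ as $\|x\|\to\infty$ for each $i$, and $M$ is Lipschitz continuous on $\mathbb R^D$. (All of (4) holds if every $\nabla J^i$ is Lipschitz continuous.) Then there is a unique variational generalized Nash equilibrium $a^*$, i.e. a unique $a^*\in C$ with $\langle M(a^*),a-a^*\rangle\ge0$ for all $a\in C$. Let $G,E,S>0$, $s\ge 4/7$, and $\gamma_t=G/t^{4/7}$,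 $\varepsilon_t=E/t^{2/7}$, $\sigma_t=S/t^{s}$ for $t\ge1$. Let $\mu(1)\in\mathbb R^D$ and $\lambda(1)\in\mathbb R^n_+$ be arbitrary deterministic vectors and, for $t\ge 1$, let $a(t)$ be drawn, given the past, from the normal law with mean $\mu(t)$ and covariance $\sigma_t^2 I$, and $$\mu^i(t+1)=\mu^i(t)-\gamma_t m^i(t),\qquad \lambda(t+1)=\Pi_{\mathbb R^n_+}\big[\lambda(t)-\gamma_t(-g(a(t))+\varepsilon_t\lambda(t))\big],$$ $$m^i(t)=\big(U^i(a(t),\lambda(t))-U^i(\mu(t),\lambda(t))\big)\frac{a^i(t)-\mu^i(t)}{\sigma_t^2},\qquad U^i(a,\lambda)=J^i(a)+\langle\lambda,g(a)\rangle .$$ Then $\mathrm E\|\mu(t)-a^*\|^2$ is finite for every $t\ge1$ and $$\mathrm E\|\mu(t)-a^*\|^2=O\big(1/t^{4/7}\big)\quad\text{as } t\to\infty .$$ -/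

import Mathlib

open MeasureTheory ProbabilityTheory Filter Asymptotics
open scoped RealInnerProductSpace

noncomputable section

namespace PayoffGNE

/-- Joint actions of `N` players, player `i` acting in `ℝ^(d i)`: the space `ℝ^D`, `D = ∑ i, d i`,
with the Euclidean norm. The coordinate `⟨i, j⟩` is `a^{i,j}`. -/
abbrev Action {N : ℕ} (d : Fin N → ℕ) : Type := EuclideanSpace ℝ (Σ i : Fin N, Fin (d i))

/-- Dual vectors, `ℝ^n`. -/
abbrev Dual (n : ℕ) : Type := EuclideanSpace ℝ (Fin n)

variable {N n : ℕ} {d : Fin N → ℕ}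

/-- The joint action in which player `i` plays `x` and all others play as in `a`. -/
def deviate (a : Action d) (i : Fin N) (x : EuclideanSpace ℝ (Fin (d i))) : Action d :=
  WithLp.toLp 2 (fun p => if h : p.1 = i then x (h ▸ p.2) else a p)

/-- The constraint function `g(a) = K a - l`. -/
def constraintFun (K : Matrix (Fin n) (Σ i : Fin N, Fin (d i)) ℝ) (l : Dual n) (a : Action d) :
    Dual n :=
  WithLp.toLp 2 (fun j => K.mulVec a.ofLp j - l j)

/-- The coupling constraint set `C = {a : K a - l ≤ 0}`. -/
def constraintSet (K : Matrix (Fin n) (Σ i : Fin N, Fin (d i)) ℝ) (l : Dual n) :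
    Set (Action d) :=
  {a | ∀ j, constraintFun K l a j ≤ 0}

/-- The pseudo-gradient `M`, with `M^{i,j}(a) = ∂J^i(a)/∂a^{i,j}`. -/
def pseudoGradient (J : Fin N → Action d → ℝ) (a : Action d) : Action d :=
  WithLp.toLp 2 (fun p => fderiv ℝ (J p.1) a (EuclideanSpace.single p 1))

/-- Convex game: each `J^i` is continuously differentiable on `ℝ^D`, and convex in the action of
player `i` for fixed actions of the others. -/
def IsConvexGame (J : Fin N → Action d → ℝ) : Prop :=
  ∀ i, ContDiff ℝ 1 (J i) ∧ ∀ a : Action d, ConvexOn ℝ Set.univ (fun x => J i (deviate a i x))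

/-- Strong monotonicity of a mapping on the whole space. -/
def StronglyMonotone (M : Action d → Action d) : Prop :=
  ∃ ν : ℝ, 0 < ν ∧ ∀ a b : Action d, ν * ‖a - b‖ ^ 2 ≤ ⟪M a - M b, a - b⟫

/-- Slater's constraint qualification: there is a strictly feasible point. -/
def SlaterCondition (K : Matrix (Fin n) (Σ i : Fin N, Fin (d i)) ℝ) (l : Dual n) : Prop :=
  ∃ a : Action d, ∀ j, constraintFun K l a j < 0

/-- At most quadratic growth of the costs, `J^i(x) = O(‖x‖²)` and `∇J^i(x) = O(‖x‖)` as
`‖x‖ → ∞`, and Lipschitz continuity of the pseudo-gradient. Both hold when all `∇J^i` are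
Lipschitz continuous on `ℝ^D`. -/
structure QuadraticGrowth (J : Fin N → Action d → ℝ) : Prop where
  cost : ∀ i, J i =O[Bornology.cobounded (Action d)] (fun x => ‖x‖ ^ 2)
  gradient : ∀ i, (fun x => fderiv ℝ (J i) x) =O[Bornology.cobounded (Action d)] (fun x => ‖x‖)
  lipschitz : ∃ L : NNReal, LipschitzWith L (pseudoGradient J)

/-- Variational generalized Nash equilibrium: a solution of the variational inequality
of `M` over `C`. -/
def IsVGNE (J : Fin N → Action d → ℝ) (K : Matrix (Fin n) (Σ i : Fin N, Fin (d i)) ℝ)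
    (l : Dual n) (aStar : Action d) : Prop :=
  aStar ∈ constraintSet K l ∧
    ∀ a ∈ constraintSet K l, 0 ≤ ⟪pseudoGradient J aStar, a - aStar⟫

/-- The Lagrangian cost `U^i(a, λ) = J^i(a) + ⟨λ, g(a)⟩` of player `i`. -/
def lagrangianCost (J : Fin N → Action d → ℝ) (K : Matrix (Fin n) (Σ i : Fin N, Fin (d i)) ℝ)
    (l : Dual n) (i : Fin N) (a : Action d) (lam : Dual n) : ℝ :=
  J i a + ⟪lam, constraintFun K l a⟫

/-- The two-point gradient estimate
`m^i = (U^i(a, λ) - U^i(μ, λ)) (a^i - μ^i) / σ²`, all players stacked. -/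
def gradEstimate (J : Fin N → Action d → ℝ) (K : Matrix (Fin n) (Σ i : Fin N, Fin (d i)) ℝ)
    (l : Dual n) (σ : ℝ) (μ a : Action d) (lam : Dual n) : Action d :=
  WithLp.toLp 2 (fun p =>
    (lagrangianCost J K l p.1 a lam - lagrangianCost J K l p.1 μ lam) * ((a p - μ p) / σ ^ 2))

/-- The projection onto the nonnegative orthant `ℝ^n_+`. -/
def projNonneg (v : Dual n) : Dual n := WithLp.toLp 2 (fun j => max (v j) 0)

/-- `projNonneg v` lies in the nonnegative orthant and is a nearest point of it to `v`. -/
theorem projNonneg_isNearest (v : Dual n) :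
    (∀ j, 0 ≤ projNonneg v j) ∧
      ∀ w : Dual n, (∀ j, 0 ≤ w j) → ‖v - projNonneg v‖ ≤ ‖v - w‖ := by
  refine ⟨fun j => le_max_right _ _, fun w hw => ?_⟩
  rw [EuclideanSpace.norm_eq, EuclideanSpace.norm_eq]
  refine Real.sqrt_le_sqrt (Finset.sum_le_sum fun j _ => ?_)
  simp only [Real.norm_eq_abs, sq_abs, PiLp.sub_apply, projNonneg]
  rcases le_total (v j) 0 with h | h
  · rw [max_eq_right h]; nlinarith [hw j]
  · rw [max_eq_left h]; nlinarith [sq_nonneg (v j - w j)]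

/-- Standard Gaussian sampling noise: the real random variables `ξ t p`, over all times `t ≥ 1` and
coordinates `p`, are independent, each with the normal law `N(0, 1)`. -/
structure IsStandardNoise {Ω : Type*} [MeasurableSpace Ω] (P : Measure Ω)
    (ξ : ℕ → (Σ i : Fin N, Fin (d i)) → Ω → ℝ) : Prop where
  measurable : ∀ t, 1 ≤ t → ∀ p, Measurable (ξ t p)
  law : ∀ t, 1 ≤ t → ∀ p, P.map (ξ t p) = gaussianReal 0 1
  indep : iIndepFun
    (fun q : {t : ℕ // 1 ≤ t} × (Σ i : Fin N, Fin (d i)) => ξ q.1.1 q.2) P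

/-- `(μ, λ, a)` is a run, over the times `t ≥ 1`, of the payoff-based algorithm with step sizes `γ`,
regularization parameters `ε` and sampling deviations `σ`. Given the past, the action `a(t)` is
drawn from the normal law with mean `μ(t)` and covariance `σ_t² I`, that is
`a(t) = μ(t) + σ_t ξ(t)` with standard Gaussian noise `ξ(t)` that is fresh at each time. -/
structure IsPayoffRun {Ω : Type*} [MeasurableSpace Ω] (P : Measure Ω)
    (J : Fin N → Action d → ℝ) (K : Matrix (Fin n) (Σ i : Fin N, Fin (d i)) ℝ) (l : Dual n)
    (γ ε σ : ℕ → ℝ) (μ a : ℕ → Ω → Action d) (lam : ℕ → Ω → Dual n) : Prop where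
  primal_init : ∃ μ₁ : Action d, ∀ ω, μ 1 ω = μ₁
  dual_init : ∃ lam₁ : Dual n, (∀ j, 0 ≤ lam₁ j) ∧ ∀ ω, lam 1 ω = lam₁
  sampling : ∃ ξ : ℕ → (Σ i : Fin N, Fin (d i)) → Ω → ℝ, IsStandardNoise P ξ ∧
    ∀ t, 1 ≤ t → ∀ ω p, a t ω p = μ t ω p + σ t * ξ t p ω
  primal_step : ∀ t, 1 ≤ t → ∀ ω,
    μ (t + 1) ω = μ t ω - γ t • gradEstimate J K l (σ t) (μ t ω) (a t ω) (lam t ω)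
  dual_step : ∀ t, 1 ≤ t → ∀ ω,
    lam (t + 1) ω =
      projNonneg (lam t ω - γ t • (-constraintFun K l (a t ω) + ε t • lam t ω))

end PayoffGNE

end

/-! Existence and uniqueness. Adding the penalty `ε⁻¹ Kᵀ(Ka - l)₊` to `M` keeps it strongly monotone
and Lipschitz, so it has a zero. Slater's condition bounds these zeros and their penalty forces as
`ε → 0`, and a limit point is a KKT point (`exists_kkt_point`), hence a variational equilibrium.
Strong monotonicity leaves room for only one.

Rate. Let `u = μ - a*`, `x = λ`, `g = K a* - l ≤ 0`, and let `d` be the distance from `x` to the set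
of all multipliers of `a*`; multipliers need not be unique. In `‖u‖² + d²` the bilinear primal and
dual terms cancel, and one step dissipates `γ(‖u‖² + Γ)` with `Γ = -⟨x, g⟩`, but `d` decays only
through the regularization, at the slow rate `γε`. The cross term `κ⟨u, v⟩` of the Lyapunov function
`W` adds the dissipation `γκ‖v‖²`, where `v = Kᵀ(x + g)₊ + M(a*)`. The shrunk variable `(x + g)₊` is
used because `x` itself drifts along `g` at inactive constraints, at a cost `γ‖u‖‖g‖` that nothing
absorbs; the shrunk variable moves only by `γ(θ + ‖y‖)`, where `θ² ≤ Γ` and `y` is the part of the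
dual direction other than `g` (`norm_shrink_step_le`).

Hoffman's error bound (`hoffman_bound`) gives `d ≤ H(‖v‖ + ‖K‖θ + Γ)`. It is used twice. The pull
`εRd` of the regularization towards the origin is charged to the dissipation and leaves only `ε²`
(`first_order_bound`). And `W` is at most a constant times dissipation plus `W²`
(`exists_lyapunov_le_dissipation`), the square being needed because `Γ²` is not controlled by `Γ`
far from the multipliers.

With `w = E W` and `f = E W²` this gives (`exists_expected_step`) `w⁺ ≤ (1 - cγ)w + Cγf + Cγ²` and
`f⁺ ≤ (1 - cγε)f + Cγ²w + Cγ⁴`. If `w` is of order `γ`, then `f` should be of order `γ²/ε ~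
t^(-6/7)`, which is small compared with `γ`, so the two recursions close
(`coupled_recursion_bound`). The exponents enter through `ε² ~ γ`, which keeps the regularization
error at `γ²` per step, and through `4/7 + 2/7 < 1`, which lets the slow contraction beat `1/t`.

Sampling. By Gaussian integration by parts (`integral_gradEstimate`) the mean of the estimate is the
Gaussian average of `M + Kᵀλ`, so its bias is of order `σ` because `M` is Lipschitz. The difference
of two costs is of order `σ`, which compensates the division by `σ`, so the second moment does not
blow up as `σ → 0`. -/

noncomputable section

namespace PayoffGNE

/-! ### Hoffman's error bound for polyhedra -/

section Hoffman

variable {n : ℕ} {F : Type*} [NormedAddCommGroup F] [NormedSpace ℝ F]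

theorem exists_bound_of_injOn_support (A : Dual n →ₗ[ℝ] F) (S : Finset (Fin n))
    (h : ∀ w : Dual n, (∀ i, i ∉ S → w i = 0) → A w = 0 → w = 0) :
    ∃ C : ℝ, 0 ≤ C ∧ ∀ z : Dual n, (∀ i, i ∉ S → z i = 0) → ‖z‖ ≤ C * ‖A z‖ := by
  let V : Submodule ℝ (Dual n) :=
    { carrier := {z | ∀ i, i ∉ S → z i = 0}
      add_mem' := fun {a b} ha hb i hi => by simp [ha i hi, hb i hi]
      zero_mem' := fun i _ => by simp
      smul_mem' := fun c x hx i hi => by simp [hx i hi] }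
  have hker : LinearMap.ker (A.domRestrict V) = ⊥ := by
    rw [LinearMap.ker_eq_bot']
    rintro ⟨w, hw⟩ hAw
    exact Subtype.ext (h w hw hAw)
  obtain ⟨C, -, hC⟩ := (A.domRestrict V).exists_antilipschitzWith hker
  refine ⟨C, C.2, fun z hz => ?_⟩
  simpa using hC.le_mul_norm (map_zero _) (⟨z, hz⟩ : V)

/-- Every image of `A` has a preimage of controlled norm whose coordinates keep the signs. -/
theorem exists_sign_preserving_preimage (A : Dual n →ₗ[ℝ] F) (S : Finset (Fin n)) :
    ∃ C : ℝ, 0 ≤ C ∧ ∀ z₀ : Dual n, (∀ i, i ∉ S → z₀ i = 0) → ∃ z : Dual n,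
      (∀ i, (0 ≤ z₀ i → 0 ≤ z i) ∧ (z₀ i ≤ 0 → z i ≤ 0)) ∧ A z = A z₀ ∧ ‖z‖ ≤ C * ‖A z₀‖ := by
  induction S using Finset.strongInduction with
  | H S ih =>
    by_cases hinj : ∀ w : Dual n, (∀ i, i ∉ S → w i = 0) → A w = 0 → w = 0
    · obtain ⟨C, hC0, hC⟩ := exists_bound_of_injOn_support A S hinj
      exact ⟨C, hC0, fun z₀ hz₀ => ⟨z₀, fun i => ⟨id, id⟩, rfl, hC z₀ hz₀⟩⟩
    · push Not at hinj
      obtain ⟨w, hwS, hAw, hw0⟩ := hinj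
      -- The dummy constant 0 for `j ∉ S` makes the family total. All constants are thus fixed
      -- before `z₀`, and their sum serves whichever coordinate is removed.
      have ih' : ∀ j : Fin n, ∃ C : ℝ, 0 ≤ C ∧ (j ∈ S → ∀ z₀ : Dual n,
          (∀ i, i ∉ S.erase j → z₀ i = 0) → ∃ z : Dual n,
          (∀ i, (0 ≤ z₀ i → 0 ≤ z i) ∧ (z₀ i ≤ 0 → z i ≤ 0)) ∧ A z = A z₀ ∧
            ‖z‖ ≤ C * ‖A z₀‖) := by
        intro j
        by_cases hj : j ∈ S
        · obtain ⟨C, h0, hC⟩ := ih (S.erase j) (Finset.erase_ssubset hj)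
          exact ⟨C, h0, fun _ => hC⟩
        · exact ⟨0, le_rfl, fun h => absurd h hj⟩
      choose C hC0 hC using ih'
      refine ⟨∑ j, C j, Finset.sum_nonneg fun j _ => hC0 j, fun z₀ hz₀ => ?_⟩
      have hCle : ∀ j, C j ≤ ∑ j, C j := fun j =>
        Finset.single_le_sum (fun i _ => hC0 i) (Finset.mem_univ j)
      by_cases hzero : ∃ j ∈ S, z₀ j = 0
      · obtain ⟨j, hjS, hj⟩ := hzero
        obtain ⟨z, h1, h2, h3⟩ := hC j hjS z₀ (fun i hi => by
          by_cases hij : i = j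
          · rw [hij, hj]
          · exact hz₀ i (fun h => hi (Finset.mem_erase.2 ⟨hij, h⟩)))
        exact ⟨z, h1, h2, h3.trans (mul_le_mul_of_nonneg_right (hCle j) (norm_nonneg _))⟩
      · push Not at hzero
        -- Up to replacing the kernel vector by its negative, it agrees in sign with `z₀` somewhere,
        -- so subtracting it pushes some coordinate of `z₀` towards 0.
        obtain ⟨w, hwS, hAw, i₀, hi₀⟩ : ∃ w : Dual n, (∀ i, i ∉ S → w i = 0) ∧ A w = 0 ∧
            ∃ i, 0 < w i * z₀ i := by
          obtain ⟨i, hi⟩ : ∃ i, w i ≠ 0 := by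
            by_contra hcon
            push Not at hcon
            exact hw0 (PiLp.ext hcon)
          have hiS : i ∈ S := by
            by_contra h
            exact hi (hwS i h)
          rcases lt_or_gt_of_ne (mul_ne_zero hi (hzero i hiS)) with hneg | hpos
          · exact ⟨-w, fun i hi => by simp [hwS i hi], by simp [hAw], i, by
              rw [PiLp.neg_apply]; linarith⟩
          · exact ⟨w, hwS, hAw, i, hpos⟩
        -- The ratio test: the smallest `z₀ i / w i` is the longest step along `-w` that reverses no
        -- sign. The minimizing coordinate becomes 0 while the image is unchanged, so the support
        -- loses `j`.
        obtain ⟨j, hjT, hjmin⟩ := Finset.exists_min_image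
          (Finset.univ.filter fun i => 0 < w i * z₀ i) (fun i => z₀ i / w i)
          ⟨i₀, by simpa using hi₀⟩
        have hj : 0 < w j * z₀ j := by simpa using hjT
        have hwj : w j ≠ 0 := left_ne_zero_of_mul hj.ne'
        have hjS : j ∈ S := by
          by_contra h
          exact hwj (hwS j h)
        set s : ℝ := z₀ j / w j with hs
        have hs0 : 0 ≤ s := by
          rw [hs, div_eq_mul_inv, show z₀ j * (w j)⁻¹ = (w j * z₀ j) * ((w j)⁻¹ * (w j)⁻¹) by
            field_simp]
          exact mul_nonneg hj.le (mul_self_nonneg _)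
        have hsign : ∀ i, 0 ≤ (z₀ i - s * w i) * z₀ i := by
          intro i
          by_cases hi : 0 < w i * z₀ i
          · have h1 : s ≤ z₀ i / w i := hjmin i (by simpa using hi)
            have hwi : w i ≠ 0 := left_ne_zero_of_mul hi.ne'
            have h2 : s * (w i * z₀ i) ≤ z₀ i / w i * (w i * z₀ i) :=
              mul_le_mul_of_nonneg_right h1 hi.le
            have h3 : z₀ i / w i * (w i * z₀ i) = z₀ i * z₀ i := by field_simp
            nlinarith
          · nlinarith [mul_self_nonneg (z₀ i), mul_nonneg hs0 (neg_nonneg.2 (not_lt.1 hi))]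
        obtain ⟨z, h1, h2, h3⟩ := hC j hjS (z₀ - s • w) (fun i hi => by
          by_cases hij : i = j
          · subst hij
            simp [hs, hwj]
          · have hiS : i ∉ S := fun h => hi (Finset.mem_erase.2 ⟨hij, h⟩)
            simp [hz₀ i hiS, hwS i hiS])
        have hA : A (z₀ - s • w) = A z₀ := by simp [hAw]
        rw [hA] at h2 h3
        refine ⟨z, fun i => ?_, h2, h3.trans
          (mul_le_mul_of_nonneg_right (hCle j) (norm_nonneg _))⟩
        have h1i := h1 i
        simp only [PiLp.sub_apply, PiLp.smul_apply, smul_eq_mul] at h1i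
        by_cases hiS : i ∈ S
        · have hne := hzero i hiS
          refine ⟨fun h => h1i.1 ?_, fun h => h1i.2 ?_⟩
          · have : 0 < z₀ i := lt_of_le_of_ne h (Ne.symm hne)
            exact nonneg_of_mul_nonneg_left (hsign i) this
          · have : z₀ i < 0 := lt_of_le_of_ne h hne
            nlinarith [hsign i]
        · have h0 : z₀ i - s * w i = 0 := by simp [hz₀ i hiS, hwS i hiS]
          rw [h0] at h1i
          exact ⟨fun _ => h1i.1 le_rfl, fun _ => h1i.2 le_rfl⟩

/-- Every image of `A` has a preimage of controlled norm lying coordinatewise between `0` and the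
given preimage. -/
theorem exists_dominated_preimage (A : Dual n →ₗ[ℝ] F) (S : Finset (Fin n)) :
    ∃ C : ℝ, 0 ≤ C ∧ ∀ z₀ : Dual n, (∀ i, i ∉ S → z₀ i = 0) → ∃ z : Dual n,
      (∀ i, (0 ≤ z i ∧ z i ≤ z₀ i) ∨ (z₀ i ≤ z i ∧ z i ≤ 0)) ∧ A z = A z₀ ∧
        ‖z‖ ≤ C * ‖A z₀‖ := by
  induction S using Finset.strongInduction with
  | H S ih =>
    obtain ⟨C₁, hC₁, hsol⟩ := exists_sign_preserving_preimage A S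
    have ih' : ∀ j : Fin n, ∃ C : ℝ, 0 ≤ C ∧ (j ∈ S → ∀ z₀ : Dual n,
        (∀ i, i ∉ S.erase j → z₀ i = 0) → ∃ z : Dual n,
        (∀ i, (0 ≤ z i ∧ z i ≤ z₀ i) ∨ (z₀ i ≤ z i ∧ z i ≤ 0)) ∧ A z = A z₀ ∧
          ‖z‖ ≤ C * ‖A z₀‖) := by
      intro j
      by_cases hj : j ∈ S
      · obtain ⟨C, h0, hC⟩ := ih (S.erase j) (Finset.erase_ssubset hj)
        exact ⟨C, h0, fun _ => hC⟩
      · exact ⟨0, le_rfl, fun h => absurd h hj⟩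
    choose C hC0 hC using ih'
    have hCs : 0 ≤ ∑ j, C j := Finset.sum_nonneg fun j _ => hC0 j
    have hCle : ∀ j, C j ≤ ∑ j, C j := fun j =>
      Finset.single_le_sum (fun i _ => hC0 i) (Finset.mem_univ j)
    refine ⟨C₁ + ∑ j, C j, by positivity, fun z₀ hz₀ => ?_⟩
    obtain ⟨z', hz'sign, hAz', hz'norm⟩ := hsol z₀ hz₀
    -- If `z'` overshoots `z₀`, only the largest admissible fraction `s • z'` is taken. It exhausts
    -- a coordinate of `z₀`, and the remainder `z₀ - s • z'` has image `(1 - s) • A z₀` and smaller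
    -- support, so the induction applies to it.
    by_cases hdom : ∀ i, |z' i| ≤ |z₀ i|
    · refine ⟨z', fun i => ?_, hAz', hz'norm.trans
        (mul_le_mul_of_nonneg_right (by linarith) (norm_nonneg _))⟩
      rcases le_total 0 (z₀ i) with h | h
      · have := (hz'sign i).1 h
        have hd := hdom i
        rw [abs_of_nonneg h, abs_of_nonneg this] at hd
        exact Or.inl ⟨this, hd⟩
      · have := (hz'sign i).2 h
        have hd := hdom i
        rw [abs_of_nonpos h, abs_of_nonpos this] at hd
        exact Or.inr ⟨by linarith, this⟩
    · push Not at hdom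
      obtain ⟨i₀, hi₀⟩ := hdom
      have hi₀' : 0 < |z' i₀| := lt_of_le_of_lt (abs_nonneg _) hi₀
      obtain ⟨j, hjT, hjmin⟩ := Finset.exists_min_image
        (Finset.univ.filter fun i => 0 < |z' i|) (fun i => |z₀ i| / |z' i|)
        ⟨i₀, by simpa using hi₀'⟩
      have hj : 0 < |z' j| := by simpa using hjT
      set s : ℝ := |z₀ j| / |z' j| with hs
      have hs0 : 0 ≤ s := by positivity
      have hs1 : s ≤ 1 := (hjmin i₀ (by simpa using hi₀')).trans ((div_le_one hi₀').2 hi₀.le)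
      have hle : ∀ i, s * |z' i| ≤ |z₀ i| := by
        intro i
        rcases (abs_nonneg (z' i)).eq_or_lt with h | h
        · rw [← h]; simp
        · exact (le_div_iff₀ h).1 (hjmin i (by simpa using h))
      have hbet : ∀ i, (0 ≤ s * z' i ∧ s * z' i ≤ z₀ i) ∨ (z₀ i ≤ s * z' i ∧ s * z' i ≤ 0) := by
        intro i
        have hl := hle i
        rcases le_total 0 (z₀ i) with h | h
        · have := (hz'sign i).1 h
          rw [abs_of_nonneg h, abs_of_nonneg this] at hl
          exact Or.inl ⟨mul_nonneg hs0 this, hl⟩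
        · have := (hz'sign i).2 h
          rw [abs_of_nonpos h, abs_of_nonpos this] at hl
          exact Or.inr ⟨by linarith, mul_nonpos_of_nonneg_of_nonpos hs0 this⟩
      have hzj : z₀ j - s * z' j = 0 := by
        have hsj : s * |z' j| = |z₀ j| := by rw [hs]; field_simp
        rcases le_total 0 (z₀ j) with h | h
        · have := (hz'sign j).1 h
          rw [abs_of_nonneg h, abs_of_nonneg this] at hsj
          linarith
        · have := (hz'sign j).2 h
          rw [abs_of_nonpos h, abs_of_nonpos this] at hsj
          linarith
      have hjS : j ∈ S := by
        by_contra h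
        have h1 := hz'sign j
        rw [hz₀ j h] at h1
        have : z' j = 0 := le_antisymm (h1.2 le_rfl) (h1.1 le_rfl)
        simp [this] at hj
      obtain ⟨y, hy1, hy2, hy3⟩ := hC j hjS (z₀ - s • z') (fun i hi => by
        by_cases hij : i = j
        · subst hij
          simpa using hzj
        · have hiS : i ∉ S := fun h => hi (Finset.mem_erase.2 ⟨hij, h⟩)
          have h1 := hz'sign i
          rw [hz₀ i hiS] at h1
          have : z' i = 0 := le_antisymm (h1.2 le_rfl) (h1.1 le_rfl)
          simp [hz₀ i hiS, this])
      have hA : A (z₀ - s • z') = (1 - s) • A z₀ := by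
        rw [map_sub, map_smul, hAz', sub_smul, one_smul]
      rw [hA] at hy2 hy3
      refine ⟨s • z' + y, fun i => ?_, ?_, ?_⟩
      · have h1 := hbet i
        have h2 := hy1 i
        simp only [PiLp.sub_apply, PiLp.smul_apply, PiLp.add_apply, smul_eq_mul] at h2 ⊢
        rcases h1 with h1 | h1 <;> rcases h2 with h2 | h2
        · exact Or.inl ⟨by linarith, by linarith⟩
        · exact Or.inl ⟨by linarith, by linarith⟩
        · exact Or.inr ⟨by linarith, by linarith⟩
        · exact Or.inr ⟨by linarith, by linarith⟩
      · rw [map_add, map_smul, hAz', hy2, ← add_smul]; simp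
      · have hn : ‖(1 - s) • A z₀‖ ≤ ‖A z₀‖ := by
          rw [norm_smul, Real.norm_of_nonneg (by linarith)]
          exact mul_le_of_le_one_left (norm_nonneg _) (by linarith)
        calc ‖s • z' + y‖ ≤ ‖s • z'‖ + ‖y‖ := norm_add_le _ _
          _ ≤ ‖z'‖ + ‖y‖ := by
              gcongr
              rw [norm_smul, Real.norm_of_nonneg hs0]
              exact mul_le_of_le_one_left (norm_nonneg _) hs1
          _ ≤ C₁ * ‖A z₀‖ + (∑ j, C j) * ‖A z₀‖ :=
              add_le_add hz'norm (hy3.trans (mul_le_mul (hCle j) hn (norm_nonneg _) hCs))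
          _ = _ := by ring

/-- Hoffman's error bound for the polyhedron `{p ≥ 0 : A p = A y}`. -/
theorem hoffman_bound (A : Dual n →ₗ[ℝ] F) :
    ∃ H : ℝ, 0 ≤ H ∧ ∀ x y : Dual n, (∀ i, 0 ≤ x i) → (∀ i, 0 ≤ y i) →
      ∃ p : Dual n, (∀ i, 0 ≤ p i) ∧ A p = A y ∧ ‖x - p‖ ≤ H * ‖A x - A y‖ := by
  obtain ⟨H, hH0, hH⟩ := exists_dominated_preimage A Finset.univ
  refine ⟨H, hH0, fun x y hx hy => ?_⟩
  -- Since `z` lies between 0 and `x - y` in each coordinate, `x - z` lies between `y` and `x`,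
  -- hence in the orthant.
  obtain ⟨z, h1, h2, h3⟩ := hH (x - y) (fun i hi => absurd (Finset.mem_univ i) hi)
  rw [map_sub] at h2 h3
  refine ⟨x - z, fun i => ?_, by rw [map_sub, h2]; simp, by simpa using h3⟩
  have h1i := h1 i
  simp only [PiLp.sub_apply] at h1i ⊢
  rcases h1i with h | h
  · linarith [hy i]
  · linarith [hx i]

end Hoffman

/-! ### Step sizes and the coupled recursion -/

section StepSizes

theorem eventually_div_rpow_le (G δ s : ℝ) (hδ : 0 < δ) (hs : 0 < s) :
    ∀ᶠ t : ℕ in atTop, G / (t : ℝ) ^ s ≤ δ := by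
  have h : Tendsto (fun t : ℕ => G / (t : ℝ) ^ s) atTop (nhds 0) :=
    Tendsto.div_atTop tendsto_const_nhds
      ((tendsto_rpow_atTop hs).comp tendsto_natCast_atTop_atTop)
  exact (h.eventually (gt_mem_nhds hδ)).mono fun t ht => ht.le

theorem eventually_step_le_regularization (G E δ : ℝ) (hE : 0 < E) (hδ : 0 < δ) :
    ∀ᶠ t : ℕ in atTop, G / (t : ℝ) ^ (4 / 7 : ℝ) ≤ δ * (E / (t : ℝ) ^ (2 / 7 : ℝ)) := by
  filter_upwards [eventually_div_rpow_le G (δ * E) (2 / 7) (by positivity) (by norm_num),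
    eventually_ge_atTop 1] with t ht ht1
  have ht0 : (0 : ℝ) < t := by exact_mod_cast ht1
  have hp : (0 : ℝ) < (t : ℝ) ^ (2 / 7 : ℝ) := Real.rpow_pos_of_pos ht0 _
  have hsplit : (t : ℝ) ^ (4 / 7 : ℝ) = (t : ℝ) ^ (2 / 7 : ℝ) * (t : ℝ) ^ (2 / 7 : ℝ) := by
    rw [← Real.rpow_add ht0]; norm_num
  rw [hsplit, ← div_div, mul_div_assoc']
  exact div_le_div_of_nonneg_right ht hp.le

/-- The product decays with exponent `4/7 + 2/7 = 6/7`, which leaves a factor `t^(-1/7)` to spare.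
This is why even the slow contraction rate beats the decay of the target envelope. -/
theorem eventually_inv_le_step_mul_regularization (G E δ : ℝ) (hG : 0 < G) (hE : 0 < E)
    (hδ : 0 < δ) :
    ∀ᶠ t : ℕ in atTop,
      1 / (t : ℝ) ≤ δ * (G / (t : ℝ) ^ (4 / 7 : ℝ) * (E / (t : ℝ) ^ (2 / 7 : ℝ))) := by
  filter_upwards [eventually_div_rpow_le 1 (δ * (G * E)) (1 / 7) (by positivity) (by norm_num),
    eventually_ge_atTop 1] with t ht ht1
  have ht0 : (0 : ℝ) < t := by exact_mod_cast ht1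
  have hp : (0 : ℝ) < (t : ℝ) ^ (4 / 7 : ℝ) * (t : ℝ) ^ (2 / 7 : ℝ) :=
    mul_pos (Real.rpow_pos_of_pos ht0 _) (Real.rpow_pos_of_pos ht0 _)
  have hsplit : (t : ℝ) =
      (t : ℝ) ^ (1 / 7 : ℝ) * ((t : ℝ) ^ (4 / 7 : ℝ) * (t : ℝ) ^ (2 / 7 : ℝ)) := by
    rw [← Real.rpow_add ht0, ← Real.rpow_add ht0]; norm_num
  calc 1 / (t : ℝ) = 1 / (t : ℝ) ^ (1 / 7 : ℝ) /
        ((t : ℝ) ^ (4 / 7 : ℝ) * (t : ℝ) ^ (2 / 7 : ℝ)) := by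
        conv_lhs => rw [hsplit]
        rw [← div_div]
    _ ≤ δ * (G * E) / ((t : ℝ) ^ (4 / 7 : ℝ) * (t : ℝ) ^ (2 / 7 : ℝ)) :=
        div_le_div_of_nonneg_right ht hp.le
    _ = _ := by field_simp

/-- From `1 - 1/t ≤ t/(t+1) ≤ (t/(t+1))^s`, the last because the base is at most 1 and `s ≤ 1`. An
envelope `t^(-s)` therefore survives any recursion whose net contraction is at least `1/t`. -/
theorem inv_rpow_mul_one_sub_le {t : ℕ} (ht : 1 ≤ t) {s : ℝ} (hs1 : s ≤ 1) :
    1 / (t : ℝ) ^ s * (1 - 1 / (t : ℝ)) ≤ 1 / ((t + 1 : ℕ) : ℝ) ^ s := by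
  have ht0 : (0 : ℝ) < t := by exact_mod_cast ht
  have ht1 : (0 : ℝ) < (t : ℝ) + 1 := by positivity
  have h1 : (1 : ℝ) - 1 / t ≤ t / (t + 1) := by
    rw [le_div_iff₀ ht1]
    have : (1 - 1 / (t : ℝ)) * (t + 1) = t - 1 / t := by field_simp; ring
    rw [this]
    linarith [show (0 : ℝ) ≤ 1 / t by positivity]
  have h2 : (t : ℝ) / (t + 1) ≤ ((t : ℝ) / (t + 1)) ^ s := by
    conv_lhs => rw [← Real.rpow_one ((t : ℝ) / (t + 1))]
    exact Real.rpow_le_rpow_of_exponent_ge (by positivity)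
      ((div_le_one ht1).2 (by linarith)) hs1
  have h3 : ((t : ℝ) / (t + 1)) ^ s = (t : ℝ) ^ s / ((t : ℝ) + 1) ^ s :=
    Real.div_rpow ht0.le ht1.le s
  have hp : 0 < (t : ℝ) ^ s := Real.rpow_pos_of_pos ht0 _
  calc 1 / (t : ℝ) ^ s * (1 - 1 / (t : ℝ)) ≤ 1 / (t : ℝ) ^ s * ((t : ℝ) ^ s / ((t : ℝ) + 1) ^ s) :=
        mul_le_mul_of_nonneg_left (by rw [← h3]; exact h1.trans h2) (by positivity)
    _ = 1 / ((t + 1 : ℕ) : ℝ) ^ s := by push_cast; field_simp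

/-- A fast recursion for `w`, driven by the slow recursion for `f` that is itself driven by `w`
with a smaller weight, forces `w = O(γ)`. -/
theorem coupled_recursion_bound {G E c C : ℝ} (hG : 0 < G) (hE : 0 < E) (hc : 0 < c)
    (hC : 0 ≤ C) {γ ε : ℕ → ℝ} (hγ : ∀ t : ℕ, γ t = G / (t : ℝ) ^ (4 / 7 : ℝ))
    (hε : ∀ t : ℕ, ε t = E / (t : ℝ) ^ (2 / 7 : ℝ)) {w f : ℕ → ℝ}
    (h1 : ∀ᶠ t in atTop, w (t + 1) ≤ (1 - c * γ t) * w t + C * γ t * f t + C * γ t ^ 2)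
    (h2 : ∀ᶠ t in atTop,
      f (t + 1) ≤ (1 - c * (γ t * ε t)) * f t + C * γ t ^ 2 * w t + C * γ t ^ 4) :
    ∃ A : ℝ, ∀ᶠ t : ℕ in atTop, w t ≤ A * (1 / (t : ℝ) ^ (4 / 7 : ℝ)) := by
  -- The ansatz is `w ≤ A τ` and `f ≤ A η τ`. With this `η` the feedback `C γ f` uses at most a
  -- quarter of the fast contraction.
  set η : ℝ := c / (4 * (C + 1)) with hη
  have hη0 : 0 < η := by positivity
  have hCη : C * η ≤ c / 4 := by
    rw [hη, mul_div_assoc', div_le_div_iff₀ (by positivity) (by positivity)]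
    nlinarith
  have e1 : ∀ᶠ t in atTop, γ t ≤ 1 := by
    simpa only [hγ] using eventually_div_rpow_le G 1 (4 / 7) one_pos (by norm_num)
  have e2 : ∀ᶠ t in atTop, ε t ≤ 1 := by
    simpa only [hε] using eventually_div_rpow_le E 1 (2 / 7) one_pos (by norm_num)
  have e3 : ∀ᶠ t in atTop, γ t ≤ 1 / c := by
    simpa only [hγ] using eventually_div_rpow_le G (1 / c) (4 / 7) (by positivity) (by norm_num)
  -- The slow recursion is driven by terms with a spare factor `γ`; as `γ = o(ε)`, they fit into
  -- half of its contraction, even after the loss of `η`.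
  have e4 : ∀ᶠ t in atTop, γ t ≤ (η * c / 2 / (C + C * G + 1)) * ε t := by
    simpa only [hγ, hε] using eventually_step_le_regularization G E _ hE (by positivity)
  have e5 : ∀ᶠ t : ℕ in atTop, 1 / (t : ℝ) ≤ c / 2 * (γ t * ε t) := by
    simpa only [hγ, hε] using
      eventually_inv_le_step_mul_regularization G E (c / 2) hG hE (by positivity)
  obtain ⟨T, hT⟩ := eventually_atTop.1 (((((((h1.and h2).and e1).and e2).and e3).and e4).and
    e5).and (eventually_ge_atTop 1))
  have hTpos : (0 : ℝ) < T := by exact_mod_cast (hT T le_rfl).2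
  set τ : ℕ → ℝ := fun t => 1 / (t : ℝ) ^ (4 / 7 : ℝ) with hτ
  have hτT : 0 < τ T := one_div_pos.2 (Real.rpow_pos_of_pos hTpos _)
  -- The first pair absorbs the forcing terms `C γ⁴` and `C γ²`; the second pair starts the
  -- induction at `T`.
  set A : ℝ := max (max 1 (4 * C * G / c)) (max (w T / τ T) (f T / (η * τ T))) with hA
  have hA1 : 1 ≤ A := (le_max_left _ _).trans (le_max_left _ _)
  have hAC : 4 * C * G ≤ A * c :=
    (div_le_iff₀ hc).1 ((le_max_right _ _).trans (le_max_left _ _))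
  have hAw : w T ≤ A * τ T := (div_le_iff₀ hτT).1 ((le_max_left _ _).trans (le_max_right _ _))
  have hAf : f T ≤ A * (η * τ T) :=
    (div_le_iff₀ (by positivity)).1 ((le_max_right _ _).trans (le_max_right _ _))
  have key : ∀ t, T ≤ t → w t ≤ A * τ t ∧ f t ≤ A * (η * τ t) := by
    intro t ht
    induction t, ht using Nat.le_induction with
    | base => exact ⟨hAw, hAf⟩
    | succ t ht ih =>
      obtain ⟨⟨⟨⟨⟨⟨⟨h1, h2⟩, e1⟩, e2⟩, e3⟩, e4⟩, e5⟩, e6⟩ := hT t ht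
      have ht0 : (0 : ℝ) < t := by exact_mod_cast e6
      have hτ0 : 0 < τ t := one_div_pos.2 (Real.rpow_pos_of_pos ht0 _)
      have hγτ : γ t = G * τ t := by rw [hγ, hτ]; ring
      have hγ0 : 0 < γ t := by rw [hγτ]; positivity
      have hε0 : 0 < ε t := by rw [hε]; exact div_pos hE (Real.rpow_pos_of_pos ht0 _)
      have hstep : τ t * (1 - 1 / (t : ℝ)) ≤ τ (t + 1) :=
        inv_rpow_mul_one_sub_le e6 (by norm_num)
      have hcγ : c * γ t ≤ 1 := by rw [le_div_iff₀ hc] at e3; linarith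
      have hcγε : c * (γ t * ε t) ≤ 1 := by nlinarith
      have hinv : 1 / (t : ℝ) ≤ c / 2 * γ t := by
        refine e5.trans ?_
        have : γ t * ε t ≤ γ t := mul_le_of_le_one_right hγ0.le e2
        nlinarith
      have e4' : (C + C * G) * γ t ≤ η * c / 2 * ε t := by
        have h : γ t * (C + C * G + 1) ≤ η * c / 2 * ε t := by
          rw [div_mul_eq_mul_div, le_div_iff₀ (by positivity)] at e4
          exact e4
        nlinarith
      constructor
      · have a1 : (1 - c * γ t) * w t ≤ (1 - c * γ t) * (A * τ t) :=
          mul_le_mul_of_nonneg_left ih.1 (by linarith)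
        have a2 : C * γ t * f t ≤ C * γ t * (A * (η * τ t)) :=
          mul_le_mul_of_nonneg_left ih.2 (by positivity)
        have a3 : (A * τ t) * (1 / (t : ℝ)) ≤ (A * τ t) * (c / 2 * γ t) :=
          mul_le_mul_of_nonneg_left hinv (by positivity)
        have a4 : (C * η) * (γ t * A * τ t) ≤ c / 4 * (γ t * A * τ t) :=
          mul_le_mul_of_nonneg_right hCη (by positivity)
        have a5 : 4 * C * G * (γ t * τ t) ≤ A * c * (γ t * τ t) :=
          mul_le_mul_of_nonneg_right hAC (by positivity)
        have a6 : C * γ t ^ 2 = C * G * (γ t * τ t) := by rw [sq, hγτ]; ring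
        have a7 : A * (τ t * (1 - 1 / (t : ℝ))) ≤ A * τ (t + 1) :=
          mul_le_mul_of_nonneg_left hstep (by linarith)
        linarith
      · have a1 : (1 - c * (γ t * ε t)) * f t ≤ (1 - c * (γ t * ε t)) * (A * (η * τ t)) :=
          mul_le_mul_of_nonneg_left ih.2 (by linarith)
        have a2 : C * γ t ^ 2 * w t ≤ C * γ t ^ 2 * (A * τ t) :=
          mul_le_mul_of_nonneg_left ih.1 (by positivity)
        have a3 : (A * (η * τ t)) * (1 / (t : ℝ)) ≤ (A * (η * τ t)) * (c / 2 * (γ t * ε t)) :=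
          mul_le_mul_of_nonneg_left e5 (by positivity)
        -- Of the four factors `γ`, one is written `G τ` and another is bounded by `1 ≤ A`, so the
        -- forcing takes the same shape as the term driven by `w`.
        have a4 : C * γ t ^ 4 ≤ C * G * γ t * (γ t * (A * τ t)) := by
          have b1 : C * γ t ^ 4 = C * G * γ t * (γ t * τ t) * γ t := by
            rw [show γ t ^ 4 = γ t ^ 3 * γ t by ring]; nth_rewrite 2 [hγτ]; ring
          have b2 : C * G * γ t * (γ t * τ t) * γ t ≤ C * G * γ t * (γ t * τ t) * A :=
            mul_le_mul_of_nonneg_left (e1.trans hA1) (by positivity)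
          linarith
        have a5 : (C + C * G) * γ t * (γ t * (A * τ t)) ≤ η * c / 2 * ε t * (γ t * (A * τ t)) :=
          mul_le_mul_of_nonneg_right e4' (by positivity)
        have a7 : A * η * (τ t * (1 - 1 / (t : ℝ))) ≤ A * η * τ (t + 1) :=
          mul_le_mul_of_nonneg_left hstep (by positivity)
        linarith
  exact ⟨A, eventually_atTop.2 ⟨T, fun t ht => (key t ht).1⟩⟩

end StepSizes

/-! ### Projection onto the nonnegative orthant -/

section Projection

variable {n : ℕ}

theorem inner_dual_eq_sum (x y : Dual n) : ⟪x, y⟫ = ∑ j, x j * y j := by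
  simp [PiLp.inner_apply, mul_comm]

@[simp]
theorem projNonneg_apply (v : Dual n) (j : Fin n) : projNonneg v j = max (v j) 0 := rfl

theorem projNonneg_of_nonneg {v : Dual n} (hv : ∀ j, 0 ≤ v j) : projNonneg v = v :=
  PiLp.ext fun j => max_eq_left (hv j)

theorem norm_le_norm_of_abs_le {x y : Dual n} (h : ∀ j, |x j| ≤ |y j|) : ‖x‖ ≤ ‖y‖ := by
  rw [EuclideanSpace.norm_eq, EuclideanSpace.norm_eq]
  refine Real.sqrt_le_sqrt (Finset.sum_le_sum fun j _ => ?_)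
  rw [Real.norm_eq_abs, Real.norm_eq_abs]
  exact pow_le_pow_left₀ (abs_nonneg _) (h j) 2

theorem norm_projNonneg_sub_le (x y : Dual n) : ‖projNonneg x - projNonneg y‖ ≤ ‖x - y‖ :=
  norm_le_norm_of_abs_le fun j => by
    simpa using abs_max_sub_max_le_abs (x j) (y j) 0

theorem lipschitzWith_projNonneg : LipschitzWith 1 (projNonneg (n := n)) :=
  LipschitzWith.of_dist_le_mul fun x y => by
    simpa [dist_eq_norm] using norm_projNonneg_sub_le x y

theorem inner_projNonneg_sub_nonneg (x y : Dual n) :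
    0 ≤ ⟪projNonneg x - projNonneg y, x - y⟫ := by
  rw [inner_dual_eq_sum]
  refine Finset.sum_nonneg fun j _ => ?_
  simp only [PiLp.sub_apply, projNonneg_apply]
  rcases le_total (x j) (y j) with h | h
  · exact mul_nonneg_of_nonpos_of_nonpos (sub_nonpos.2 (max_le_max_right 0 h)) (sub_nonpos.2 h)
  · exact mul_nonneg (sub_nonneg.2 (max_le_max_right 0 h)) (sub_nonneg.2 h)

theorem inner_projNonneg_self (x : Dual n) : ⟪projNonneg x, x⟫ = ‖projNonneg x‖ ^ 2 := by
  rw [← real_inner_self_eq_norm_sq, inner_dual_eq_sum, inner_dual_eq_sum]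
  refine Finset.sum_congr rfl fun j _ => ?_
  rw [projNonneg_apply]
  rcases le_total (x j) 0 with h | h
  · simp [max_eq_right h]
  · simp [max_eq_left h]

theorem inner_nonpos_of_nonneg_of_nonpos {x y : Dual n} (hx : ∀ j, 0 ≤ x j) (hy : ∀ j, y j ≤ 0) :
    ⟪x, y⟫ ≤ 0 := by
  rw [inner_dual_eq_sum]
  exact Finset.sum_nonpos fun j _ => mul_nonpos_of_nonneg_of_nonpos (hx j) (hy j)

theorem norm_le_sum_of_nonneg {x : Dual n} (hx : ∀ j, 0 ≤ x j) : ‖x‖ ≤ ∑ j, x j := by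
  have hs : 0 ≤ ∑ j, x j := Finset.sum_nonneg fun j _ => hx j
  refine abs_le_of_sq_le_sq' ?_ hs |>.2
  rw [← real_inner_self_eq_norm_sq, inner_dual_eq_sum, sq, Finset.sum_mul]
  refine Finset.sum_le_sum fun j _ => mul_le_mul_of_nonneg_left ?_ (hx j)
  exact Finset.single_le_sum (fun i _ => hx i) (Finset.mem_univ j)

/-- A strictly negative vector bounds the norm of a nonnegative one through the inner product. -/
theorem exists_norm_le_neg_inner {g : Dual n} (hg : ∀ j, g j < 0) :
    ∃ δ : ℝ, 0 < δ ∧ ∀ p : Dual n, (∀ j, 0 ≤ p j) → δ * ‖p‖ ≤ -⟪p, g⟫ := by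
  obtain ⟨δ, hδ, hle⟩ : ∃ δ : ℝ, 0 < δ ∧ ∀ j, δ ≤ -g j := by
    rcases isEmpty_or_nonempty (Fin n) with h | h
    · exact ⟨1, one_pos, fun j => (IsEmpty.false j).elim⟩
    · obtain ⟨j₀, hj₀⟩ := Finite.exists_min fun j => -g j
      exact ⟨-g j₀, by linarith [hg j₀], hj₀⟩
  refine ⟨δ, hδ, fun p hp => ?_⟩
  calc δ * ‖p‖ ≤ δ * ∑ j, p j := mul_le_mul_of_nonneg_left (norm_le_sum_of_nonneg hp) hδ.le
    _ = ∑ j, p j * δ := by rw [Finset.mul_sum]; exact Finset.sum_congr rfl fun j _ => mul_comm _ _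
    _ ≤ ∑ j, p j * (-g j) := Finset.sum_le_sum fun j _ => mul_le_mul_of_nonneg_left (hle j) (hp j)
    _ = -⟪p, g⟫ := by rw [inner_dual_eq_sum, ← Finset.sum_neg_distrib]; simp

end Projection

/-! ### KKT points and Lagrange multipliers -/

section KKT

variable {n : ℕ} {V : Type*} [NormedAddCommGroup V] [InnerProductSpace ℝ V]

/-- For `τ = ν / R²` the map `a ↦ a - τ F a` is a contraction: the square of its Lipschitz constant
is at most `1 - 2τν + τ²R² = 1 - τν`. Its fixed point is the zero. Taking `R = |L| + ν` ensures `R >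
0` and `τν ≤ 1`. -/
theorem exists_zero_of_strongly_monotone [CompleteSpace V] {F : V → V} {ν L : ℝ} (hν : 0 < ν)
    (hmono : ∀ a b, ν * ‖a - b‖ ^ 2 ≤ ⟪F a - F b, a - b⟫)
    (hlip : ∀ a b, ‖F a - F b‖ ≤ L * ‖a - b‖) : ∃ a, F a = 0 := by
  set R : ℝ := |L| + ν with hR
  have hRpos : 0 < R := by positivity
  have hlipR : ∀ a b, ‖F a - F b‖ ≤ R * ‖a - b‖ := fun a b =>
    (hlip a b).trans (mul_le_mul_of_nonneg_right (by linarith [le_abs_self L]) (norm_nonneg _))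
  set τ : ℝ := ν / R ^ 2 with hτ
  have hτ0 : 0 < τ := by positivity
  have hτR : τ * R ^ 2 = ν := by rw [hτ]; field_simp
  have hq0 : 0 ≤ 1 - τ * ν := by
    have : ν ≤ R := by linarith [abs_nonneg L]
    have h2 : ν ^ 2 ≤ R ^ 2 := pow_le_pow_left₀ hν.le this 2
    have : τ * ν ≤ 1 := by
      rw [hτ, div_mul_eq_mul_div, div_le_one (by positivity)]
      linarith
    linarith
  have hcontr : ContractingWith (Real.toNNReal (Real.sqrt (1 - τ * ν))) (fun a => a - τ • F a) := by
    constructor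
    · rw [← NNReal.coe_lt_coe, Real.coe_toNNReal _ (Real.sqrt_nonneg _), NNReal.coe_one,
        Real.sqrt_lt' one_pos]
      nlinarith [mul_pos hτ0 hν]
    · refine LipschitzWith.of_dist_le_mul fun a b => ?_
      rw [Real.coe_toNNReal _ (Real.sqrt_nonneg _), dist_eq_norm, dist_eq_norm]
      refine abs_le_of_sq_le_sq' ?_ (by positivity) |>.2
      rw [mul_pow, Real.sq_sqrt hq0,
        show a - τ • F a - (b - τ • F b) = (a - b) - τ • (F a - F b) by
          rw [smul_sub]; abel, norm_sub_sq_real, inner_smul_right, norm_smul, mul_pow,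
        Real.norm_of_nonneg hτ0.le]
      have h1 := hmono a b
      rw [real_inner_comm] at h1
      have h2 : ‖F a - F b‖ ^ 2 ≤ R ^ 2 * ‖a - b‖ ^ 2 := by
        rw [← mul_pow]; exact pow_le_pow_left₀ (norm_nonneg _) (hlipR a b) 2
      have h3 : τ ^ 2 * ‖F a - F b‖ ^ 2 ≤ τ * ν * ‖a - b‖ ^ 2 := by
        calc τ ^ 2 * ‖F a - F b‖ ^ 2 ≤ τ ^ 2 * (R ^ 2 * ‖a - b‖ ^ 2) :=
              mul_le_mul_of_nonneg_left h2 (by positivity)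
          _ = τ * (τ * R ^ 2) * ‖a - b‖ ^ 2 := by ring
          _ = _ := by rw [hτR]
      nlinarith [mul_le_mul_of_nonneg_left h1 hτ0.le]
  have hfix := hcontr.fixedPoint_isFixedPt
  have h0 : τ • F (ContractingWith.fixedPoint _ hcontr) = 0 := by
    have := hfix.eq
    simpa using this
  exact ⟨_, (smul_eq_zero.1 h0).resolve_left hτ0.ne'⟩

variable [FiniteDimensional ℝ V]

/-- Lagrange multipliers for the gradient value `m` and the constraint value `g`. -/
def multiplierSet (K : V →L[ℝ] Dual n) (m : V) (g : Dual n) : Set (Dual n) :=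
  {p | (∀ j, 0 ≤ p j) ∧ K.adjoint p = -m ∧ ⟪p, g⟫ = 0}

/-- The zeros of the penalized maps `M + ε⁻¹ Kᵀ (K a - l)₊`. -/
theorem exists_penalized_zero {M : V → V} {ν L : ℝ} (hν : 0 < ν)
    (hmono : ∀ a b, ν * ‖a - b‖ ^ 2 ≤ ⟪M a - M b, a - b⟫)
    (hlip : ∀ a b, ‖M a - M b‖ ≤ L * ‖a - b‖) (K : V →L[ℝ] Dual n) (l : Dual n) {ε : ℝ}
    (hε : 0 < ε) :
    ∃ a : V, ∃ p : Dual n, ε • p = projNonneg (K a - l) ∧ M a + K.adjoint p = 0 := by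
  -- The penalty is `Kᵀ` applied to a monotone, nonexpansive function of `K a`, so it preserves
  -- strong monotonicity with the same `ν` and adds only a finite Lipschitz constant.
  obtain ⟨a, ha⟩ := exists_zero_of_strongly_monotone
    (F := fun a => M a + K.adjoint (ε⁻¹ • projNonneg (K a - l)))
    (L := L + ‖K.adjoint‖ * (ε⁻¹ * ‖K‖)) hν
    (fun a b => by
      have h := inner_projNonneg_sub_nonneg (K a - l) (K b - l)
      rw [sub_sub_sub_cancel_right, ← map_sub] at h
      have e : M a + K.adjoint (ε⁻¹ • projNonneg (K a - l)) -
          (M b + K.adjoint (ε⁻¹ • projNonneg (K b - l))) = (M a - M b) +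
          K.adjoint (ε⁻¹ • (projNonneg (K a - l) - projNonneg (K b - l))) := by
        rw [smul_sub, map_sub]; abel
      rw [e, inner_add_left, ContinuousLinearMap.adjoint_inner_left, real_inner_smul_left]
      have := mul_nonneg (inv_nonneg.2 hε.le) h
      linarith [hmono a b])
    (fun a b => by
      have h := norm_projNonneg_sub_le (K a - l) (K b - l)
      rw [sub_sub_sub_cancel_right, ← map_sub] at h
      have e : M a + K.adjoint (ε⁻¹ • projNonneg (K a - l)) -
          (M b + K.adjoint (ε⁻¹ • projNonneg (K b - l))) = (M a - M b) +
          K.adjoint (ε⁻¹ • (projNonneg (K a - l) - projNonneg (K b - l))) := by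
        rw [smul_sub, map_sub]; abel
      rw [e]
      refine (norm_add_le _ _).trans ?_
      rw [add_mul]
      refine add_le_add (hlip a b) ((K.adjoint.le_opNorm _).trans ?_)
      rw [norm_smul, Real.norm_of_nonneg (inv_nonneg.2 hε.le), mul_assoc, mul_assoc]
      gcongr
      exact h.trans (K.le_opNorm _))
  exact ⟨a, ε⁻¹ • projNonneg (K a - l), by rw [smul_smul, mul_inv_cancel₀ hε.ne', one_smul], ha⟩

/-- The penalty method with `ε = 1/(k+1)`. Testing the penalized equation at a Slater point bounds
both the zeros and the penalty forces, so a subsequence converges, and its limit is a feasible point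
with a multiplier. -/
theorem exists_kkt_point {M : V → V} {ν L : ℝ} (hν : 0 < ν)
    (hmono : ∀ a b, ν * ‖a - b‖ ^ 2 ≤ ⟪M a - M b, a - b⟫)
    (hlip : ∀ a b, ‖M a - M b‖ ≤ L * ‖a - b‖) (hcont : Continuous M)
    (K : V →L[ℝ] Dual n) (l : Dual n) (hslater : ∃ a₀, ∀ j, (K a₀ - l) j < 0) :
    ∃ a : V, (∀ j, (K a - l) j ≤ 0) ∧ (multiplierSet K (M a) (K a - l)).Nonempty := by
  obtain ⟨a₀, ha₀⟩ := hslater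
  obtain ⟨δ, hδ, hδle⟩ := exists_norm_le_neg_inner ha₀
  have hε : ∀ k : ℕ, (0 : ℝ) < 1 / ((k : ℝ) + 1) := fun k => Nat.one_div_pos_of_nat
  choose a p hp hz using fun k : ℕ => exists_penalized_zero hν hmono hlip K l (hε k)
  have hp0 : ∀ k j, 0 ≤ p k j := fun k j => by
    have h1 : 1 / ((k : ℝ) + 1) * p k j = max ((K (a k) - l) j) 0 := by
      rw [← projNonneg_apply, ← hp k]; rfl
    exact nonneg_of_mul_nonneg_right (h1 ▸ le_max_right _ _) (hε k)
  have hcomp : ∀ k, ⟪p k, K (a k) - l⟫ = 1 / ((k : ℝ) + 1) * ‖p k‖ ^ 2 := fun k => by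
    have h := inner_projNonneg_self (K (a k) - l)
    rw [← hp k, real_inner_smul_left, norm_smul, mul_pow, Real.norm_of_nonneg (hε k).le] at h
    refine mul_left_cancel₀ (hε k).ne' ?_
    rw [h]; ring
  -- Complementarity holds only up to `ε‖p‖²`, but this error is nonnegative and can be dropped. The
  -- strict slack at `a₀` is what makes `‖p k‖` appear on the left.
  have hbound : ∀ k, ν * ‖a k - a₀‖ ^ 2 + δ * ‖p k‖ ≤ ‖M a₀‖ * ‖a k - a₀‖ := fun k => by
    have h1 := hmono (a k) a₀
    have h2 : ⟪M (a k), a k - a₀⟫ = -(⟪p k, K (a k) - l⟫ - ⟪p k, K a₀ - l⟫) := by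
      rw [← inner_sub_right, sub_sub_sub_cancel_right, ← map_sub,
        ← ContinuousLinearMap.adjoint_inner_left, ← inner_neg_left,
        eq_neg_of_add_eq_zero_left (hz k)]
    rw [inner_sub_left, h2, hcomp k] at h1
    have h3 : -⟪M a₀, a k - a₀⟫ ≤ ‖M a₀‖ * ‖a k - a₀‖ :=
      (neg_le_abs _).trans (abs_real_inner_le_norm _ _)
    have h4 := hδle (p k) (hp0 k)
    have h5 : 0 ≤ 1 / ((k : ℝ) + 1) * ‖p k‖ ^ 2 := by positivity
    linarith
  have ha_bound : ∀ k, ‖a k - a₀‖ ≤ ‖M a₀‖ / ν := fun k => by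
    rw [le_div_iff₀ hν]
    have h1 := hbound k
    have h2 : 0 ≤ δ * ‖p k‖ := by positivity
    rcases (norm_nonneg (a k - a₀)).eq_or_lt with h | h
    · rw [← h]; simp
    · refine le_of_mul_le_mul_right ?_ h
      nlinarith
  have hp_bound : ∀ k, ‖p k‖ ≤ ‖M a₀‖ * (‖M a₀‖ / ν) / δ := fun k => by
    rw [le_div_iff₀ hδ]
    have h1 := hbound k
    have h2 : 0 ≤ ν * ‖a k - a₀‖ ^ 2 := by positivity
    have h3 := mul_le_mul_of_nonneg_left (ha_bound k) (norm_nonneg (M a₀))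
    linarith
  obtain ⟨⟨a', p'⟩, -, φ, hφ, hlim⟩ := tendsto_subseq_of_bounded
    (x := fun k => (a k, p k)) (Metric.isBounded_closedBall.prod Metric.isBounded_closedBall)
    (fun k => Set.mk_mem_prod (mem_closedBall_iff_norm.2 (ha_bound k))
      (mem_closedBall_zero_iff.2 (hp_bound k)))
  have hla : Tendsto (fun k => a (φ k)) atTop (nhds a') := (continuous_fst.tendsto _).comp hlim
  have hlp : Tendsto (fun k => p (φ k)) atTop (nhds p') := (continuous_snd.tendsto _).comp hlim
  have hlε : Tendsto (fun k => 1 / ((φ k : ℝ) + 1)) atTop (nhds 0) :=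
    tendsto_one_div_add_atTop_nhds_zero_nat.comp hφ.tendsto_atTop
  have hlg : Tendsto (fun k => K (a (φ k)) - l) atTop (nhds (K a' - l)) :=
    ((K.continuous.tendsto _).comp hla).sub_const l
  -- The constraint violation equals `ε p` with `p` bounded, so it vanishes in the limit.
  have hproj : projNonneg (K a' - l) = 0 := by
    have h1 : Tendsto (fun k => projNonneg (K (a (φ k)) - l)) atTop
        (nhds (projNonneg (K a' - l))) :=
      (lipschitzWith_projNonneg.continuous.tendsto _).comp hlg
    have h2 : Tendsto (fun k => (1 / ((φ k : ℝ) + 1)) • p (φ k)) atTop (nhds ((0 : ℝ) • p')) :=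
      hlε.smul hlp
    rw [zero_smul] at h2
    refine tendsto_nhds_unique h1 (h2.congr fun k => hp (φ k))
  refine ⟨a', fun j => ?_, p', fun j => ?_, ?_, ?_⟩
  · have h : max ((K a' - l) j) 0 = 0 := by rw [← projNonneg_apply, hproj]; rfl
    exact h ▸ le_max_left _ _
  · have hc : Continuous fun x : Dual n => x j := by fun_prop
    exact ge_of_tendsto' ((hc.tendsto _).comp hlp) fun k => hp0 _ j
  · have h1 : Tendsto (fun k => M (a (φ k)) + K.adjoint (p (φ k))) atTop
        (nhds (M a' + K.adjoint p')) :=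
      ((hcont.tendsto _).comp hla).add ((K.adjoint.continuous.tendsto _).comp hlp)
    have h2 : M a' + K.adjoint p' = 0 :=
      tendsto_nhds_unique h1 (tendsto_const_nhds.congr fun k => (hz (φ k)).symm)
    exact eq_neg_of_add_eq_zero_right h2
  · have h1 : Tendsto (fun k => ⟪p (φ k), K (a (φ k)) - l⟫) atTop (nhds ⟪p', K a' - l⟫) :=
      hlp.inner hlg
    have h2 : Tendsto (fun k => 1 / ((φ k : ℝ) + 1) * ‖p (φ k)‖ ^ 2) atTop
        (nhds (0 * ‖p'‖ ^ 2)) := hlε.mul (hlp.norm.pow 2)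
    rw [zero_mul] at h2
    exact tendsto_nhds_unique h1 (h2.congr fun k => (hcomp (φ k)).symm)

/-- Slater's condition bounds the multipliers. -/
theorem exists_multiplier_bound (K : V →L[ℝ] Dual n) (l : Dual n) (m a : V)
    (hslater : ∃ a₀, ∀ j, (K a₀ - l) j < 0) :
    ∃ R : ℝ, 0 ≤ R ∧ ∀ p ∈ multiplierSet K m (K a - l), ‖p‖ ≤ R := by
  obtain ⟨a₀, ha₀⟩ := hslater
  obtain ⟨δ, hδ, hδle⟩ := exists_norm_le_neg_inner ha₀
  refine ⟨‖m‖ * ‖a₀ - a‖ / δ, by positivity, fun p hp => ?_⟩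
  rw [le_div_iff₀ hδ]
  have h1 := hδle p hp.1
  -- By stationarity and complementarity this product does not depend on the multiplier, while
  -- `hδle` bounds `δ‖p‖` by its negative.
  have h2 : ⟪p, K a₀ - l⟫ = -⟪m, a₀ - a⟫ := by
    rw [← inner_neg_left, ← hp.2.1, ContinuousLinearMap.adjoint_inner_left, map_sub,
      show K a₀ - l = (K a₀ - K a) + (K a - l) by abel, inner_add_right, hp.2.2, add_zero]
  have h3 : ⟪m, a₀ - a⟫ ≤ ‖m‖ * ‖a₀ - a‖ := real_inner_le_norm _ _
  linarith

theorem isClosed_multiplierSet (K : V →L[ℝ] Dual n) (m : V) (g : Dual n) :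
    IsClosed (multiplierSet K m g) := by
  refine IsClosed.inter ?_ (IsClosed.inter ?_ ?_)
  · show IsClosed {p : Dual n | ∀ j, 0 ≤ p j}
    rw [Set.ofPred_forall]
    exact isClosed_iInter fun j => isClosed_le continuous_const (by fun_prop)
  · exact isClosed_eq K.adjoint.continuous continuous_const
  · exact isClosed_eq (by fun_prop) continuous_const

/-- Error bound for the distance to the multiplier set. -/
theorem exists_multiplier_error_bound (K : V →L[ℝ] Dual n) (m : V) (g : Dual n)
    (hg : ∀ j, g j ≤ 0) (hne : (multiplierSet K m g).Nonempty) :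
    ∃ H : ℝ, 0 ≤ H ∧ ∀ x : Dual n, (∀ j, 0 ≤ x j) →
      Metric.infDist x (multiplierSet K m g) ≤ H * (‖K.adjoint x + m‖ + (-⟪x, g⟫)) := by
  obtain ⟨y, hy1, hy2, hy3⟩ := hne
  -- With stationarity and complementarity stacked into one linear map, the multiplier set is a
  -- fibre of that map within the orthant.
  obtain ⟨H, hH0, hH⟩ := hoffman_bound
    (((K.adjoint : Dual n →L[ℝ] V).prod (innerSL ℝ g)) : Dual n →ₗ[ℝ] V × ℝ)
  refine ⟨H, hH0, fun x hx => ?_⟩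
  obtain ⟨p, hp0, hp, hle⟩ := hH x y hx hy1
  have hpy : K.adjoint p = K.adjoint y ∧ ⟪g, p⟫ = ⟪g, y⟫ := by simpa using hp
  have hmem : p ∈ multiplierSet K m g :=
    ⟨hp0, hpy.1.trans hy2, by rw [real_inner_comm, hpy.2, real_inner_comm, hy3]⟩
  refine (Metric.infDist_le_dist_of_mem hmem).trans ?_
  rw [dist_eq_norm]
  refine hle.trans (mul_le_mul_of_nonneg_left ?_ hH0)
  have hxg : ⟪x, g⟫ ≤ 0 := inner_nonpos_of_nonneg_of_nonpos hx hg
  rw [← map_sub]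
  show ‖(K.adjoint (x - y), ⟪g, x - y⟫)‖ ≤ _
  rw [Prod.norm_mk, map_sub, hy2, sub_neg_eq_add, inner_sub_right, real_inner_comm,
    real_inner_comm y g, hy3, sub_zero, Real.norm_of_nonpos hxg]
  exact max_le (by linarith) (by linarith [norm_nonneg (K.adjoint x + m)])

end KKT

/-! ### Gaussian integration by parts and moments -/

section Gaussian

theorem hasDerivAt_gaussianPDFReal_std (x : ℝ) :
    HasDerivAt (gaussianPDFReal 0 1) (-x * gaussianPDFReal 0 1 x) x := by
  have h : HasDerivAt (fun x : ℝ => (Real.sqrt (2 * Real.pi * (1 : NNReal)))⁻¹ *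
      Real.exp (-(x - 0) ^ 2 / (2 * (1 : NNReal))))
      ((Real.sqrt (2 * Real.pi * (1 : NNReal)))⁻¹ *
        (Real.exp (-(x - 0) ^ 2 / (2 * (1 : NNReal))) * (-x))) x := by
    refine HasDerivAt.const_mul _ (HasDerivAt.exp ?_)
    have h1 : HasDerivAt (fun x : ℝ => -(x - 0) ^ 2 / (2 * (1 : NNReal)))
        (-(((2 : ℕ) : ℝ) * (x - 0) ^ (2 - 1) * 1) / (2 * (1 : NNReal))) x :=
      ((((hasDerivAt_id x).sub_const 0).pow 2).neg).div_const _
    convert h1 using 1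
    simp
    ring
  rw [gaussianPDFReal_def]
  convert h using 1
  ring

theorem integrable_gaussianReal_std_iff {f : ℝ → ℝ} :
    Integrable f (gaussianReal 0 1) ↔ Integrable (fun x => gaussianPDFReal 0 1 x * f x) := by
  rw [gaussianReal_of_var_ne_zero 0 one_ne_zero,
    integrable_withDensity_iff_integrable_smul' (measurable_gaussianPDF 0 1)
      (ae_of_all _ fun x => gaussianPDF_lt_top)]
  simp [toReal_gaussianPDF]

/-- Gaussian integration by parts on the line. -/
theorem integral_deriv_gaussianReal_std {f f' : ℝ → ℝ} (hf : ∀ x, HasDerivAt f (f' x) x)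
    (h0 : Integrable f (gaussianReal 0 1)) (h1 : Integrable f' (gaussianReal 0 1))
    (h2 : Integrable (fun x => x * f x) (gaussianReal 0 1)) :
    ∫ x, f' x ∂gaussianReal 0 1 = ∫ x, x * f x ∂gaussianReal 0 1 := by
  rw [integrable_gaussianReal_std_iff] at h0 h1 h2
  rw [integral_gaussianReal_eq_integral_smul one_ne_zero,
    integral_gaussianReal_eq_integral_smul one_ne_zero]
  have h := integral_mul_deriv_eq_deriv_mul_of_integrable (u := f) (u' := f')
    (v := gaussianPDFReal 0 1) (v' := fun x => -x * gaussianPDFReal 0 1 x) (fun x _ => hf x)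
    (fun x _ => hasDerivAt_gaussianPDFReal_std x)
    (h2.neg.congr (ae_of_all _ fun x => by simp; ring))
    (h1.congr (ae_of_all _ fun x => by simp; ring))
    (h0.congr (ae_of_all _ fun x => by simp; ring))
  calc ∫ x, gaussianPDFReal 0 1 x • f' x = ∫ x, f' x * gaussianPDFReal 0 1 x :=
        integral_congr_ae (ae_of_all _ fun x => by simp [mul_comm])
    _ = -∫ x, f x * (-x * gaussianPDFReal 0 1 x) := by rw [h, neg_neg]
    _ = ∫ x, gaussianPDFReal 0 1 x • (x * f x) := by
        rw [← integral_neg]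
        exact integral_congr_ae (ae_of_all _ fun x => by simp only [smul_eq_mul]; ring)

variable {ι : Type*} [Fintype ι]

/-- The standard Gaussian law on `ι → ℝ`. -/
abbrev stdGaussianPi (ι : Type*) [Fintype ι] : Measure (ι → ℝ) :=
  Measure.pi fun _ : ι => gaussianReal 0 1

/-- Resampling one coordinate leaves the product law unchanged. Fubini can then isolate that
coordinate without splitting the index type. -/
theorem measurePreserving_update [DecidableEq ι] (p : ι) :
    MeasurePreserving (fun x : (ι → ℝ) × ℝ => Function.update x.1 p x.2)
      ((stdGaussianPi ι).prod (gaussianReal 0 1)) (stdGaussianPi ι) := by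
  have hm : Measurable (fun x : (ι → ℝ) × ℝ => Function.update x.1 p x.2) := by
    rw [measurable_pi_iff]
    intro i
    by_cases h : i = p
    · subst h; simpa using measurable_snd
    · simp only [Function.update_of_ne h]
      exact (measurable_pi_apply i).comp measurable_fst
  refine ⟨hm, (Measure.pi_eq fun s hs => ?_).symm⟩
  rw [Measure.map_apply hm (MeasurableSet.univ_pi hs)]
  have hpre : (fun x : (ι → ℝ) × ℝ => Function.update x.1 p x.2) ⁻¹' Set.univ.pi s =
      (Set.univ.pi (Function.update s p Set.univ)) ×ˢ s p := by
    ext ⟨z, y⟩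
    simp only [Set.mem_preimage, Set.mem_univ_pi, Set.mem_prod]
    constructor
    · intro h
      refine ⟨fun i => ?_, by simpa using h p⟩
      by_cases hi : i = p
      · subst hi; simp
      · simpa [Function.update_of_ne hi] using h i
    · rintro ⟨h1, h2⟩ i
      by_cases hi : i = p
      · subst hi; simpa using h2
      · simpa [Function.update_of_ne hi] using h1 i
  rw [hpre, Measure.prod_prod, Measure.pi_pi, ← Finset.mul_prod_erase _ _ (Finset.mem_univ p),
    ← Finset.mul_prod_erase (Finset.univ) (fun i => gaussianReal 0 1 (s i)) (Finset.mem_univ p)]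
  simp only [Function.update_self, measure_univ, one_mul]
  rw [mul_comm]
  congr 1
  refine Finset.prod_congr rfl fun i hi => ?_
  rw [Function.update_of_ne (Finset.ne_of_mem_erase hi)]

/-- Gaussian integration by parts in the coordinate `p`. -/
theorem integral_partialDeriv_stdGaussianPi [DecidableEq ι] (p : ι) {f f' : (ι → ℝ) → ℝ}
    (hf : ∀ z y, HasDerivAt (fun y => f (Function.update z p y)) (f' (Function.update z p y)) y)
    (h0 : Integrable f (stdGaussianPi ι)) (h1 : Integrable f' (stdGaussianPi ι))
    (h2 : Integrable (fun z => z p * f z) (stdGaussianPi ι)) :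
    ∫ z, f' z ∂stdGaussianPi ι = ∫ z, z p * f z ∂stdGaussianPi ι := by
  have hmp := measurePreserving_update (ι := ι) p
  have key : ∀ F : (ι → ℝ) → ℝ, Integrable F (stdGaussianPi ι) →
      (∀ᵐ z ∂stdGaussianPi ι,
        Integrable (fun y => F (Function.update z p y)) (gaussianReal 0 1)) ∧
      ∫ z, F z ∂stdGaussianPi ι =
        ∫ z, ∫ y, F (Function.update z p y) ∂gaussianReal 0 1 ∂stdGaussianPi ι := by
    intro F hF
    have hi : Integrable (fun x : (ι → ℝ) × ℝ => F (Function.update x.1 p x.2))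
        ((stdGaussianPi ι).prod (gaussianReal 0 1)) := hmp.integrable_comp_of_integrable hF
    refine ⟨hi.prod_right_ae, ?_⟩
    rw [← integral_prod _ hi, ← integral_map hmp.measurable.aemeasurable
      (by rw [hmp.map_eq]; exact hF.aestronglyMeasurable), hmp.map_eq]
  obtain ⟨i0, -⟩ := key f h0
  obtain ⟨i1, e1⟩ := key f' h1
  obtain ⟨i2, e2⟩ := key _ h2
  rw [e1, e2]
  refine integral_congr_ae ?_
  filter_upwards [i0, i1, i2] with z a0 a1 a2
  simp only [Function.update_self] at a2 ⊢
  exact integral_deriv_gaussianReal_std (hf z) a0 a1 a2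

theorem memLp_eval_stdGaussianPi (p : ι) (k : ENNReal) (hk : k ≠ ⊤) :
    MemLp (fun z : ι → ℝ => z p) k (stdGaussianPi ι) :=
  (memLp_id_gaussianReal' (μ := 0) (v := 1) k hk).comp_measurePreserving
    (μ := stdGaussianPi ι) (f := Function.eval p)
    (measurePreserving_eval (fun _ : ι => gaussianReal 0 1) p)

theorem norm_toLp_le_sum (z : ι → ℝ) : ‖WithLp.toLp 2 z‖ ≤ ∑ p, |z p| := by
  have hs : 0 ≤ ∑ p, |z p| := Finset.sum_nonneg fun j _ => abs_nonneg _
  refine abs_le_of_sq_le_sq' ?_ hs |>.2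
  rw [EuclideanSpace.norm_sq_eq, sq, Finset.sum_mul]
  refine Finset.sum_le_sum fun j _ => ?_
  simp only [Real.norm_eq_abs]
  rw [sq]
  exact mul_le_mul_of_nonneg_left
    (Finset.single_le_sum (f := fun p => |z p|) (fun i _ => abs_nonneg _) (Finset.mem_univ j))
    (abs_nonneg _)

theorem measurable_toLp_pi : Measurable fun z : ι → ℝ => (WithLp.toLp 2 z : EuclideanSpace ℝ ι) :=
  (PiLp.continuous_toLp 2 (fun _ : ι => ℝ)).measurable

theorem integrable_one_add_norm_pow_stdGaussianPi (k : ℕ) :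
    Integrable (fun z : ι → ℝ => (1 + ‖(WithLp.toLp 2 z : EuclideanSpace ℝ ι)‖) ^ k)
      (stdGaussianPi ι) := by
  have h1 : MemLp (fun z : ι → ℝ => 1 + ∑ p, |z p|) k (stdGaussianPi ι) := by
    have h2 : MemLp (fun z : ι → ℝ => ∑ p, |z p|) k (stdGaussianPi ι) :=
      memLp_finsetSum Finset.univ (f := fun p (z : ι → ℝ) => |z p|) fun p _ =>
        (memLp_eval_stdGaussianPi p k (ENNReal.natCast_ne_top k)).norm
    exact (memLp_const (1 : ℝ)).add h2
  refine h1.integrable_norm_pow'.mono'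
    ((measurable_const.add measurable_toLp_pi.norm).pow_const k).aestronglyMeasurable
    (ae_of_all _ fun z => ?_)
  have hs : 0 ≤ ∑ p, |z p| := Finset.sum_nonneg fun j _ => abs_nonneg _
  rw [Real.norm_of_nonneg (by positivity), Real.norm_of_nonneg (by positivity)]
  gcongr
  exact norm_toLp_le_sum z

theorem integral_eval_stdGaussianPi (p : ι) : ∫ z, z p ∂stdGaussianPi ι = 0 := by
  have hmp := measurePreserving_eval (fun _ : ι => gaussianReal 0 1) p
  have : ∫ z, z p ∂stdGaussianPi ι = ∫ y, y ∂gaussianReal 0 1 := by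
    rw [← hmp.map_eq, integral_map hmp.measurable.aemeasurable (by fun_prop)]
  rw [this, integral_id_gaussianReal]

end Gaussian

/-! ### The Lyapunov function and its change in one step -/

section System

/-- A strongly monotone Lipschitz map `M` with affine constraints `K a ≤ l`, a feasible point
`aStar` with a nonempty set of Lagrange multipliers, a bound `R` for the multipliers and an error
bound constant `H` for the multiplier set. -/
structure PrimalDualSystem (V : Type*) [NormedAddCommGroup V] [InnerProductSpace ℝ V]
    [FiniteDimensional ℝ V] (n : ℕ) where
  M : V → V
  K : V →L[ℝ] Dual n
  l : Dual n
  aStar : V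
  ν : ℝ
  L : ℝ
  R : ℝ
  H : ℝ
  ν_pos : 0 < ν
  L_nonneg : 0 ≤ L
  R_nonneg : 0 ≤ R
  H_nonneg : 0 ≤ H
  mono : ∀ a b, ν * ‖a - b‖ ^ 2 ≤ ⟪M a - M b, a - b⟫
  lip : ∀ a b, ‖M a - M b‖ ≤ L * ‖a - b‖
  feasible : ∀ j, (K aStar - l) j ≤ 0
  nonempty : (multiplierSet K (M aStar) (K aStar - l)).Nonempty
  norm_le : ∀ p ∈ multiplierSet K (M aStar) (K aStar - l), ‖p‖ ≤ R
  error_bound : ∀ x : Dual n, (∀ j, 0 ≤ x j) →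
    Metric.infDist x (multiplierSet K (M aStar) (K aStar - l)) ≤
      H * (‖K.adjoint x + M aStar‖ + (-⟪x, K aStar - l⟫))

namespace PrimalDualSystem

variable {n : ℕ} {V : Type*} [NormedAddCommGroup V] [InnerProductSpace ℝ V]
  [FiniteDimensional ℝ V] (S : PrimalDualSystem V n)

/-- The constraint value at the solution. -/
def g : Dual n := S.K S.aStar - S.l

/-- The set of Lagrange multipliers of the solution. -/
def mult : Set (Dual n) := multiplierSet S.K (S.M S.aStar) S.g

/-- Distance to the multipliers. -/
def dualDist (x : Dual n) : ℝ := Metric.infDist x S.mult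

/-- Dual variables shrunk by the slack of the constraints at the solution. -/
def shrink (x : Dual n) : Dual n := projNonneg (x + S.g)

/-- Primal residual of the shrunk dual variable. -/
def residual (x : Dual n) : V := S.K.adjoint (S.shrink x) + S.M S.aStar

/-- Violation of complementarity at the solution. -/
def compl (x : Dual n) : ℝ := -⟪x, S.g⟫

/-- The Lyapunov function, with weight `κ` of the cross term; `u` is the primal error. -/
def lyapunov (κ : ℝ) (u : V) (x : Dual n) : ℝ :=
  ‖u‖ ^ 2 + S.dualDist x ^ 2 + κ * ⟪u, S.residual x⟫

theorem g_nonpos (j : Fin n) : S.g j ≤ 0 := S.feasible j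

theorem dualDist_nonneg (x : Dual n) : 0 ≤ S.dualDist x := Metric.infDist_nonneg

theorem compl_nonneg {x : Dual n} (hx : ∀ j, 0 ≤ x j) : 0 ≤ S.compl x :=
  neg_nonneg.2 (inner_nonpos_of_nonneg_of_nonpos hx S.g_nonpos)

theorem exists_nearest (x : Dual n) : ∃ p ∈ S.mult, S.dualDist x = ‖x - p‖ := by
  obtain ⟨p, hp, h⟩ :=
    (isClosed_multiplierSet S.K (S.M S.aStar) S.g).exists_infDist_eq_dist S.nonempty x
  exact ⟨p, hp, by rw [← dist_eq_norm]; exact h⟩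

theorem dualDist_le {p : Dual n} (hp : p ∈ S.mult) (x : Dual n) : S.dualDist x ≤ ‖x - p‖ := by
  rw [← dist_eq_norm]
  exact Metric.infDist_le_dist_of_mem hp

theorem norm_le_dualDist_add (x : Dual n) : ‖x‖ ≤ S.dualDist x + S.R := by
  obtain ⟨p, hp, hd⟩ := S.exists_nearest x
  have h := norm_add_le (x - p) p
  rw [sub_add_cancel] at h
  linarith [S.norm_le p hp]

theorem shrink_apply (x : Dual n) (j : Fin n) : S.shrink x j = max (x j + S.g j) 0 := rfl

/-- For a multiplier the terms `p j * g j` have one sign and sum to 0, so each vanishes: either `p j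
= 0`, or there is no slack to subtract. -/
theorem shrink_of_mem {p : Dual n} (hp : p ∈ S.mult) : S.shrink p = p := by
  have h0 : ∀ j, p j * S.g j = 0 := by
    have h := hp.2.2
    rw [inner_dual_eq_sum] at h
    intro j
    exact (Finset.sum_eq_zero_iff_of_nonpos fun i _ =>
      mul_nonpos_of_nonneg_of_nonpos (hp.1 i) (S.g_nonpos i)).1 h j (Finset.mem_univ j)
  refine PiLp.ext fun j => ?_
  rw [shrink_apply]
  rcases mul_eq_zero.1 (h0 j) with h | h
  · rw [h, zero_add, max_eq_right (S.g_nonpos j)]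
  · rw [h, add_zero, max_eq_left (hp.1 j)]

theorem norm_shrink_sub_le (x y : Dual n) : ‖S.shrink x - S.shrink y‖ ≤ ‖x - y‖ := by
  simpa [shrink] using norm_projNonneg_sub_le (x + S.g) (y + S.g)

theorem residual_eq {p : Dual n} (hp : p ∈ S.mult) (x : Dual n) :
    S.residual x = S.K.adjoint (S.shrink x - p) := by
  rw [residual, map_sub, hp.2.1, sub_neg_eq_add]

theorem norm_adjoint_le (y : Dual n) : ‖S.K.adjoint y‖ ≤ ‖S.K‖ * ‖y‖ := by
  simpa using S.K.adjoint.le_opNorm y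

/-- Shrinking is nonexpansive and fixes the nearest multiplier, where the residual is 0. -/
theorem norm_residual_le (x : Dual n) : ‖S.residual x‖ ≤ ‖S.K‖ * S.dualDist x := by
  obtain ⟨p, hp, hd⟩ := S.exists_nearest x
  rw [S.residual_eq hp, hd]
  refine (S.norm_adjoint_le _).trans (mul_le_mul_of_nonneg_left ?_ (norm_nonneg _))
  have := S.norm_shrink_sub_le x p
  rwa [S.shrink_of_mem hp] at this

theorem sub_shrink_apply (x : Dual n) (j : Fin n) : (x - S.shrink x) j = min (x j) (-S.g j) := by
  rw [PiLp.sub_apply, shrink_apply]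
  rcases le_total (x j + S.g j) 0 with h | h
  · rw [max_eq_right h, min_eq_left (by linarith)]; ring
  · rw [max_eq_left h, min_eq_right (by linarith)]; ring

/-- What shrinking removes in a coordinate is `min (x j) (-g j)`, whose square is at most the
product of its two arguments. Replacing `x` by its shrunk version is thus paid for by the
complementarity dissipation. -/
theorem sq_norm_sub_shrink_le {x : Dual n} (hx : ∀ j, 0 ≤ x j) :
    ‖x - S.shrink x‖ ^ 2 ≤ S.compl x := by
  rw [← real_inner_self_eq_norm_sq, compl, inner_dual_eq_sum, inner_dual_eq_sum,
    ← Finset.sum_neg_distrib]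
  refine Finset.sum_le_sum fun j _ => ?_
  rw [sub_shrink_apply]
  have h0 : 0 ≤ min (x j) (-S.g j) := le_min (hx j) (neg_nonneg.2 (S.g_nonpos j))
  calc min (x j) (-S.g j) * min (x j) (-S.g j) ≤ x j * -S.g j :=
        mul_le_mul (min_le_left _ _) (min_le_right _ _) h0 (hx j)
    _ = _ := by ring

theorem norm_sub_shrink_le {x : Dual n} (hx : ∀ j, 0 ≤ x j) : ‖x - S.shrink x‖ ≤ ‖S.g‖ :=
  norm_le_norm_of_abs_le fun j => by
    have h0 : 0 ≤ min (x j) (-S.g j) := le_min (hx j) (neg_nonneg.2 (S.g_nonpos j))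
    rw [sub_shrink_apply, abs_of_nonneg h0, abs_of_nonpos (S.g_nonpos j)]
    exact min_le_right _ _

theorem compl_le_dualDist (x : Dual n) : S.compl x ≤ ‖S.g‖ * S.dualDist x := by
  obtain ⟨p, hp, hd⟩ := S.exists_nearest x
  have h : S.compl x = -⟪x - p, S.g⟫ := by rw [compl, inner_sub_left, hp.2.2, sub_zero]
  rw [h, hd, mul_comm]
  exact (neg_le_abs _).trans (abs_real_inner_le_norm _ _)

theorem dualDist_le_residual {x : Dual n} (hx : ∀ j, 0 ≤ x j) :
    S.dualDist x ≤ S.H * (‖S.residual x‖ + ‖S.K‖ * ‖x - S.shrink x‖ + S.compl x) := by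
  refine (S.error_bound x hx).trans (mul_le_mul_of_nonneg_left ?_ S.H_nonneg)
  have h : S.K.adjoint x + S.M S.aStar = S.residual x + S.K.adjoint (x - S.shrink x) := by
    rw [residual, map_sub]; abel
  rw [h]
  have h1 := norm_add_le (S.residual x) (S.K.adjoint (x - S.shrink x))
  have h2 := S.norm_adjoint_le (x - S.shrink x)
  have h3 : -⟪x, S.K S.aStar - S.l⟫ = S.compl x := rfl
  linarith

/-- The condition `κ * ‖K‖ ≤ 1` makes the Lyapunov function equivalent to the sum of the two squared
distances. -/
theorem abs_cross_le {κ : ℝ} (hκ : 0 ≤ κ) (hκK : κ * ‖S.K‖ ≤ 1) (u : V) (x : Dual n) :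
    |κ * ⟪u, S.residual x⟫| ≤ (‖u‖ ^ 2 + S.dualDist x ^ 2) / 2 := by
  rw [abs_mul, abs_of_nonneg hκ]
  have h1 : |⟪u, S.residual x⟫| ≤ ‖u‖ * (‖S.K‖ * S.dualDist x) :=
    (abs_real_inner_le_norm _ _).trans
      (mul_le_mul_of_nonneg_left (S.norm_residual_le x) (norm_nonneg _))
  have h2 := mul_le_mul_of_nonneg_left h1 hκ
  have h3 : 0 ≤ ‖u‖ * S.dualDist x := mul_nonneg (norm_nonneg _) (S.dualDist_nonneg x)
  nlinarith [sq_nonneg (‖u‖ - S.dualDist x), mul_le_mul_of_nonneg_right hκK h3]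

theorem lyapunov_lower {κ : ℝ} (hκ : 0 ≤ κ) (hκK : κ * ‖S.K‖ ≤ 1) (u : V) (x : Dual n) :
    (‖u‖ ^ 2 + S.dualDist x ^ 2) / 2 ≤ S.lyapunov κ u x := by
  have := (abs_le.1 (S.abs_cross_le hκ hκK u x)).1
  rw [lyapunov]; linarith

theorem lyapunov_upper {κ : ℝ} (hκ : 0 ≤ κ) (hκK : κ * ‖S.K‖ ≤ 1) (u : V) (x : Dual n) :
    S.lyapunov κ u x ≤ 2 * (‖u‖ ^ 2 + S.dualDist x ^ 2) := by
  have := (abs_le.1 (S.abs_cross_le hκ hκK u x)).2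
  rw [lyapunov]; nlinarith [sq_nonneg ‖u‖, sq_nonneg (S.dualDist x)]

theorem lyapunov_nonneg {κ : ℝ} (hκ : 0 ≤ κ) (hκK : κ * ‖S.K‖ ≤ 1) (u : V) (x : Dual n) :
    0 ≤ S.lyapunov κ u x :=
  le_trans (by positivity) (S.lyapunov_lower hκ hκK u x)

theorem continuous_lyapunov (κ : ℝ) : Continuous fun w : V × Dual n => S.lyapunov κ w.1 w.2 := by
  have h1 : Continuous fun w : V × Dual n => S.dualDist w.2 :=
    (Metric.continuous_infDist_pt _).comp continuous_snd
  have h2 : Continuous fun w : V × Dual n => S.residual w.2 :=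
    (S.K.adjoint.continuous.comp (lipschitzWith_projNonneg.continuous.comp
      (continuous_snd.add continuous_const))).add continuous_const
  exact ((continuous_fst.norm.pow 2).add (h1.pow 2)).add
    (continuous_const.mul (continuous_fst.inner h2))

/-- The shrunk dual variable moves, along a projected step, by no more than the complementarity
violation and the part of the step direction beyond the slack. -/
theorem norm_shrink_step_le {x : Dual n} (hx : ∀ j, 0 ≤ x j) (y : Dual n) {γ : ℝ} (hγ : 0 ≤ γ) :
    ‖S.shrink (projNonneg (x + γ • (S.g + y))) - S.shrink x‖ ≤
      γ * (‖x - S.shrink x‖ + ‖y‖) := by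
  set y' : Dual n := WithLp.toLp 2 (fun j => |y j|) with hy'
  have hny : ‖y'‖ ≤ ‖y‖ := norm_le_norm_of_abs_le fun j => by simp [hy']
  have key : ‖S.shrink (projNonneg (x + γ • (S.g + y))) - S.shrink x‖ ≤
      ‖γ • ((x - S.shrink x) + y')‖ := by
    refine norm_le_norm_of_abs_le fun j => ?_
    have hg := S.g_nonpos j
    have hxj := hx j
    have hγg : γ * S.g j ≤ 0 := mul_nonpos_of_nonneg_of_nonpos hγ hg
    have hγy : |γ * y j| = γ * |y j| := by rw [abs_mul, abs_of_nonneg hγ]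
    have h1 := le_abs_self (γ * y j)
    have h2 := neg_abs_le (γ * y j)
    have h0 : 0 ≤ γ * |y j| := mul_nonneg hγ (abs_nonneg _)
    rw [PiLp.sub_apply, shrink_apply, shrink_apply, projNonneg_apply]
    simp only [PiLp.smul_apply, PiLp.add_apply, smul_eq_mul, sub_shrink_apply, hy']
    rw [mul_add γ (S.g j)]
    have hrhs : 0 ≤ γ * (min (x j) (-S.g j) + |y j|) :=
      mul_nonneg hγ (add_nonneg (le_min hxj (by linarith)) (abs_nonneg _))
    rw [abs_of_nonneg hrhs, mul_add]
    -- If `x j` exceeds the slack, `γ g j` lowers it by at most `γ` times that slack, which is the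
    -- minimum here. If not, the shrunk coordinate is 0, and only `y j` can lift it off 0.
    rcases le_total (-S.g j) (x j) with h | h
    · rw [min_eq_right h, max_eq_left (by linarith : 0 ≤ x j + S.g j), abs_le]
      constructor
      · have a1 := le_max_left (x j + (γ * S.g j + γ * y j)) 0
        have a2 := le_max_left (max (x j + (γ * S.g j + γ * y j)) 0 + S.g j) 0
        linarith
      · have : max (max (x j + (γ * S.g j + γ * y j)) 0 + S.g j) 0 ≤
            x j + S.g j + γ * |y j| := by
          refine max_le ?_ (by linarith)
          have : max (x j + (γ * S.g j + γ * y j)) 0 ≤ x j + γ * |y j| :=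
            max_le (by linarith) (by linarith)
          linarith
        linarith
    · rw [min_eq_left h, max_eq_right (by linarith : x j + S.g j ≤ 0), sub_zero,
        abs_of_nonneg (le_max_right _ _)]
      have hγx : 0 ≤ γ * x j := mul_nonneg hγ hxj
      refine max_le ?_ (by linarith)
      have : max (x j + (γ * S.g j + γ * y j)) 0 ≤ -S.g j + γ * |y j| :=
        max_le (by linarith) (by linarith)
      linarith
  refine key.trans ?_
  rw [norm_smul, Real.norm_of_nonneg hγ]
  exact mul_le_mul_of_nonneg_left ((norm_add_le _ _).trans (by linarith)) hγ

/-- Upper bound for the Lyapunov function after one step in the directions `-m` and `g + y`. -/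
theorem lyapunov_step_le {κ : ℝ} (hκ : 0 ≤ κ) (hκK : κ * ‖S.K‖ ≤ 1) {γ : ℝ} (hγ : 0 ≤ γ)
    (u m : V) {x p : Dual n} (hx : ∀ j, 0 ≤ x j) (hp : p ∈ S.mult) (hd : S.dualDist x = ‖x - p‖)
    (y : Dual n) :
    S.lyapunov κ (u - γ • m) (projNonneg (x + γ • (S.g + y))) ≤
      S.lyapunov κ u x + (γ * ⟪m, -(2 : ℝ) • u - κ • S.residual x⟫ + 2 * γ * ⟪S.g + y, x - p⟫ +
        κ * ‖S.K‖ * ‖u‖ * (γ * (‖x - S.shrink x‖ + ‖y‖)) +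
        2 * γ ^ 2 * (‖m‖ ^ 2 + ‖S.g + y‖ ^ 2)) := by
  set x' := projNonneg (x + γ • (S.g + y)) with hx'
  set D := S.shrink x' - S.shrink x with hD
  -- Two bounds for the same displacement. This one serves the first-order term `⟪u, Kᵀ D⟫`, where
  -- the slack `g` must not enter in full.
  have hD1 : ‖D‖ ≤ γ * (‖x - S.shrink x‖ + ‖y‖) := S.norm_shrink_step_le hx y hγ
  -- The crude bound is enough for `γ ⟪m, Kᵀ D⟫`, which is already of second order in `γ`.
  have hD2 : ‖D‖ ≤ γ * ‖S.g + y‖ := by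
    refine (S.norm_shrink_sub_le x' x).trans ?_
    have := norm_projNonneg_sub_le (x + γ • (S.g + y)) x
    rw [projNonneg_of_nonneg hx, add_sub_cancel_left, norm_smul, Real.norm_of_nonneg hγ] at this
    exact this
  have hdist : S.dualDist x' ^ 2 ≤ ‖x - p‖ ^ 2 + 2 * γ * ⟪S.g + y, x - p⟫ +
      γ ^ 2 * ‖S.g + y‖ ^ 2 := by
    have h1 : S.dualDist x' ≤ ‖(x - p) + γ • (S.g + y)‖ := by
      refine (S.dualDist_le hp x').trans ?_
      have := norm_projNonneg_sub_le (x + γ • (S.g + y)) p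
      rw [projNonneg_of_nonneg hp.1] at this
      rwa [sub_add_eq_add_sub]
    refine (pow_le_pow_left₀ (S.dualDist_nonneg _) h1 2).trans (le_of_eq ?_)
    rw [norm_add_sq_real, inner_smul_right, norm_smul, mul_pow, Real.norm_of_nonneg hγ,
      real_inner_comm]
    ring
  have hu : ‖u - γ • m‖ ^ 2 = ‖u‖ ^ 2 - 2 * γ * ⟪m, u⟫ + γ ^ 2 * ‖m‖ ^ 2 := by
    rw [norm_sub_sq_real, inner_smul_right, norm_smul, mul_pow, Real.norm_of_nonneg hγ,
      real_inner_comm]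
    ring
  have hres : S.residual x' = S.residual x + S.K.adjoint D := by
    rw [residual, residual, hD, map_sub]; abel
  have hcross : ⟪u - γ • m, S.residual x'⟫ = ⟪u, S.residual x⟫ - γ * ⟪m, S.residual x⟫ +
      ⟪u, S.K.adjoint D⟫ - γ * ⟪m, S.K.adjoint D⟫ := by
    rw [hres, inner_sub_left, inner_add_right, inner_add_right, real_inner_smul_left,
      real_inner_smul_left]
    ring
  have hc1 : ⟪u, S.K.adjoint D⟫ ≤ ‖S.K‖ * ‖u‖ * (γ * (‖x - S.shrink x‖ + ‖y‖)) := by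
    calc ⟪u, S.K.adjoint D⟫ ≤ ‖u‖ * ‖S.K.adjoint D‖ := real_inner_le_norm _ _
      _ ≤ ‖u‖ * (‖S.K‖ * ‖D‖) := by gcongr; exact S.norm_adjoint_le D
      _ ≤ ‖u‖ * (‖S.K‖ * (γ * (‖x - S.shrink x‖ + ‖y‖))) := by gcongr
      _ = _ := by ring
  have hc2 : -(γ * ⟪m, S.K.adjoint D⟫) ≤ ‖S.K‖ * (γ ^ 2 * (‖m‖ ^ 2 + ‖S.g + y‖ ^ 2)) := by
    have h1 : -⟪m, S.K.adjoint D⟫ ≤ ‖m‖ * (‖S.K‖ * (γ * ‖S.g + y‖)) := by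
      calc -⟪m, S.K.adjoint D⟫ ≤ ‖m‖ * ‖S.K.adjoint D‖ :=
            (neg_le_abs _).trans (abs_real_inner_le_norm _ _)
        _ ≤ ‖m‖ * (‖S.K‖ * ‖D‖) := by gcongr; exact S.norm_adjoint_le D
        _ ≤ _ := by gcongr
    have h2 := mul_le_mul_of_nonneg_left h1 hγ
    have h3 : ‖m‖ * ‖S.g + y‖ ≤ ‖m‖ ^ 2 + ‖S.g + y‖ ^ 2 := by
      nlinarith [sq_nonneg (‖m‖ - ‖S.g + y‖), sq_nonneg ‖m‖, sq_nonneg ‖S.g + y‖]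
    have h4 := mul_le_mul_of_nonneg_left h3 (by positivity : 0 ≤ ‖S.K‖ * γ ^ 2)
    linarith
  have hk1 := mul_le_mul_of_nonneg_left hc1 hκ
  have hk2 := mul_le_mul_of_nonneg_left hc2 hκ
  have hk3 := mul_le_mul_of_nonneg_right hκK
    (by positivity : 0 ≤ γ ^ 2 * (‖m‖ ^ 2 + ‖S.g + y‖ ^ 2))
  rw [lyapunov, lyapunov, hu, hcross, hd, inner_sub_right, inner_smul_right, inner_smul_right]
  linarith

end PrimalDualSystem

end System

/-! ### Drift and dissipation inequalities -/

section Drift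

theorem mul_le_sq_add_sq (x y : ℝ) : x * y ≤ x ^ 2 + y ^ 2 := by
  nlinarith [sq_nonneg (x - y), sq_nonneg (x + y), sq_nonneg x, sq_nonneg y]

theorem mul_le_eighth_sq_add (x y : ℝ) : x * y ≤ x ^ 2 / 8 + 2 * y ^ 2 := by
  nlinarith [sq_nonneg (x - 4 * y)]

/-- Young's inequality term by term: each cross term is charged to part of `ν r²`, `Γ`, `κ vn²` or
`ε d²`, and only squares of the small parameters remain. -/
theorem drift_real_bound {ν L k κ H R r d vn θ Γ ε β η : ℝ} (hν : 0 < ν) (hκ : 0 < κ)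
    (hR : 0 ≤ R) (hΓ : 0 ≤ Γ) (hε : 0 ≤ ε)
    (h1 : κ * (2 * L ^ 2 + 5 * k ^ 2) ≤ ν / 2) (h2 : κ * (2 * k ^ 2 + 1) ≤ 1 / 2)
    (h3 : κ * ε ≤ 1) (h4 : 8 * R * H * ε ≤ 1) (hθ : θ ^ 2 ≤ Γ) (hd : d ≤ H * (vn + k * θ + Γ)) :
    -(2 * ν * r ^ 2) + 2 * β * r - 2 * Γ - 2 * ε * d ^ 2 + 2 * ε * R * d +
        κ * (L * r * vn + β * vn - vn ^ 2 + k * θ * vn) +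
        κ * k * r * (θ + k * r + η + ε * (d + R)) ≤
      -(ν * r ^ 2) - Γ - κ / 2 * vn ^ 2 - ε * d ^ 2 +
        (2 / ν + 3 * κ + 8 * R ^ 2 * H ^ 2 / κ + 4 * R ^ 2 * H ^ 2 * k ^ 2 + κ * R ^ 2) *
          (β ^ 2 + η ^ 2 + ε ^ 2) := by
  have a1 : 2 * β * r ≤ ν * r ^ 2 / 2 + 2 / ν * β ^ 2 := by
    have h : 0 ≤ (ν * r - 2 * β) ^ 2 / (2 * ν) := by positivity
    have e : (ν * r - 2 * β) ^ 2 / (2 * ν) = ν * r ^ 2 / 2 + 2 / ν * β ^ 2 - 2 * β * r := by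
      field_simp; ring
    linarith
  have a2 : κ * (L * r * vn) ≤ κ * (vn ^ 2 / 8 + 2 * (L * r) ^ 2) :=
    mul_le_mul_of_nonneg_left (by linarith [mul_le_eighth_sq_add vn (L * r)]) hκ.le
  have a3 : κ * (β * vn) ≤ κ * (vn ^ 2 / 8 + 2 * β ^ 2) :=
    mul_le_mul_of_nonneg_left (by linarith [mul_le_eighth_sq_add vn β]) hκ.le
  have a4 : κ * (k * θ * vn) ≤ κ * (vn ^ 2 / 8 + 2 * k ^ 2 * Γ) := by
    refine mul_le_mul_of_nonneg_left ?_ hκ.le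
    have := mul_le_eighth_sq_add vn (k * θ)
    have := mul_le_mul_of_nonneg_left hθ (by positivity : 0 ≤ 2 * k ^ 2)
    linarith
  -- Bounding this against `ε d²` would leave an error of order `ε`. The error bound `hd` trades `d`
  -- for quantities dissipated without the factor `ε`, and the error drops to `ε²`.
  have a5 : 2 * ε * R * d ≤ 2 * ε * R * (H * (vn + k * θ + Γ)) :=
    mul_le_mul_of_nonneg_left hd (by positivity)
  have a6 : 2 * ε * R * H * vn ≤ κ * (vn ^ 2 / 8) + 8 * R ^ 2 * H ^ 2 / κ * ε ^ 2 := by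
    have h : 0 ≤ (κ * vn - 8 * ε * R * H) ^ 2 / (8 * κ) := by positivity
    have e : (κ * vn - 8 * ε * R * H) ^ 2 / (8 * κ) =
        κ * (vn ^ 2 / 8) + 8 * R ^ 2 * H ^ 2 / κ * ε ^ 2 - 2 * ε * R * H * vn := by
      field_simp; ring
    linarith
  have a7 : 2 * ε * R * H * (k * θ) ≤ Γ / 4 + 4 * R ^ 2 * H ^ 2 * k ^ 2 * ε ^ 2 := by
    nlinarith [sq_nonneg (θ / 2 - 2 * ε * R * H * k)]
  have a8 : 2 * ε * R * H * Γ ≤ Γ / 4 := by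
    have := mul_le_mul_of_nonneg_right h4 hΓ
    linarith
  have b1 : κ * ((k * r) * θ) ≤ κ * ((k * r) ^ 2 + Γ) :=
    mul_le_mul_of_nonneg_left (by linarith [mul_le_sq_add_sq (k * r) θ]) hκ.le
  have b2 : κ * ((k * r) * η) ≤ κ * ((k * r) ^ 2 + η ^ 2) :=
    mul_le_mul_of_nonneg_left (mul_le_sq_add_sq (k * r) η) hκ.le
  have b3 : κ * ((k * r) * (ε * d)) ≤ κ * ((k * r) ^ 2 + (ε * d) ^ 2) :=
    mul_le_mul_of_nonneg_left (mul_le_sq_add_sq (k * r) (ε * d)) hκ.le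
  have b4 : κ * ((k * r) * (ε * R)) ≤ κ * ((k * r) ^ 2 + (ε * R) ^ 2) :=
    mul_le_mul_of_nonneg_left (mul_le_sq_add_sq (k * r) (ε * R)) hκ.le
  have b5 : κ * (ε * d) ^ 2 ≤ ε * d ^ 2 := by
    have := mul_le_mul_of_nonneg_right h3 (by positivity : 0 ≤ ε * d ^ 2)
    linarith
  have c1 := mul_le_mul_of_nonneg_right h1 (sq_nonneg r)
  have c2 := mul_le_mul_of_nonneg_right h2 hΓ
  have p1 : 0 ≤ 2 / ν * (η ^ 2 + ε ^ 2) := by positivity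
  have p2 : 0 ≤ κ * (β ^ 2 + 2 * η ^ 2 + 3 * ε ^ 2) := by positivity
  have p3 : 0 ≤ 8 * R ^ 2 * H ^ 2 / κ * (β ^ 2 + η ^ 2) := by positivity
  have p4 : 0 ≤ 4 * R ^ 2 * H ^ 2 * k ^ 2 * (β ^ 2 + η ^ 2) := by positivity
  have p5 : 0 ≤ κ * R ^ 2 * (β ^ 2 + η ^ 2) := by positivity
  linarith

/-- The second-order term grows like `γ²(r² + d²)`. The `r²` part fits into half of the strong
monotonicity, but the `d²` part can only be absorbed by the regularization, which requires `γ` to be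
small compared with `ε`. -/
theorem mean_drift_bound {ν κ r d vn Γ ε γ q C₁ C₂ Q D : ℝ} (hγ : 0 ≤ γ)
    (hC₁ : 0 ≤ C₁)
    (hD : D ≤ γ * (-(ν * r ^ 2) - Γ - κ / 2 * vn ^ 2 - ε * d ^ 2 + C₁ * q) +
      C₂ * γ ^ 2 * (1 + r ^ 2 + d ^ 2))
    (hq : q ≤ Q * γ) (h1 : C₂ * γ ≤ ν / 2) (h2 : C₂ * γ ≤ ε / 2) :
    D ≤ -(γ * (ν / 2 * r ^ 2 + Γ + κ / 2 * vn ^ 2)) - γ * (ε / 2) * d ^ 2 +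
      (C₁ * Q + C₂) * γ ^ 2 := by
  have a1 := mul_le_mul_of_nonneg_left (mul_le_mul_of_nonneg_left hq hC₁) hγ
  have a2 := mul_le_mul_of_nonneg_right h1 (by positivity : 0 ≤ γ * r ^ 2)
  have a3 := mul_le_mul_of_nonneg_right h2 (by positivity : 0 ≤ γ * d ^ 2)
  linarith

/-- Only the weak coercivity `c γ ε (r² + d²)` is used, since it holds at every distance from the
multipliers. Multiplied by `2W` it gives the contraction of `W²`; the `γ² W²` part of the noise is
absorbed because `γ` is small compared with `ε`. -/
theorem second_moment_real_bound {ν κ r d vn Γ ε γ W D F c C₄ C₅ C₆ : ℝ} (hγ : 0 ≤ γ)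
    (hγ1 : γ ≤ 1) (hε : 0 ≤ ε) (hε1 : ε ≤ 1) (hκ : 0 ≤ κ) (hΓ : 0 ≤ Γ) (hW : 0 ≤ W)
    (hC₆ : 0 ≤ C₆) (hcν : c ≤ ν / 2) (hc : c ≤ 1 / 2) (hc0 : 0 ≤ c)
    (hWr : W ≤ 2 * (r ^ 2 + d ^ 2))
    (hD : D ≤ -(γ * (ν / 2 * r ^ 2 + Γ + κ / 2 * vn ^ 2)) - γ * (ε / 2) * d ^ 2 + C₄ * γ ^ 2)
    (hF : F ≤ C₅ * γ ^ 2 * (W + W ^ 2) + C₆ * γ ^ 4 * (1 + W ^ 2))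
    (hsmall : (C₅ + C₆) * γ ≤ c / 2 * ε) :
    W ^ 2 + 2 * W * D + F ≤
      (1 - c / 2 * (γ * ε)) * W ^ 2 + (2 * C₄ + C₅) * γ ^ 2 * W + C₆ * γ ^ 4 := by
  have hD' : D ≤ -(c * (γ * ε) * (r ^ 2 + d ^ 2)) + C₄ * γ ^ 2 := by
    have a1 : c * ε * (γ * r ^ 2) ≤ ν / 2 * (γ * r ^ 2) :=
      mul_le_mul_of_nonneg_right (by nlinarith) (by positivity)
    have a2 : c * (γ * ε * d ^ 2) ≤ 1 / 2 * (γ * ε * d ^ 2) :=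
      mul_le_mul_of_nonneg_right hc (by positivity)
    have a3 : 0 ≤ γ * (Γ + κ / 2 * vn ^ 2) := by positivity
    linarith
  have b1 := mul_le_mul_of_nonneg_left hD' (by positivity : 0 ≤ 2 * W)
  have b2 := mul_le_mul_of_nonneg_left hWr (by positivity : 0 ≤ W * (c * (γ * ε)))
  have b3 := mul_le_mul_of_nonneg_right hsmall (by positivity : 0 ≤ γ * W ^ 2)
  have b4 : C₆ * γ ^ 4 * W ^ 2 ≤ C₆ * γ * (γ * W ^ 2) := by
    have : γ ^ 4 ≤ γ ^ 2 := pow_le_pow_of_le_one hγ hγ1 (by norm_num)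
    have := mul_le_mul_of_nonneg_left this (by positivity : 0 ≤ C₆ * W ^ 2)
    linarith
  linarith

namespace PrimalDualSystem

variable {n : ℕ} {V : Type*} [NormedAddCommGroup V] [InnerProductSpace ℝ V]
  [FiniteDimensional ℝ V] (S : PrimalDualSystem V n)

/-- Subtracting the equation `Kᵀ p = -M(a*)` of the nearest multiplier shows `⟪x - p, K u⟫` with
opposite signs in the primal and dual parts, and it cancels. The cross weight contributes `-κ‖v‖²`;
the other terms are scalar and go to `drift_real_bound`. -/
theorem first_order_bound {κ ε β η : ℝ} (hκ : 0 < κ) (hε : 0 ≤ ε)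
    (h1 : κ * (2 * S.L ^ 2 + 5 * ‖S.K‖ ^ 2) ≤ S.ν / 2) (h2 : κ * (2 * ‖S.K‖ ^ 2 + 1) ≤ 1 / 2)
    (h3 : κ * ε ≤ 1) (h4 : 8 * S.R * S.H * ε ≤ 1) (u mbar : V) {x p : Dual n}
    (hx : ∀ j, 0 ≤ x j) (hp : p ∈ S.mult) (hd : S.dualDist x = ‖x - p‖)
    (hm : ‖mbar - (S.M (S.aStar + u) + S.K.adjoint x)‖ ≤ β) :
    ⟪mbar, -(2 : ℝ) • u - κ • S.residual x⟫ + 2 * ⟪S.g + S.K u - ε • x, x - p⟫ +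
        κ * ‖S.K‖ * ‖u‖ * (‖x - S.shrink x‖ + ‖S.K‖ * ‖u‖ + η + ε * (S.dualDist x + S.R)) ≤
      -(S.ν * ‖u‖ ^ 2) - S.compl x - κ / 2 * ‖S.residual x‖ ^ 2 - ε * S.dualDist x ^ 2 +
        (2 / S.ν + 3 * κ + 8 * S.R ^ 2 * S.H ^ 2 / κ + 4 * S.R ^ 2 * S.H ^ 2 * ‖S.K‖ ^ 2 +
          κ * S.R ^ 2) * (β ^ 2 + η ^ 2 + ε ^ 2) := by
  set e := mbar - (S.M (S.aStar + u) + S.K.adjoint x) with he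
  set dm := S.M (S.aStar + u) - S.M S.aStar with hdm
  have hmbar : mbar = e + dm + S.K.adjoint (x - p) := by
    rw [he, hdm, map_sub, hp.2.1]; abel
  have hres : S.K.adjoint (x - p) = S.residual x + S.K.adjoint (x - S.shrink x) := by
    rw [S.residual_eq hp, ← map_add]; congr 1; abel
  have hmono : S.ν * ‖u‖ ^ 2 ≤ ⟪dm, u⟫ := by
    simpa using S.mono (S.aStar + u) S.aStar
  have hlip : ‖dm‖ ≤ S.L * ‖u‖ := by simpa using S.lip (S.aStar + u) S.aStar
  have hβ : 0 ≤ β := (norm_nonneg _).trans hm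
  have i1 : ⟪mbar, u⟫ = ⟪e, u⟫ + ⟪dm, u⟫ + ⟪x - p, S.K u⟫ := by
    rw [hmbar, inner_add_left, inner_add_left, ContinuousLinearMap.adjoint_inner_left]
  have i2 : ⟪mbar, S.residual x⟫ = ⟪e, S.residual x⟫ + ⟪dm, S.residual x⟫ +
      ‖S.residual x‖ ^ 2 + ⟪S.K.adjoint (x - S.shrink x), S.residual x⟫ := by
    rw [hmbar, hres, inner_add_left, inner_add_left, inner_add_left, real_inner_self_eq_norm_sq]
    ring
  have i3 : ⟪S.g + S.K u - ε • x, x - p⟫ = -S.compl x + ⟪x - p, S.K u⟫ - ε * ⟪x, x - p⟫ := by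
    rw [inner_sub_left, inner_add_left, real_inner_smul_left, real_inner_comm (x - p) (S.K u),
      real_inner_comm (x - p) S.g, inner_sub_left x p S.g, hp.2.2, compl]
    ring
  -- The regularization pulls towards 0 instead of `p`; the discrepancy costs at most `‖p‖ ≤ R`
  -- times the distance.
  have i4 : S.dualDist x ^ 2 - S.R * S.dualDist x ≤ ⟪x, x - p⟫ := by
    have : ⟪x, x - p⟫ = ‖x - p‖ ^ 2 + ⟪p, x - p⟫ := by
      rw [← real_inner_self_eq_norm_sq, ← inner_add_left, sub_add_cancel]
    rw [this, hd]
    have h5 : -⟪p, x - p⟫ ≤ ‖p‖ * ‖x - p‖ := (neg_le_abs _).trans (abs_real_inner_le_norm _ _)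
    have h6 := mul_le_mul_of_nonneg_right (S.norm_le p hp) (norm_nonneg (x - p))
    linarith
  have j1 : -⟪e, u⟫ ≤ β * ‖u‖ := ((neg_le_abs _).trans (abs_real_inner_le_norm _ _)).trans
    (mul_le_mul_of_nonneg_right hm (norm_nonneg _))
  have j2 : -⟪e, S.residual x⟫ ≤ β * ‖S.residual x‖ :=
    ((neg_le_abs _).trans (abs_real_inner_le_norm _ _)).trans
      (mul_le_mul_of_nonneg_right hm (norm_nonneg _))
  have j3 : -⟪dm, S.residual x⟫ ≤ S.L * ‖u‖ * ‖S.residual x‖ :=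
    ((neg_le_abs _).trans (abs_real_inner_le_norm _ _)).trans
      (mul_le_mul_of_nonneg_right hlip (norm_nonneg _))
  have j4 : -⟪S.K.adjoint (x - S.shrink x), S.residual x⟫ ≤
      ‖S.K‖ * ‖x - S.shrink x‖ * ‖S.residual x‖ :=
    ((neg_le_abs _).trans (abs_real_inner_le_norm _ _)).trans
      (mul_le_mul_of_nonneg_right (S.norm_adjoint_le _) (norm_nonneg _))
  have key := drift_real_bound (L := S.L) (r := ‖u‖) (d := S.dualDist x) (vn := ‖S.residual x‖)
    (θ := ‖x - S.shrink x‖) (β := β) (η := η) S.ν_pos hκ S.R_nonneg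
    (S.compl_nonneg hx) hε h1 h2 h3 h4 (S.sq_norm_sub_shrink_le hx) (S.dualDist_le_residual hx)
  rw [inner_sub_right, inner_smul_right, inner_smul_right, i1, i2, i3]
  have k1 := mul_le_mul_of_nonneg_left i4 hε
  have k2 : κ * -(⟪e, S.residual x⟫ + ⟪dm, S.residual x⟫ +
      ‖S.residual x‖ ^ 2 + ⟪S.K.adjoint (x - S.shrink x), S.residual x⟫) ≤
      κ * (S.L * ‖u‖ * ‖S.residual x‖ + β * ‖S.residual x‖ - ‖S.residual x‖ ^ 2 +
        ‖S.K‖ * ‖x - S.shrink x‖ * ‖S.residual x‖) :=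
    mul_le_mul_of_nonneg_left (by linarith) hκ.le
  linarith

/-- The fast dissipation controls the Lyapunov function up to a quadratic correction. -/
theorem exists_lyapunov_le_dissipation : ∃ C : ℝ, 0 < C ∧ ∀ κ : ℝ, 0 ≤ κ → κ * ‖S.K‖ ≤ 1 →
    ∀ (u : V) (x : Dual n), (∀ j, 0 ≤ x j) →
      S.lyapunov κ u x ≤
        C * (‖u‖ ^ 2 + S.compl x + ‖S.residual x‖ ^ 2 + S.lyapunov κ u x ^ 2) := by
  refine ⟨2 + 6 * S.H ^ 2 * (2 + ‖S.K‖ ^ 2) + 24 * S.H ^ 2 * ‖S.g‖ ^ 4, by positivity,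
    fun κ hκ hκK u x hx => ?_⟩
  set W := S.lyapunov κ u x
  have hW0 : 0 ≤ W := S.lyapunov_nonneg hκ hκK u x
  have hlow : (‖u‖ ^ 2 + S.dualDist x ^ 2) / 2 ≤ W := S.lyapunov_lower hκ hκK u x
  have hup : W ≤ 2 * (‖u‖ ^ 2 + S.dualDist x ^ 2) := S.lyapunov_upper hκ hκK u x
  have hΓ := S.compl_nonneg hx
  have hθ := S.sq_norm_sub_shrink_le hx
  have hd := S.dualDist_le_residual hx
  have hd0 := S.dualDist_nonneg x
  have hΓd := S.compl_le_dualDist x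
  set Γ := S.compl x
  set d := S.dualDist x
  set θ := ‖x - S.shrink x‖
  set vn := ‖S.residual x‖
  set k := ‖S.K‖
  -- Squaring the error bound leaves one term that the dissipation does not dominate, `Γ²`. It is
  -- split as `Γ + Γ⁴`, and `Γ ≤ ‖g‖ d` with `d² ≤ 2W` turns `Γ⁴` into a multiple of `W²`.
  have h1 : d ^ 2 ≤ S.H ^ 2 * (3 * (vn ^ 2 + k ^ 2 * Γ + Γ ^ 2)) := by
    refine (pow_le_pow_left₀ hd0 hd 2).trans ?_
    rw [mul_pow]
    refine mul_le_mul_of_nonneg_left ?_ (sq_nonneg _)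
    have h3 : (k * θ) ^ 2 ≤ k ^ 2 * Γ := by
      rw [mul_pow]; exact mul_le_mul_of_nonneg_left hθ (sq_nonneg _)
    nlinarith [sq_nonneg (vn - k * θ), sq_nonneg (vn - Γ), sq_nonneg (k * θ - Γ)]
  have h2 : Γ ^ 2 ≤ Γ + Γ ^ 4 := by
    rcases le_total Γ 1 with h | h
    · nlinarith [pow_nonneg hΓ 4]
    · nlinarith [pow_le_pow_right₀ h (by norm_num : 2 ≤ 4)]
  have h3 : Γ ^ 4 ≤ ‖S.g‖ ^ 4 * (4 * W ^ 2) := by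
    have a1 : Γ ^ 4 ≤ (‖S.g‖ * d) ^ 4 := pow_le_pow_left₀ hΓ hΓd 4
    have a2 : d ^ 2 ≤ 2 * W := by nlinarith [sq_nonneg ‖u‖]
    have a3 : (d ^ 2) ^ 2 ≤ (2 * W) ^ 2 := pow_le_pow_left₀ (sq_nonneg _) a2 2
    rw [mul_pow] at a1
    refine a1.trans (mul_le_mul_of_nonneg_left ?_ (by positivity))
    nlinarith
  have h4 : Γ ^ 2 ≤ Γ + ‖S.g‖ ^ 4 * (4 * W ^ 2) := h2.trans (by linarith)
  have h5 := mul_le_mul_of_nonneg_left h4 (by positivity : 0 ≤ 6 * S.H ^ 2)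
  have p1 : 0 ≤ 2 * (Γ + vn ^ 2 + W ^ 2) := by positivity
  have p2 : 0 ≤ 6 * S.H ^ 2 * (‖u‖ ^ 2 * (2 + k ^ 2) + Γ + vn ^ 2 * (1 + k ^ 2) +
    W ^ 2 * (2 + k ^ 2)) := by positivity
  have p3 : 0 ≤ 24 * S.H ^ 2 * ‖S.g‖ ^ 4 * (‖u‖ ^ 2 + Γ + vn ^ 2) := by positivity
  linarith

end PrimalDualSystem

end Drift

/-! ### Pathwise bounds for a random step -/

section Expected

namespace PrimalDualSystem

variable {n : ℕ} {V : Type*} [NormedAddCommGroup V] [InnerProductSpace ℝ V]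
  [FiniteDimensional ℝ V] (S : PrimalDualSystem V n)
  {Z : Type*} [MeasurableSpace Z]

/-- A random primal direction `m` and a random constraint error `s` at the primal error `u` and
the dual point `x`: `m` is nearly unbiased, `s` is centered, and both are dominated by `P`. -/
structure StepNoise (ρ : Measure Z) (P : Z → ℝ) (B σ : ℝ) (u : V) (x : Dual n)
    (m : Z → V) (s : Z → Dual n) : Prop where
  m_meas : AEStronglyMeasurable m ρ
  s_meas : AEStronglyMeasurable s ρ
  m_le : ∀ z, ‖m z‖ ≤ B * (1 + ‖u‖ + S.dualDist x) * P z
  s_le : ∀ z, ‖s z‖ ≤ σ * B * P z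
  s_mean : ∫ z, s z ∂ρ = 0
  m_bias : ‖∫ z, m z ∂ρ - (S.M (S.aStar + u) + S.K.adjoint x)‖ ≤ σ * B

/-- The dual direction. -/
def dualDir (ε : ℝ) (u : V) (x s : Dual n) : Dual n := S.g + (S.K u + s - ε • x)

/-- The Lyapunov function after a step. -/
def stepValue (κ γ ε : ℝ) (u : V) (x : Dual n) (m : V) (s : Dual n) : ℝ :=
  S.lyapunov κ (u - γ • m) (projNonneg (x + γ • S.dualDir ε u x s))

/-- A bound for the dual direction. -/
def dirConst (B : ℝ) : ℝ := B + ‖S.g‖ + ‖S.K‖ + B ^ 2 + B * (1 + S.R)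

/-- An upper bound for the growth of the Lyapunov function in a step. -/
def growth (κ γ ε σ B : ℝ) (u : V) (x p : Dual n) (m : V) (s : Dual n) (P : ℝ) : ℝ :=
  γ * ⟪m, -(2 : ℝ) • u - κ • S.residual x⟫ + 2 * γ * ⟪S.g + S.K u - ε • x, x - p⟫ +
    2 * γ * ⟪s, x - p⟫ +
    γ * (κ * ‖S.K‖ * ‖u‖ * (‖x - S.shrink x‖ + ‖S.K‖ * ‖u‖ + ε * (S.dualDist x + S.R))) +
    γ * (κ * ‖S.K‖ * ‖u‖ * (σ * B)) * P +
    4 * γ ^ 2 * (S.dirConst B) ^ 2 * (1 + ‖u‖ + S.dualDist x) ^ 2 * P ^ 2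

variable {S} in
theorem norm_excess_le {ε σ B P : ℝ} (hε : 0 ≤ ε) {u : V} {x s : Dual n}
    (hs : ‖s‖ ≤ σ * B * P) :
    ‖S.K u + s - ε • x‖ ≤ ‖S.K‖ * ‖u‖ + σ * B * P + ε * (S.dualDist x + S.R) := by
  have h1 := norm_sub_le (S.K u + s) (ε • x)
  have h2 := norm_add_le (S.K u) s
  have h3 := S.K.le_opNorm u
  have h4 : ‖ε • x‖ ≤ ε * (S.dualDist x + S.R) := by
    rw [norm_smul, Real.norm_of_nonneg hε]
    exact mul_le_mul_of_nonneg_left (S.norm_le_dualDist_add x) hε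
  linarith

variable {S} in
theorem excess_le_dirConst {ε σ B P : ℝ} (hε : 0 ≤ ε) (hεB : ε ≤ B) (hσB : σ ≤ B)
    (hP : 1 ≤ P) (u : V) (x : Dual n) :
    B * (1 + ‖u‖ + S.dualDist x) * P + ‖S.g‖ + (‖S.K‖ * ‖u‖ + σ * B * P +
      ε * (S.dualDist x + S.R)) ≤ S.dirConst B * (1 + ‖u‖ + S.dualDist x) * P := by
  have hB : 0 ≤ B := hε.trans hεB
  have hd := S.dualDist_nonneg x
  have hu := norm_nonneg u
  have hR := S.R_nonneg
  have hg := norm_nonneg S.g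
  have hk := norm_nonneg S.K
  have hP0 : 0 ≤ P := by linarith
  set Y := 1 + ‖u‖ + S.dualDist x with hY
  have hY1 : 1 ≤ Y := by rw [hY]; linarith
  have hYP : 1 ≤ Y * P := one_le_mul_of_one_le_of_one_le hY1 hP
  have hYPY : Y ≤ Y * P := le_mul_of_one_le_right (by linarith) hP
  have hYPP : P ≤ Y * P := le_mul_of_one_le_left hP0 hY1
  have a1 : ‖S.g‖ ≤ ‖S.g‖ * (Y * P) := le_mul_of_one_le_right hg hYP
  have a2 : ‖S.K‖ * ‖u‖ ≤ ‖S.K‖ * (Y * P) :=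
    mul_le_mul_of_nonneg_left (by linarith) hk
  have a3 : σ * B * P ≤ B * B * (Y * P) := by
    refine mul_le_mul ?_ hYPP hP0 (by positivity)
    exact mul_le_mul_of_nonneg_right hσB hB
  have a4 : ε * (S.dualDist x + S.R) ≤ B * ((1 + S.R) * (Y * P)) := by
    refine mul_le_mul hεB ?_ (by positivity) hB
    have : S.R ≤ S.R * (Y * P) := le_mul_of_one_le_right hR hYP
    linarith
  rw [dirConst]
  nlinarith

variable {S} in
-- The projection and the distance are replaced by a bound that is affine in the random vectors `m`
-- and `s`, up to powers of `P`. Its mean therefore sees only the bias of `m` and the centering of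
-- `s`.
theorem stepValue_le_growth {κ γ ε σ B : ℝ} (hκ : 0 ≤ κ) (hκK : κ * ‖S.K‖ ≤ 1) (hγ : 0 ≤ γ)
    (hε : 0 ≤ ε) (hεB : ε ≤ B) (hσ : 0 ≤ σ) (hσB : σ ≤ B) {u : V} {x p : Dual n}
    (hx : ∀ j, 0 ≤ x j) (hp : p ∈ S.mult) (hd : S.dualDist x = ‖x - p‖) {m : V} {s : Dual n}
    {P : ℝ} (hP : 1 ≤ P) (hm : ‖m‖ ≤ B * (1 + ‖u‖ + S.dualDist x) * P)
    (hs : ‖s‖ ≤ σ * B * P) :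
    S.stepValue κ γ ε u x m s ≤ S.lyapunov κ u x + S.growth κ γ ε σ B u x p m s P := by
  have h := S.lyapunov_step_le hκ hκK hγ u m hx hp hd (S.K u + s - ε • x)
  refine h.trans (add_le_add_right ?_ _)
  have hy := norm_excess_le (S := S) hε hs (u := u) (x := x)
  have hdir := excess_le_dirConst (S := S) hε hεB hσB hP u x
  have hB : 0 ≤ B := hε.trans hεB
  have hd0 := S.dualDist_nonneg x
  have hR := S.R_nonneg
  have hP0 : 0 ≤ P := by linarith
  have hm2 : ‖m‖ ^ 2 ≤ (S.dirConst B * (1 + ‖u‖ + S.dualDist x) * P) ^ 2 := by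
    refine pow_le_pow_left₀ (norm_nonneg _) (hm.trans (le_trans ?_ hdir)) 2
    have : 0 ≤ ‖S.g‖ + (‖S.K‖ * ‖u‖ + σ * B * P + ε * (S.dualDist x + S.R)) := by positivity
    linarith
  have hh2 : ‖S.g + (S.K u + s - ε • x)‖ ^ 2 ≤
      (S.dirConst B * (1 + ‖u‖ + S.dualDist x) * P) ^ 2 := by
    refine pow_le_pow_left₀ (norm_nonneg _) ((norm_add_le _ _).trans (le_trans ?_ hdir)) 2
    have : 0 ≤ B * (1 + ‖u‖ + S.dualDist x) * P := by positivity
    linarith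
  have e1 : ⟪S.g + (S.K u + s - ε • x), x - p⟫ =
      ⟪S.g + S.K u - ε • x, x - p⟫ + ⟪s, x - p⟫ := by
    rw [← inner_add_left]; congr 1; abel
  have a1 : κ * ‖S.K‖ * ‖u‖ * (γ * (‖x - S.shrink x‖ + ‖S.K u + s - ε • x‖)) ≤
      κ * ‖S.K‖ * ‖u‖ * (γ * (‖x - S.shrink x‖ +
        (‖S.K‖ * ‖u‖ + σ * B * P + ε * (S.dualDist x + S.R)))) := by gcongr
  have a2 := mul_le_mul_of_nonneg_left (add_le_add hm2 hh2) (by positivity : 0 ≤ 2 * γ ^ 2)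
  rw [e1, growth]
  linarith

variable {S} in
-- The factor `‖u‖ + d` in the first-order term is essential: the square of that term is then
-- bounded by `γ²(W + W²)` without a constant, and constants enter the second moment only at order
-- `γ⁴`.
theorem abs_growth_le {κ γ ε σ B : ℝ} (hκ : 0 ≤ κ) (hκK : κ * ‖S.K‖ ≤ 1) (hγ : 0 ≤ γ)
    (hε : 0 ≤ ε) (hεB : ε ≤ B) (hσ : 0 ≤ σ) (hσB : σ ≤ B) {u : V} {x p : Dual n}
    (hx : ∀ j, 0 ≤ x j) (hd : S.dualDist x = ‖x - p‖) {m : V} {s : Dual n}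
    {P : ℝ} (hP : 1 ≤ P) (hm : ‖m‖ ≤ B * (1 + ‖u‖ + S.dualDist x) * P)
    (hs : ‖s‖ ≤ σ * B * P) :
    |S.growth κ γ ε σ B u x p m s P| ≤ 8 * (1 + S.dirConst B) ^ 2 *
      (γ * ((‖u‖ + S.dualDist x) * (1 + ‖u‖ + S.dualDist x)) * P +
        γ ^ 2 * (1 + ‖u‖ + S.dualDist x) ^ 2 * P ^ 2) := by
  have hdir := excess_le_dirConst (S := S) hε hεB hσB hP u x
  have hB : 0 ≤ B := hε.trans hεB
  have hd0 := S.dualDist_nonneg x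
  have hR := S.R_nonneg
  have hP0 : 0 ≤ P := by linarith
  have hC0 : 0 ≤ S.dirConst B := by rw [dirConst]; positivity
  set Y := 1 + ‖u‖ + S.dualDist x with hY
  have hY0 : 0 ≤ Y := by positivity
  set d := S.dualDist x with hdd
  set T := S.dirConst B * Y * P with hT
  have hT0 : 0 ≤ T := by positivity
  have hmT : ‖m‖ ≤ T := by
    have : 0 ≤ ‖S.g‖ + (‖S.K‖ * ‖u‖ + σ * B * P + ε * (d + S.R)) := by positivity
    linarith
  have hκ1 : κ * ‖S.K‖ * ‖u‖ ≤ ‖u‖ := mul_le_of_le_one_left (norm_nonneg _) hκK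
  have hw : ‖-(2 : ℝ) • u - κ • S.residual x‖ ≤ 2 * (‖u‖ + d) := by
    have h1 := norm_sub_le (-(2 : ℝ) • u) (κ • S.residual x)
    rw [norm_smul, norm_smul, norm_neg, Real.norm_of_nonneg hκ, Real.norm_ofNat] at h1
    have h2 := mul_le_mul_of_nonneg_left (S.norm_residual_le x) hκ
    have h3 : κ * ‖S.K‖ * d ≤ 1 * d := mul_le_mul_of_nonneg_right hκK hd0
    rw [← hdd] at h2
    linarith
  have t1 : |⟪m, -(2 : ℝ) • u - κ • S.residual x⟫| ≤ T * (2 * (‖u‖ + d)) :=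
    (abs_real_inner_le_norm _ _).trans (mul_le_mul hmT hw (norm_nonneg _) hT0)
  have t2 : |⟪S.g + S.K u - ε • x, x - p⟫| ≤ T * (‖u‖ + d) := by
    refine (abs_real_inner_le_norm _ _).trans
      (mul_le_mul ?_ (by rw [← hd]; linarith [norm_nonneg u]) (norm_nonneg _) hT0)
    have h1 := norm_excess_le (S := S) hε (u := u) (x := x) (s := 0) (σ := σ) (B := B) (P := P)
      (by rw [norm_zero]; positivity)
    rw [add_zero] at h1
    have h2 := norm_add_le S.g (S.K u - ε • x)
    rw [← add_sub_assoc] at h2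
    have : 0 ≤ B * Y * P := by positivity
    linarith
  have t3 : |⟪s, x - p⟫| ≤ T * (‖u‖ + d) := by
    refine (abs_real_inner_le_norm _ _).trans
      (mul_le_mul ?_ (by rw [← hd]; linarith [norm_nonneg u]) (norm_nonneg _) hT0)
    have : 0 ≤ B * Y * P + ‖S.g‖ + ‖S.K‖ * ‖u‖ + ε * (d + S.R) := by positivity
    linarith
  have t4 : |κ * ‖S.K‖ * ‖u‖ * (‖x - S.shrink x‖ + ‖S.K‖ * ‖u‖ + ε * (d + S.R))| ≤
      T * (‖u‖ + d) := by
    rw [abs_of_nonneg (by positivity), mul_comm T]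
    refine mul_le_mul (by linarith) ?_ (by positivity) (by positivity)
    have h1 := S.norm_sub_shrink_le hx
    have : 0 ≤ B * Y * P + σ * B * P := by positivity
    linarith
  have t5 : |κ * ‖S.K‖ * ‖u‖ * (σ * B) * P| ≤ T * (‖u‖ + d) := by
    rw [abs_of_nonneg (by positivity), mul_comm T, mul_assoc]
    refine mul_le_mul (by linarith) ?_ (by positivity) (by positivity)
    have : 0 ≤ B * Y * P + ‖S.g‖ + ‖S.K‖ * ‖u‖ + ε * (d + S.R) := by positivity
    linarith
  have hsum : |S.growth κ γ ε σ B u x p m s P| ≤ γ * (8 * (T * (‖u‖ + d))) +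
      4 * γ ^ 2 * T ^ 2 := by
    have e : S.growth κ γ ε σ B u x p m s P =
        γ * (⟪m, -(2 : ℝ) • u - κ • S.residual x⟫ + 2 * ⟪S.g + S.K u - ε • x, x - p⟫ +
          2 * ⟪s, x - p⟫ +
          κ * ‖S.K‖ * ‖u‖ * (‖x - S.shrink x‖ + ‖S.K‖ * ‖u‖ + ε * (d + S.R)) +
          κ * ‖S.K‖ * ‖u‖ * (σ * B) * P) + 4 * γ ^ 2 * T ^ 2 := by
      rw [growth, hT]; ring
    rw [e]
    refine (abs_add_le _ _).trans (add_le_add ?_ (le_of_eq (abs_of_nonneg (by positivity))))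
    rw [abs_mul, abs_of_nonneg hγ]
    refine mul_le_mul_of_nonneg_left ?_ hγ
    rw [abs_le] at t1 t2 t3 t4 t5 ⊢
    constructor <;> linarith
  refine hsum.trans ?_
  have hC1 : S.dirConst B ≤ (1 + S.dirConst B) ^ 2 := by nlinarith
  have hC2 : S.dirConst B ^ 2 ≤ (1 + S.dirConst B) ^ 2 := by nlinarith
  have b1 := mul_le_mul_of_nonneg_right hC1
    (by positivity : 0 ≤ 8 * (γ * ((‖u‖ + d) * Y) * P))
  have b2 := mul_le_mul_of_nonneg_right hC2 (by positivity : 0 ≤ 4 * (γ ^ 2 * Y ^ 2 * P ^ 2))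
  have b3 : 0 ≤ (1 + S.dirConst B) ^ 2 * (4 * (γ ^ 2 * Y ^ 2 * P ^ 2)) := by positivity
  rw [hT]
  linarith

/-- Crude bound for the Lyapunov function after a step, for arbitrary step sizes. -/
theorem stepValue_le_crude {κ : ℝ} (hκ : 0 ≤ κ) (hκK : κ * ‖S.K‖ ≤ 1) (B γ : ℝ) (hγ : 0 ≤ γ) :
    ∃ C : ℝ, 0 ≤ C ∧ ∀ ε σ : ℝ, 0 ≤ ε → ε ≤ B → 0 ≤ σ → σ ≤ B → ∀ (u : V) (x : Dual n),
      (∀ j, 0 ≤ x j) → ∀ (m : V) (s : Dual n) (P : ℝ), 1 ≤ P →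
      ‖m‖ ≤ B * (1 + ‖u‖ + S.dualDist x) * P → ‖s‖ ≤ σ * B * P →
      S.stepValue κ γ ε u x m s ≤ C * (1 + S.lyapunov κ u x) * P ^ 2 := by
  refine ⟨1 + 8 * (1 + S.dirConst B) ^ 2 * (γ + γ ^ 2) * 6, by positivity,
    fun ε σ hε hεB hσ hσB u x hx m s P hP hm hs => ?_⟩
  obtain ⟨p, hp, hd⟩ := S.exists_nearest x
  have h1 := stepValue_le_growth hκ hκK hγ hε hεB hσ hσB hx hp hd hP hm hs
  have h2 := (le_abs_self _).trans
    (abs_growth_le hκ hκK hγ hε hεB hσ hσB hx hd hP hm hs)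
  have hlow := S.lyapunov_lower hκ hκK u x
  have hW0 := S.lyapunov_nonneg hκ hκK u x
  have hd0 := S.dualDist_nonneg x
  set W := S.lyapunov κ u x
  set d := S.dualDist x
  have hP2 : 1 ≤ P ^ 2 := one_le_pow₀ hP
  have hPP : P ≤ P ^ 2 := by nlinarith
  have hY2 : (1 + ‖u‖ + d) ^ 2 ≤ 6 * (1 + W) := by
    nlinarith [sq_nonneg (‖u‖ - d), sq_nonneg (1 - ‖u‖), sq_nonneg (1 - d)]
  have hrY : (‖u‖ + d) * (1 + ‖u‖ + d) ≤ 6 * (1 + W) := by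
    refine le_trans ?_ hY2
    nlinarith [norm_nonneg u]
  have a1 : γ * ((‖u‖ + d) * (1 + ‖u‖ + d)) * P ≤ γ * (6 * (1 + W)) * P ^ 2 := by
    gcongr
  have a2 : γ ^ 2 * (1 + ‖u‖ + d) ^ 2 * P ^ 2 ≤ γ ^ 2 * (6 * (1 + W)) * P ^ 2 := by
    gcongr
  have a3 := mul_le_mul_of_nonneg_left (add_le_add a1 a2)
    (by positivity : 0 ≤ 8 * (1 + S.dirConst B) ^ 2)
  have a4 : W ≤ 1 * (1 + W) * P ^ 2 := by nlinarith
  linarith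

end PrimalDualSystem

end Expected

/-! ### Expected one-step contraction -/

section ExpectedStep

theorem mul_le_one_of_le_inv {X N e : ℝ} (hN : 0 < N) (he0 : 0 ≤ e) (hXN : X ≤ N)
    (he : e ≤ 1 / N) : X * e ≤ 1 := by
  calc X * e ≤ N * e := mul_le_mul_of_nonneg_right hXN he0
    _ ≤ N * (1 / N) := mul_le_mul_of_nonneg_left he hN.le
    _ = 1 := by field_simp

namespace PrimalDualSystem

variable {n : ℕ} {V : Type*} [NormedAddCommGroup V] [InnerProductSpace ℝ V]
  [FiniteDimensional ℝ V] (S : PrimalDualSystem V n)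
  {Z : Type*} [MeasurableSpace Z]

theorem exists_cross_weight : ∃ κ : ℝ, 0 < κ ∧ κ * ‖S.K‖ ≤ 1 ∧
    κ * (2 * S.L ^ 2 + 5 * ‖S.K‖ ^ 2) ≤ S.ν / 2 ∧ κ * (2 * ‖S.K‖ ^ 2 + 1) ≤ 1 / 2 := by
  have hν := S.ν_pos
  set a := 2 * S.L ^ 2 + 5 * ‖S.K‖ ^ 2 with ha
  set b := 2 * ‖S.K‖ ^ 2 + 1 with hb
  have ha0 : 0 ≤ a := by positivity
  have hb0 : 0 < b := by positivity
  set κ := min (S.ν / 2 / (a + 1)) (1 / 2 / b) with hκ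
  have hκ0 : 0 < κ := lt_min (by positivity) (by positivity)
  have h1 : κ * (a + 1) ≤ S.ν / 2 := (le_div_iff₀ (by positivity)).1 (min_le_left _ _)
  have h2 : κ * b ≤ 1 / 2 := (le_div_iff₀ hb0).1 (min_le_right _ _)
  refine ⟨κ, hκ0, ?_, by linarith, h2⟩
  have h3 : ‖S.K‖ ≤ b := by nlinarith [sq_nonneg (‖S.K‖ - 1), sq_nonneg ‖S.K‖]
  linarith [mul_le_mul_of_nonneg_left h3 hκ0.le]

theorem sq_one_add_le {κ : ℝ} (hκ : 0 ≤ κ) (hκK : κ * ‖S.K‖ ≤ 1) (u : V) (x : Dual n) :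
    (1 + ‖u‖ + S.dualDist x) ^ 2 ≤ 6 * (1 + S.lyapunov κ u x) ∧
      (‖u‖ + S.dualDist x) ^ 2 ≤ 4 * S.lyapunov κ u x := by
  have hlow := S.lyapunov_lower hκ hκK u x
  constructor
  · nlinarith [sq_nonneg (‖u‖ - S.dualDist x), sq_nonneg (1 - ‖u‖), sq_nonneg (1 - S.dualDist x)]
  · nlinarith [sq_nonneg (‖u‖ - S.dualDist x)]

variable {S} in
theorem StepNoise.integrable_m {ρ : Measure Z} {P : Z → ℝ} {B σ : ℝ} {u : V} {x : Dual n}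
    {m : Z → V} {s : Z → Dual n} (h : S.StepNoise ρ P B σ u x m s) (hP : Integrable P ρ) :
    Integrable m ρ :=
  (hP.const_mul _).mono' h.m_meas (ae_of_all _ h.m_le)

variable {S} in
theorem StepNoise.integrable_s {ρ : Measure Z} {P : Z → ℝ} {B σ : ℝ} {u : V} {x : Dual n}
    {m : Z → V} {s : Z → Dual n} (h : S.StepNoise ρ P B σ u x m s) (hP : Integrable P ρ) :
    Integrable s ρ :=
  (hP.const_mul _).mono' h.s_meas (ae_of_all _ h.s_le)

variable {S} in
theorem StepNoise.integral_growth {ρ : Measure Z} [IsProbabilityMeasure ρ] {P : Z → ℝ}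
    {B σ : ℝ} {u : V} {x p : Dual n} {m : Z → V} {s : Z → Dual n}
    (h : S.StepNoise ρ P B σ u x m s) (hP : Integrable P ρ)
    (hP2 : Integrable (fun z => P z ^ 2) ρ) (κ γ ε : ℝ) :
    Integrable (fun z => S.growth κ γ ε σ B u x p (m z) (s z) (P z)) ρ ∧
    ∫ z, S.growth κ γ ε σ B u x p (m z) (s z) (P z) ∂ρ =
      γ * (⟪∫ z, m z ∂ρ, -(2 : ℝ) • u - κ • S.residual x⟫ +
        2 * ⟪S.g + S.K u - ε • x, x - p⟫ +
        κ * ‖S.K‖ * ‖u‖ * (‖x - S.shrink x‖ + ‖S.K‖ * ‖u‖ + σ * B * ∫ z, P z ∂ρ +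
          ε * (S.dualDist x + S.R))) +
      4 * γ ^ 2 * (S.dirConst B) ^ 2 * (1 + ‖u‖ + S.dualDist x) ^ 2 * ∫ z, P z ^ 2 ∂ρ := by
  have hm := h.integrable_m hP
  have hs := h.integrable_s hP
  have im : Integrable (fun z => ⟪m z, -(2 : ℝ) • u - κ • S.residual x⟫) ρ := hm.inner_const _
  have is : Integrable (fun z => ⟪s z, x - p⟫) ρ := hs.inner_const _
  have em : ∫ z, ⟪m z, -(2 : ℝ) • u - κ • S.residual x⟫ ∂ρ =
      ⟪∫ z, m z ∂ρ, -(2 : ℝ) • u - κ • S.residual x⟫ := by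
    rw [real_inner_comm, ← integral_inner hm]
    exact integral_congr_ae (ae_of_all _ fun z => real_inner_comm _ _)
  have es : ∫ z, ⟪s z, x - p⟫ ∂ρ = 0 := by
    have e : ∫ z, ⟪s z, x - p⟫ ∂ρ = ⟪x - p, ∫ z, s z ∂ρ⟫ := by
      rw [← integral_inner hs]
      exact integral_congr_ae (ae_of_all _ fun z => real_inner_comm _ _)
    rw [e, h.s_mean, inner_zero_right]
  unfold growth
  have i1 := im.const_mul γ
  have i2 := i1.add (integrable_const (μ := ρ) (2 * γ * ⟪S.g + S.K u - ε • x, x - p⟫))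
  have i3 := i2.add (is.const_mul (2 * γ))
  have i4 := i3.add (integrable_const (μ := ρ) (γ * (κ * ‖S.K‖ * ‖u‖ * (‖x - S.shrink x‖ +
    ‖S.K‖ * ‖u‖ + ε * (S.dualDist x + S.R)))))
  have i5 := i4.add (hP.const_mul (γ * (κ * ‖S.K‖ * ‖u‖ * (σ * B))))
  have i6 := hP2.const_mul (4 * γ ^ 2 * (S.dirConst B) ^ 2 * (1 + ‖u‖ + S.dualDist x) ^ 2)
  refine ⟨i5.add i6, ?_⟩
  refine (integral_add i5 i6).trans ?_
  rw [integral_add' i4 (hP.const_mul _), integral_add' i3 (integrable_const _),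
    integral_add' i2 (is.const_mul _), integral_add' i1 (integrable_const _)]
  simp only [integral_const_mul, integral_const, probReal_univ, one_smul, em, es]
  ring

variable {S} in
/-- Mean growth of the Lyapunov function in terms of the dissipation. -/
theorem StepNoise.integral_growth_le {ρ : Measure Z} [IsProbabilityMeasure ρ] {P : Z → ℝ}
    {B σ : ℝ} {u : V} {x p : Dual n} {m : Z → V} {s : Z → Dual n}
    (h : S.StepNoise ρ P B σ u x m s) (hP : Integrable P ρ)
    (hP2 : Integrable (fun z => P z ^ 2) ρ) {κ γ ε : ℝ} (hκ : 0 < κ)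
    (hκ1 : κ * (2 * S.L ^ 2 + 5 * ‖S.K‖ ^ 2) ≤ S.ν / 2)
    (hκ2 : κ * (2 * ‖S.K‖ ^ 2 + 1) ≤ 1 / 2) (hγ : 0 ≤ γ) (hε : 0 ≤ ε) (hκε : κ * ε ≤ 1)
    (hRHε : 8 * S.R * S.H * ε ≤ 1) (hx : ∀ j, 0 ≤ x j) (hp : p ∈ S.mult)
    (hd : S.dualDist x = ‖x - p‖) :
    ∫ z, S.growth κ γ ε σ B u x p (m z) (s z) (P z) ∂ρ ≤
      γ * (-(S.ν * ‖u‖ ^ 2) - S.compl x - κ / 2 * ‖S.residual x‖ ^ 2 - ε * S.dualDist x ^ 2 +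
        (2 / S.ν + 3 * κ + 8 * S.R ^ 2 * S.H ^ 2 / κ + 4 * S.R ^ 2 * S.H ^ 2 * ‖S.K‖ ^ 2 +
          κ * S.R ^ 2) * ((σ * B) ^ 2 + (σ * B * ∫ z, P z ∂ρ) ^ 2 + ε ^ 2)) +
      12 * S.dirConst B ^ 2 * (∫ z, P z ^ 2 ∂ρ) * γ ^ 2 * (1 + ‖u‖ ^ 2 + S.dualDist x ^ 2) := by
  rw [(h.integral_growth hP hP2 κ γ ε).2]
  refine add_le_add (mul_le_mul_of_nonneg_left
    (S.first_order_bound hκ hε hκ1 hκ2 hκε hRHε u _ hx hp hd h.m_bias) hγ) ?_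
  have h1 : (1 + ‖u‖ + S.dualDist x) ^ 2 ≤ 3 * (1 + ‖u‖ ^ 2 + S.dualDist x ^ 2) := by
    nlinarith [sq_nonneg (‖u‖ - S.dualDist x), sq_nonneg (1 - ‖u‖),
      sq_nonneg (1 - S.dualDist x)]
  have hP₂ : 0 ≤ ∫ z, P z ^ 2 ∂ρ := integral_nonneg fun z => sq_nonneg _
  have h2 := mul_le_mul_of_nonneg_left h1
    (by positivity : 0 ≤ 4 * γ ^ 2 * S.dirConst B ^ 2 * ∫ z, P z ^ 2 ∂ρ)
  linarith

theorem sq_le_of_abs_le_growth {A γ r d W P g : ℝ} (hW : 0 ≤ W)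
    (hg : |g| ≤ A * (γ * ((r + d) * (1 + r + d)) * P + γ ^ 2 * (1 + r + d) ^ 2 * P ^ 2))
    (hY : (1 + r + d) ^ 2 ≤ 6 * (1 + W)) (hrd : (r + d) ^ 2 ≤ 4 * W) :
    g ^ 2 ≤ 48 * A ^ 2 * γ ^ 2 * (W + W ^ 2) * P ^ 2 +
      144 * A ^ 2 * γ ^ 4 * (1 + W ^ 2) * P ^ 4 := by
  have h2 := pow_le_pow_left₀ (abs_nonneg _) hg 2
  rw [sq_abs] at h2
  have h4 : (γ * ((r + d) * (1 + r + d)) * P) ^ 2 ≤ γ ^ 2 * P ^ 2 * (4 * W * (6 * (1 + W))) := by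
    have h := mul_le_mul hrd hY (sq_nonneg _) (by positivity)
    have := mul_le_mul_of_nonneg_left h (by positivity : 0 ≤ γ ^ 2 * P ^ 2)
    refine le_trans (le_of_eq ?_) this
    ring
  have h5 : (γ ^ 2 * (1 + r + d) ^ 2 * P ^ 2) ^ 2 ≤ γ ^ 4 * P ^ 4 * (72 * (1 + W ^ 2)) := by
    have h6 := pow_le_pow_left₀ (sq_nonneg _) hY 2
    have h7 : (6 * (1 + W)) ^ 2 ≤ 72 * (1 + W ^ 2) := by linarith [sq_nonneg (1 - W)]
    have := mul_le_mul_of_nonneg_left (h6.trans h7) (by positivity : 0 ≤ γ ^ 4 * P ^ 4)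
    refine le_trans (le_of_eq ?_) this
    ring
  generalize γ * ((r + d) * (1 + r + d)) * P = X at *
  generalize γ ^ 2 * (1 + r + d) ^ 2 * P ^ 2 = Y at *
  have h3 := mul_nonneg (sq_nonneg A) (sq_nonneg (X - Y))
  have h9 := mul_le_mul_of_nonneg_left (add_le_add h4 h5) (by positivity : 0 ≤ 2 * A ^ 2)
  linarith

variable {S} in
theorem growth_sq_le {κ γ ε σ B : ℝ} (hκ : 0 ≤ κ) (hκK : κ * ‖S.K‖ ≤ 1) (hγ : 0 ≤ γ)
    (hε : 0 ≤ ε) (hεB : ε ≤ B) (hσ : 0 ≤ σ) (hσB : σ ≤ B) {u : V} {x p : Dual n}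
    (hx : ∀ j, 0 ≤ x j) (hd : S.dualDist x = ‖x - p‖) {m : V} {s : Dual n}
    {P : ℝ} (hP : 1 ≤ P) (hm : ‖m‖ ≤ B * (1 + ‖u‖ + S.dualDist x) * P)
    (hs : ‖s‖ ≤ σ * B * P) :
    S.growth κ γ ε σ B u x p m s P ^ 2 ≤
      48 * (8 * (1 + S.dirConst B) ^ 2) ^ 2 * γ ^ 2 *
        (S.lyapunov κ u x + S.lyapunov κ u x ^ 2) * P ^ 2 +
      144 * (8 * (1 + S.dirConst B) ^ 2) ^ 2 * γ ^ 4 * (1 + S.lyapunov κ u x ^ 2) * P ^ 4 :=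
  sq_le_of_abs_le_growth (S.lyapunov_nonneg hκ hκK u x)
    (abs_growth_le hκ hκK hγ hε hεB hσ hσB hx hd hP hm hs)
    (S.sq_one_add_le hκ hκK u x).1 (S.sq_one_add_le hκ hκK u x).2

variable {S} in
/-- Second moment of the growth of the Lyapunov function. -/
theorem StepNoise.integral_growth_sq_le {ρ : Measure Z} [IsProbabilityMeasure ρ] {P : Z → ℝ}
    {B σ : ℝ} {u : V} {x p : Dual n} {m : Z → V} {s : Z → Dual n}
    (h : S.StepNoise ρ P B σ u x m s) (hP1 : ∀ z, 1 ≤ P z) (hP : Integrable P ρ)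
    (hP2 : Integrable (fun z => P z ^ 2) ρ) (hP4 : Integrable (fun z => P z ^ 4) ρ)
    {κ γ ε : ℝ} (hκ : 0 ≤ κ) (hκK : κ * ‖S.K‖ ≤ 1) (hγ : 0 ≤ γ)
    (hε : 0 ≤ ε) (hεB : ε ≤ B) (hσ : 0 ≤ σ) (hσB : σ ≤ B)
    (hx : ∀ j, 0 ≤ x j) (hd : S.dualDist x = ‖x - p‖) :
    Integrable (fun z => S.growth κ γ ε σ B u x p (m z) (s z) (P z) ^ 2) ρ ∧
    ∫ z, S.growth κ γ ε σ B u x p (m z) (s z) (P z) ^ 2 ∂ρ ≤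
      48 * (8 * (1 + S.dirConst B) ^ 2) ^ 2 * (∫ z, P z ^ 2 ∂ρ) * γ ^ 2 *
        (S.lyapunov κ u x + S.lyapunov κ u x ^ 2) +
      144 * (8 * (1 + S.dirConst B) ^ 2) ^ 2 * (∫ z, P z ^ 4 ∂ρ) * γ ^ 4 *
        (1 + S.lyapunov κ u x ^ 2) := by
  have hle := fun z => growth_sq_le hκ hκK hγ hε hεB hσ hσB hx hd (hP1 z) (h.m_le z) (h.s_le z)
  have hgi := (h.integral_growth (p := p) hP hP2 κ γ ε).1
  have i1 := hP2.const_mul (48 * (8 * (1 + S.dirConst B) ^ 2) ^ 2 * γ ^ 2 *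
    (S.lyapunov κ u x + S.lyapunov κ u x ^ 2))
  have i2 := hP4.const_mul (144 * (8 * (1 + S.dirConst B) ^ 2) ^ 2 * γ ^ 4 *
    (1 + S.lyapunov κ u x ^ 2))
  have hi : Integrable (fun z => S.growth κ γ ε σ B u x p (m z) (s z) (P z) ^ 2) ρ :=
    (i1.add i2).mono' (hgi.aestronglyMeasurable.pow 2) (ae_of_all _ fun z => by
      rw [Real.norm_of_nonneg (sq_nonneg _)]
      exact hle z)
  refine ⟨hi, (integral_mono hi (i1.add i2) hle).trans ?_⟩
  refine (integral_add i1 i2).trans_le ?_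
  rw [integral_const_mul, integral_const_mul]
  exact le_of_eq (by ring)

variable {S} in
-- Nonnegativity of the Lyapunov function allows the pathwise upper bound to be squared, and it lets
-- the integrals be compared without first proving the left side integrable.
theorem StepNoise.integral_stepValue_le {ρ : Measure Z} [IsProbabilityMeasure ρ] {P : Z → ℝ}
    {B σ : ℝ} {u : V} {x p : Dual n} {m : Z → V} {s : Z → Dual n}
    (h : S.StepNoise ρ P B σ u x m s) (hP1 : ∀ z, 1 ≤ P z) (hP : Integrable P ρ)
    (hP2 : Integrable (fun z => P z ^ 2) ρ) (hP4 : Integrable (fun z => P z ^ 4) ρ)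
    {κ γ ε : ℝ} (hκ : 0 ≤ κ) (hκK : κ * ‖S.K‖ ≤ 1) (hγ : 0 ≤ γ)
    (hε : 0 ≤ ε) (hεB : ε ≤ B) (hσ : 0 ≤ σ) (hσB : σ ≤ B)
    (hx : ∀ j, 0 ≤ x j) (hp : p ∈ S.mult) (hd : S.dualDist x = ‖x - p‖) :
    ∫ z, S.stepValue κ γ ε u x (m z) (s z) ∂ρ ≤ S.lyapunov κ u x +
        ∫ z, S.growth κ γ ε σ B u x p (m z) (s z) (P z) ∂ρ ∧
    ∫ z, S.stepValue κ γ ε u x (m z) (s z) ^ 2 ∂ρ ≤ S.lyapunov κ u x ^ 2 +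
        2 * S.lyapunov κ u x * ∫ z, S.growth κ γ ε σ B u x p (m z) (s z) (P z) ∂ρ +
        ∫ z, S.growth κ γ ε σ B u x p (m z) (s z) (P z) ^ 2 ∂ρ := by
  have hgi := (h.integral_growth (p := p) hP hP2 κ γ ε).1
  have hΔ2i := (h.integral_growth_sq_le (p := p) hP1 hP hP2 hP4 hκ hκK hγ hε hεB hσ hσB hx hd).1
  have hstep : ∀ z, S.stepValue κ γ ε u x (m z) (s z) ≤ S.lyapunov κ u x +
      S.growth κ γ ε σ B u x p (m z) (s z) (P z) := fun z =>
    stepValue_le_growth hκ hκK hγ hε hεB hσ hσB hx hp hd (hP1 z) (h.m_le z) (h.s_le z)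
  have hstep0 : ∀ z, 0 ≤ S.stepValue κ γ ε u x (m z) (s z) := fun z =>
    S.lyapunov_nonneg hκ hκK _ _
  generalize S.lyapunov κ u x = W at *
  generalize hΔ : (fun z => S.growth κ γ ε σ B u x p (m z) (s z) (P z)) = Δ at *
  have hΔz : ∀ z, S.growth κ γ ε σ B u x p (m z) (s z) (P z) = Δ z := fun z => congrFun hΔ z
  simp only [hΔz] at *
  constructor
  · have h2 : ∫ z, (W + Δ z) ∂ρ = W + ∫ z, Δ z ∂ρ := by
      rw [integral_add (integrable_const _) hgi]; simp
    rw [← h2]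
    exact integral_mono_of_nonneg (ae_of_all _ hstep0) ((integrable_const _).add hgi)
      (ae_of_all _ hstep)
  · have i1 : Integrable (fun z => W ^ 2 + 2 * W * Δ z) ρ :=
      (integrable_const _).add (hgi.const_mul _)
    have h2 : ∫ z, (W ^ 2 + 2 * W * Δ z + Δ z ^ 2) ∂ρ =
        W ^ 2 + 2 * W * ∫ z, Δ z ∂ρ + ∫ z, Δ z ^ 2 ∂ρ := by
      rw [integral_add i1 hΔ2i, integral_add (integrable_const _) (hgi.const_mul _),
        integral_const_mul]
      simp
    rw [← h2]
    refine integral_mono_of_nonneg (ae_of_all _ fun z => sq_nonneg _) (i1.add hΔ2i)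
      (ae_of_all _ fun z => ?_)
    have := pow_le_pow_left₀ (hstep0 z) (hstep z) 2
    exact this.trans (le_of_eq (by ring))

/-- The dissipation that does not carry `ε` controls `W` up to `W²`. This gives contraction at the
full rate `γ`, at the price of a term `γ W²` that the second moment has to pay for. -/
theorem first_moment_real_bound {ν κ r d vn Γ ε γ W D c C₃ C₄ : ℝ} (hγ : 0 ≤ γ) (hε : 0 ≤ ε)
    (hΓ : 0 ≤ Γ) (hc0 : 0 ≤ c) (hC₃ : 0 < C₃) (hcν : c ≤ ν / 2) (hc1 : c ≤ 1) (hcκ : c ≤ κ / 2)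
    (hW : W ≤ C₃ * (r ^ 2 + Γ + vn ^ 2 + W ^ 2))
    (hD : D ≤ -(γ * (ν / 2 * r ^ 2 + Γ + κ / 2 * vn ^ 2)) - γ * (ε / 2) * d ^ 2 + C₄ * γ ^ 2) :
    D ≤ -(c / C₃ * γ * W) + c * γ * W ^ 2 + C₄ * γ ^ 2 := by
  have h3 : c * (r ^ 2 + Γ + vn ^ 2) ≤ ν / 2 * r ^ 2 + Γ + κ / 2 * vn ^ 2 := by
    have a1 := mul_le_mul_of_nonneg_right hcν (sq_nonneg r)
    have a2 := mul_le_mul_of_nonneg_right hc1 hΓ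
    have a3 := mul_le_mul_of_nonneg_right hcκ (sq_nonneg vn)
    linarith
  have h4 : c / C₃ * W ≤ c * (r ^ 2 + Γ + vn ^ 2) + c * W ^ 2 := by
    rw [div_mul_eq_mul_div, div_le_iff₀ hC₃]
    have := mul_le_mul_of_nonneg_left hW hc0
    linarith
  have h6 := mul_le_mul_of_nonneg_left (h4.trans (add_le_add_left h3 _)) hγ
  have h7 : 0 ≤ γ * (ε / 2) * d ^ 2 := by positivity
  linarith

/-- One step contracts the mean of the Lyapunov function at the fast rate `γ`, up to its second
moment, which itself contracts at the slow rate `γ ε`. -/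
theorem exists_expected_step {κ : ℝ} (hκ0 : 0 < κ) (hκK : κ * ‖S.K‖ ≤ 1)
    (hκ1 : κ * (2 * S.L ^ 2 + 5 * ‖S.K‖ ^ 2) ≤ S.ν / 2)
    (hκ2 : κ * (2 * ‖S.K‖ ^ 2 + 1) ≤ 1 / 2) (ρ : Measure Z) [IsProbabilityMeasure ρ]
    {P : Z → ℝ} (hP1 : ∀ z, 1 ≤ P z) (hPi : Integrable P ρ)
    (hP2i : Integrable (fun z => P z ^ 2) ρ) (hP4i : Integrable (fun z => P z ^ 4) ρ)
    {B Q : ℝ} (hB : 0 ≤ B) (hQ : 0 ≤ Q) :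
    ∃ c C δ : ℝ, 0 < c ∧ 0 ≤ C ∧ 0 < δ ∧ ∀ γ ε σ : ℝ, 0 ≤ γ → γ ≤ δ → 0 ≤ ε → ε ≤ δ →
      γ ≤ δ * ε → 0 ≤ σ → σ ≤ B → ε ≤ B → σ ^ 2 ≤ Q * γ → ε ^ 2 ≤ Q * γ →
      ∀ (u : V) (x : Dual n), (∀ j, 0 ≤ x j) → ∀ (m : Z → V) (s : Z → Dual n),
      S.StepNoise ρ P B σ u x m s →
      ∫ z, S.stepValue κ γ ε u x (m z) (s z) ∂ρ ≤
        (1 - c * γ) * S.lyapunov κ u x + C * γ * S.lyapunov κ u x ^ 2 + C * γ ^ 2 ∧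
      ∫ z, S.stepValue κ γ ε u x (m z) (s z) ^ 2 ∂ρ ≤
        (1 - c * (γ * ε)) * S.lyapunov κ u x ^ 2 + C * γ ^ 2 * S.lyapunov κ u x +
          C * γ ^ 4 := by
  obtain ⟨C₃, hC₃, hcoer⟩ := S.exists_lyapunov_le_dissipation
  have hν := S.ν_pos
  have hR := S.R_nonneg
  have hH := S.H_nonneg
  have hP0 : ∀ z, 0 ≤ P z := fun z => zero_le_one.trans (hP1 z)
  set P₁ := ∫ z, P z ∂ρ with hP₁
  set P₂ := ∫ z, P z ^ 2 ∂ρ with hP₂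
  set P₄ := ∫ z, P z ^ 4 ∂ρ with hP₄
  have hP₁0 : 0 ≤ P₁ := integral_nonneg hP0
  have hP₂0 : 0 ≤ P₂ := integral_nonneg fun z => sq_nonneg _
  have hP₄0 : 0 ≤ P₄ := integral_nonneg fun z => pow_nonneg (hP0 z) 4
  set D := S.dirConst B with hD
  have hD0 : 0 ≤ D := by rw [hD, dirConst]; positivity
  set C₁ := 2 / S.ν + 3 * κ + 8 * S.R ^ 2 * S.H ^ 2 / κ + 4 * S.R ^ 2 * S.H ^ 2 * ‖S.K‖ ^ 2 +
    κ * S.R ^ 2 with hC₁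
  have hC₁0 : 0 ≤ C₁ := by positivity
  set C₂ := 12 * D ^ 2 * P₂ with hC₂
  have hC₂0 : 0 ≤ C₂ := by positivity
  set Q' := (B ^ 2 + B ^ 2 * P₁ ^ 2 + 1) * Q with hQ'
  set C₄ := C₁ * Q' + C₂ with hC₄
  have hC₄0 : 0 ≤ C₄ := by positivity
  set A := 8 * (1 + D) ^ 2 with hA
  set C₅ := 48 * A ^ 2 * P₂ with hC₅
  set C₆ := 144 * A ^ 2 * P₄ with hC₆
  have hC₅0 : 0 ≤ C₅ := by positivity
  have hC₆0 : 0 ≤ C₆ := by positivity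
  set c₁ := min (S.ν / 2) (1 / 2) with hc₁
  have hc₁0 : 0 < c₁ := lt_min (by positivity) (by norm_num)
  have hc₁ν : c₁ ≤ S.ν / 2 := min_le_left _ _
  have hc₁h : c₁ ≤ 1 / 2 := min_le_right _ _
  set c₀ := min c₁ (κ / 2) with hc₀
  have hc₀0 : 0 < c₀ := lt_min hc₁0 (by positivity)
  -- Each summand is the reciprocal of one smallness threshold, so `δ = 1 / N` meets all of them at
  -- once.
  set N := 1 + κ + 8 * S.R * S.H + 2 * C₂ / S.ν + 2 * C₂ + 2 * (C₅ + C₆) / c₁ with hN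
  have n1 : 0 ≤ 8 * S.R * S.H := by positivity
  have n2 : 0 ≤ 2 * C₂ / S.ν := by positivity
  have n3 : 0 ≤ 2 * (C₅ + C₆) / c₁ := by positivity
  have hN1 : 1 ≤ N := by linarith
  have hNpos : 0 < N := by linarith
  have hcle : min (c₀ / C₃) (c₁ / 2) ≤ c₀ / C₃ := min_le_left _ _
  have hcle' : min (c₀ / C₃) (c₁ / 2) ≤ c₁ / 2 := min_le_right _ _
  refine ⟨min (c₀ / C₃) (c₁ / 2), c₀ + 2 * C₄ + C₅ + C₆, 1 / N,
    lt_min (by positivity) (by positivity), by positivity, by positivity, ?_⟩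
  intro γ ε σ hγ hγδ hε hεδ hγε hσ hσB hεB hσQ hεQ u x hx m s hnoise
  have hN1' : 1 / N ≤ 1 := (div_le_one hNpos).2 hN1
  have hε1 : ε ≤ 1 := hεδ.trans hN1'
  have hγ1 : γ ≤ 1 := hγδ.trans hN1'
  have s1 : κ * ε ≤ 1 := mul_le_one_of_le_inv hNpos hε (by linarith) hεδ
  have s2 : 8 * S.R * S.H * ε ≤ 1 := mul_le_one_of_le_inv hNpos hε (by linarith) hεδ
  have s3 : C₂ * γ ≤ S.ν / 2 := by
    have := mul_le_one_of_le_inv (X := 2 * C₂ / S.ν) hNpos hγ (by linarith) hγδ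
    rw [div_mul_eq_mul_div, div_le_one hν] at this
    linarith
  have s4 : C₂ * γ ≤ ε / 2 := by
    have h1 := mul_le_one_of_le_inv (X := 2 * C₂) hNpos (by positivity) (by linarith)
      (le_refl (1 / N))
    have h2 := mul_le_mul_of_nonneg_left hγε (by positivity : 0 ≤ 2 * C₂)
    have h3 := mul_le_mul_of_nonneg_right h1 hε
    linarith
  have s5 : (C₅ + C₆) * γ ≤ c₁ / 2 * ε := by
    have h1 := mul_le_one_of_le_inv (X := 2 * (C₅ + C₆) / c₁) hNpos (by positivity) (by linarith)
      (le_refl (1 / N))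
    rw [div_mul_eq_mul_div, div_le_one hc₁0] at h1
    have h2 := mul_le_mul_of_nonneg_left hγε (by positivity : 0 ≤ 2 * (C₅ + C₆))
    have h3 := mul_le_mul_of_nonneg_right h1 hε
    linarith
  obtain ⟨p, hp, hd⟩ := S.exists_nearest x
  set W := S.lyapunov κ u x with hW
  have hW0 : 0 ≤ W := S.lyapunov_nonneg hκ0.le hκK u x
  have hup := S.lyapunov_upper hκ0.le hκK u x
  rw [← hW] at hup
  have hΓ := S.compl_nonneg hx
  have hmean := hnoise.integral_growth_le hPi hP2i hκ0 hκ1 hκ2 hγ hε s1 s2 hx hp hd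
  rw [← hP₁, ← hP₂, ← hD, ← hC₁, ← hC₂] at hmean
  have hF := (hnoise.integral_growth_sq_le (p := p) hP1 hPi hP2i hP4i hκ0.le hκK hγ hε hεB hσ hσB
    hx hd).2
  obtain ⟨hstep1, hstep2⟩ := hnoise.integral_stepValue_le hP1 hPi hP2i hP4i hκ0.le hκK hγ hε hεB
    hσ hσB hx hp hd
  have hcoer' := hcoer κ hκ0.le hκK u x hx
  rw [← hW] at hF hstep1 hstep2 hcoer'
  rw [← hP₂, ← hP₄, ← hD, ← hA, ← hC₅, ← hC₆] at hF
  -- Bias, sampling error and regularization enter through their squares, each of order `γ`; after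
  -- the factor `γ` of the step they match the variance term.
  have hq : (σ * B) ^ 2 + (σ * B * P₁) ^ 2 + ε ^ 2 ≤ Q' * γ := by
    have h1 := mul_le_mul_of_nonneg_right hσQ (by positivity : 0 ≤ B ^ 2 + B ^ 2 * P₁ ^ 2)
    rw [hQ']
    linarith
  have hmean' := mean_drift_bound hγ hC₁0 hmean hq s3 s4
  rw [← hC₄] at hmean'
  clear_value C₁ C₂ C₄ C₅ C₆ Q' c₁ D W
  constructor
  · have h1 := first_moment_real_bound hγ hε hΓ hc₀0.le hC₃
      ((min_le_left _ _).trans hc₁ν) ((min_le_left _ _).trans (hc₁h.trans (by norm_num)))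
      (min_le_right _ _) hcoer' hmean'
    have h5 := mul_le_mul_of_nonneg_right hcle (by positivity : 0 ≤ γ * W)
    have h8 : 0 ≤ (2 * C₄ + C₅ + C₆) * γ * W ^ 2 := by positivity
    have h9 : 0 ≤ (c₀ + C₄ + C₅ + C₆) * γ ^ 2 := by positivity
    linarith
  · have h2 := second_moment_real_bound (c := c₁) hγ hγ1 hε hε1 hκ0.le hΓ hW0 hC₆0
      hc₁ν hc₁h hc₁0.le hup hmean' hF s5
    have h3 := mul_le_mul_of_nonneg_right hcle' (by positivity : 0 ≤ γ * ε * W ^ 2)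
    have h4 : 0 ≤ (c₀ + C₆) * γ ^ 2 * W := by positivity
    have h5 : 0 ≤ (c₀ + 2 * C₄ + C₅) * γ ^ 4 := by positivity
    linarith

end PrimalDualSystem

end ExpectedStep

/-! ### The two-point gradient estimate -/

section Game

variable {N n : ℕ} {d : Fin N → ℕ}

/-- The linear part of the constraint function. -/
def couplingMap (K : Matrix (Fin n) (Σ i : Fin N, Fin (d i)) ℝ) : Action d →L[ℝ] Dual n :=
  LinearMap.toContinuousLinearMap (Matrix.toEuclideanLin K)

theorem constraintFun_eq (K : Matrix (Fin n) (Σ i : Fin N, Fin (d i)) ℝ) (l : Dual n)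
    (a : Action d) : constraintFun K l a = couplingMap K a - l := rfl

theorem norm_action_le_of_abs_le {x y : Action d} (h : ∀ p, |x p| ≤ |y p|) : ‖x‖ ≤ ‖y‖ := by
  rw [EuclideanSpace.norm_eq, EuclideanSpace.norm_eq]
  refine Real.sqrt_le_sqrt (Finset.sum_le_sum fun j _ => ?_)
  rw [Real.norm_eq_abs, Real.norm_eq_abs]
  exact pow_le_pow_left₀ (abs_nonneg _) (h j) 2

/-- The growth condition acts outside some ball, and compactness with continuity of the derivative
covers the ball. -/
theorem exists_fderiv_bound {V : Type*} [NormedAddCommGroup V] [NormedSpace ℝ V]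
    [ProperSpace V] {f : V → ℝ} (hf : ContDiff ℝ 1 f)
    (hgrow : (fun x => fderiv ℝ f x) =O[Bornology.cobounded V] fun x => ‖x‖) :
    ∃ B : ℝ, 0 ≤ B ∧ ∀ x, ‖fderiv ℝ f x‖ ≤ B * (1 + ‖x‖) := by
  obtain ⟨c, hc0, hc⟩ := hgrow.exists_nonneg
  have hb := hc.bound
  rw [(Filter.hasBasis_cobounded_norm (E := V)).eventually_iff] at hb
  obtain ⟨r, -, hr⟩ := hb
  obtain ⟨b, hb⟩ := (isCompact_closedBall (0 : V) r).exists_bound_of_continuousOn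
    (hf.continuous_fderiv one_ne_zero).continuousOn
  refine ⟨c + |b|, by positivity, fun x => ?_⟩
  rcases le_total r ‖x‖ with h | h
  · have h1 := hr h
    rw [norm_norm] at h1
    have : 0 ≤ |b| * (1 + ‖x‖) := by positivity
    nlinarith
  · have h1 := hb x (mem_closedBall_zero_iff.2 h)
    have h2 : |b| ≤ |b| * (1 + ‖x‖) := le_mul_of_one_le_right (abs_nonneg _) (by simp)
    have h3 : 0 ≤ c * (1 + ‖x‖) := by positivity
    linarith [le_abs_self b]

theorem abs_sub_le_of_fderiv_bound {V : Type*} [NormedAddCommGroup V] [NormedSpace ℝ V]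
    {f : V → ℝ} (hf : ContDiff ℝ 1 f) {B : ℝ} (hB : 0 ≤ B)
    (hbound : ∀ x, ‖fderiv ℝ f x‖ ≤ B * (1 + ‖x‖)) (x w : V) :
    |f (x + w) - f x| ≤ B * (1 + ‖x‖ + ‖w‖) * ‖w‖ := by
  have h := (convex_closedBall (0 : V) (‖x‖ + ‖w‖)).norm_image_sub_le_of_norm_fderiv_le
    (f := f) (C := B * (1 + ‖x‖ + ‖w‖)) (x := x) (y := x + w)
    (fun y _ => (hf.differentiable one_ne_zero) y)
    (fun y hy => (hbound y).trans (mul_le_mul_of_nonneg_left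
      (by linarith [mem_closedBall_zero_iff.1 hy]) hB))
    (mem_closedBall_zero_iff.2 (by linarith [norm_nonneg w]))
    (mem_closedBall_zero_iff.2 (norm_add_le _ _))
  simpa using h

theorem continuous_gradEstimate {J : Fin N → Action d → ℝ} (hJ : ∀ i, Continuous (J i))
    (K : Matrix (Fin n) (Σ i : Fin N, Fin (d i)) ℝ) (l : Dual n) (σ : ℝ) :
    Continuous fun w : Action d × Action d × Dual n =>
      gradEstimate J K l σ w.1 w.2.1 w.2.2 := by
  have hU : ∀ (i : Fin N) (f : Action d × Action d × Dual n → Action d), Continuous f →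
      Continuous fun w : Action d × Action d × Dual n => lagrangianCost J K l i (f w) w.2.2 := by
    intro i f hf
    have h1 : Continuous fun w : Action d × Action d × Dual n => couplingMap K (f w) - l :=
      ((couplingMap K).continuous.comp hf).sub continuous_const
    exact ((hJ i).comp hf).add ((continuous_snd.comp continuous_snd).inner h1)
  refine (PiLp.continuous_toLp 2 _).comp (continuous_pi fun p => ?_)
  refine ((hU p.1 _ (continuous_fst.comp continuous_snd)).sub (hU p.1 _ continuous_fst)).mul ?_
  fun_prop

/-- Coordinates of `z` as a joint action. -/
def toAction (z : (Σ i : Fin N, Fin (d i)) → ℝ) : Action d := WithLp.toLp 2 z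

theorem continuous_toAction : Continuous (toAction (d := d)) := PiLp.continuous_toLp 2 _

theorem integrable_of_poly_bound {E : Type*} [NormedAddCommGroup E]
    {F : ((Σ i : Fin N, Fin (d i)) → ℝ) → E} (hF : AEStronglyMeasurable F (stdGaussianPi _))
    (C : ℝ) (k : ℕ) (h : ∀ z, ‖F z‖ ≤ C * (1 + ‖toAction z‖) ^ k) :
    Integrable F (stdGaussianPi (Σ i : Fin N, Fin (d i))) :=
  ((integrable_one_add_norm_pow_stdGaussianPi k).const_mul C).mono' hF (ae_of_all _ h)

theorem hasDerivAt_toAction_update (z : (Σ i : Fin N, Fin (d i)) → ℝ) (p : Σ i : Fin N, Fin (d i))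
    (y : ℝ) : HasDerivAt (fun y => toAction (Function.update z p y))
      (EuclideanSpace.single p (1 : ℝ) : Action d) y := by
  have h1 : HasDerivAt (fun y : ℝ => toAction (Function.update z p 0) +
      y • (EuclideanSpace.single p (1 : ℝ) : Action d)) ((1 : ℝ) • EuclideanSpace.single p 1) y :=
    ((hasDerivAt_id y).smul_const _).const_add _
  rw [one_smul] at h1
  refine h1.congr_of_eventuallyEq (Eventually.of_forall fun y => PiLp.ext fun q => ?_)
  by_cases h : q = p
  · subst h; simp [toAction]
  · simp [toAction, h]

theorem lagrangianCost_sub (J : Fin N → Action d → ℝ)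
    (K : Matrix (Fin n) (Σ i : Fin N, Fin (d i)) ℝ) (l : Dual n) (i : Fin N) (μ w : Action d)
    (lam : Dual n) : lagrangianCost J K l i (μ + w) lam - lagrangianCost J K l i μ lam =
      J i (μ + w) - J i μ + ⟪lam, couplingMap K w⟫ := by
  rw [lagrangianCost, lagrangianCost, constraintFun_eq, constraintFun_eq, map_add,
    inner_sub_right, inner_sub_right, inner_add_right]
  ring

section Bounds

variable {J : Fin N → Action d → ℝ} {B : ℝ}

theorem abs_lagrangianCost_sub_le (hJ : ∀ i, ContDiff ℝ 1 (J i)) (hB : 0 ≤ B)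
    (hbound : ∀ i x, ‖fderiv ℝ (J i) x‖ ≤ B * (1 + ‖x‖))
    (K : Matrix (Fin n) (Σ i : Fin N, Fin (d i)) ℝ) (l : Dual n) (i : Fin N) (μ w : Action d)
    (lam : Dual n) : |lagrangianCost J K l i (μ + w) lam - lagrangianCost J K l i μ lam| ≤
      (B * (1 + ‖μ‖ + ‖w‖) + ‖couplingMap K‖ * ‖lam‖) * ‖w‖ := by
  rw [lagrangianCost_sub]
  refine (abs_add_le _ _).trans ?_
  rw [add_mul]
  refine add_le_add (abs_sub_le_of_fderiv_bound (hJ i) hB (hbound i) μ w) ?_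
  refine (abs_real_inner_le_norm _ _).trans ?_
  calc ‖lam‖ * ‖couplingMap K w‖ ≤ ‖lam‖ * (‖couplingMap K‖ * ‖w‖) := by
        gcongr; exact (couplingMap K).le_opNorm w
    _ = _ := by ring

theorem gradEstimate_apply (K : Matrix (Fin n) (Σ i : Fin N, Fin (d i)) ℝ) (l : Dual n) {σ : ℝ}
    (hσ : 0 < σ) (μ : Action d) (lam : Dual n) (z : (Σ i : Fin N, Fin (d i)) → ℝ)
    (p : Σ i : Fin N, Fin (d i)) :
    gradEstimate J K l σ μ (μ + σ • toAction z) lam p =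
      σ⁻¹ * (z p * (lagrangianCost J K l p.1 (μ + σ • toAction z) lam -
        lagrangianCost J K l p.1 μ lam)) := by
  simp only [gradEstimate, toAction, PiLp.add_apply, PiLp.smul_apply, smul_eq_mul,
    add_sub_cancel_left]
  field_simp

/-- The cost difference carries a factor `σ` that cancels the remaining `σ⁻¹`, so the bound is
uniform over `0 < σ ≤ T`. The third power of the noise norm comes from the growth of the gradient,
the increment and the multiplier `z`. -/
theorem norm_gradEstimate_le (hJ : ∀ i, ContDiff ℝ 1 (J i)) (hB : 0 ≤ B)
    (hbound : ∀ i x, ‖fderiv ℝ (J i) x‖ ≤ B * (1 + ‖x‖))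
    (K : Matrix (Fin n) (Σ i : Fin N, Fin (d i)) ℝ) (l : Dual n) {σ T : ℝ}
    (hσ : 0 < σ) (hσT : σ ≤ T) (μ : Action d) (lam : Dual n)
    (z : (Σ i : Fin N, Fin (d i)) → ℝ) :
    ‖gradEstimate J K l σ μ (μ + σ • toAction z) lam‖ ≤
      (B * (1 + ‖μ‖ + T) + ‖couplingMap K‖ * ‖lam‖) * (1 + ‖toAction z‖) ^ 3 := by
  set r := ‖toAction z‖ with hr
  have hr0 : 0 ≤ r := norm_nonneg _
  have hT : 0 ≤ T := hσ.le.trans hσT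
  set Q := (B * (1 + ‖μ‖ + σ * r) + ‖couplingMap K‖ * ‖lam‖) * r with hQ
  have hQ0 : 0 ≤ Q := by positivity
  have h1 : ‖gradEstimate J K l σ μ (μ + σ • toAction z) lam‖ ≤ ‖Q • toAction z‖ := by
    refine norm_action_le_of_abs_le fun p => ?_
    rw [gradEstimate_apply K l hσ]
    have h2 := abs_lagrangianCost_sub_le hJ hB hbound K l p.1 μ (σ • toAction z) lam
    rw [norm_smul, Real.norm_of_nonneg hσ.le, ← hr] at h2
    rw [abs_mul, abs_mul, abs_of_pos (inv_pos.2 hσ), PiLp.smul_apply, smul_eq_mul, abs_mul,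
      abs_of_nonneg hQ0, show toAction z p = z p from rfl]
    calc σ⁻¹ * (|z p| * |lagrangianCost J K l p.1 (μ + σ • toAction z) lam -
          lagrangianCost J K l p.1 μ lam|) ≤ σ⁻¹ * (|z p| *
          ((B * (1 + ‖μ‖ + σ * r) + ‖couplingMap K‖ * ‖lam‖) * (σ * r))) := by gcongr
      _ = Q * |z p| := by rw [hQ]; field_simp
  refine h1.trans ?_
  rw [norm_smul, Real.norm_of_nonneg hQ0, ← hr, hQ]
  have h3 : B * (1 + ‖μ‖ + σ * r) + ‖couplingMap K‖ * ‖lam‖ ≤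
      (B * (1 + ‖μ‖ + T) + ‖couplingMap K‖ * ‖lam‖) * (1 + r) := by
    have : σ * r ≤ T * r := mul_le_mul_of_nonneg_right hσT hr0
    have a1 : B * (σ * r) ≤ B * (T * r) := mul_le_mul_of_nonneg_left this hB
    have a2 : 0 ≤ B * T + B * (1 + ‖μ‖) * r + ‖couplingMap K‖ * ‖lam‖ * r := by positivity
    linarith
  have h4 : r * r ≤ (1 + r) ^ 2 := by nlinarith
  calc (B * (1 + ‖μ‖ + σ * r) + ‖couplingMap K‖ * ‖lam‖) * r * r
      = (B * (1 + ‖μ‖ + σ * r) + ‖couplingMap K‖ * ‖lam‖) * (r * r) := by ring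
    _ ≤ ((B * (1 + ‖μ‖ + T) + ‖couplingMap K‖ * ‖lam‖) * (1 + r)) * (1 + r) ^ 2 :=
        mul_le_mul h3 h4 (by positivity) (by positivity)
    _ = _ := by ring

/-- The gradient estimate is an unbiased estimate of the Gaussian average of the Lagrangian
pseudo-gradient. -/
theorem integral_gradEstimate (hJ : ∀ i, ContDiff ℝ 1 (J i)) (hB : 0 ≤ B)
    (hbound : ∀ i x, ‖fderiv ℝ (J i) x‖ ≤ B * (1 + ‖x‖))
    (K : Matrix (Fin n) (Σ i : Fin N, Fin (d i)) ℝ) (l : Dual n) {σ : ℝ}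
    (hσ : 0 < σ) (μ : Action d) (lam : Dual n)
    (hM : Integrable (fun z => pseudoGradient J (μ + σ • toAction z)) (stdGaussianPi _)) :
    ∫ z, gradEstimate J K l σ μ (μ + σ • toAction z) lam ∂stdGaussianPi _ =
      ∫ z, (pseudoGradient J (μ + σ • toAction z) + (couplingMap K).adjoint lam)
        ∂stdGaussianPi _ := by
  classical
  have hcont : Continuous fun z : (Σ i : Fin N, Fin (d i)) → ℝ => μ + σ • toAction z :=
    continuous_const.add (continuous_toAction.const_smul σ)
  have hGi : Integrable (fun z => gradEstimate J K l σ μ (μ + σ • toAction z) lam)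
      (stdGaussianPi _) :=
    integrable_of_poly_bound ((continuous_gradEstimate (fun i => (hJ i).continuous) K l σ).comp
      (continuous_const.prodMk (hcont.prodMk continuous_const))).aestronglyMeasurable _ 3
      (norm_gradEstimate_le hJ hB hbound K l hσ le_rfl μ lam)
  have hRi : Integrable (fun z => pseudoGradient J (μ + σ • toAction z) +
      (couplingMap K).adjoint lam) (stdGaussianPi _) := hM.add (integrable_const _)
  refine PiLp.ext fun p => ?_
  have hproj : ∀ F : ((Σ i : Fin N, Fin (d i)) → ℝ) → Action d,
      Integrable F (stdGaussianPi _) →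
      (∫ z, F z ∂stdGaussianPi _) p = ∫ z, F z p ∂stdGaussianPi _ := fun F hF =>
    ((EuclideanSpace.proj (𝕜 := ℝ) p).integral_comp_comm hF).symm
  rw [hproj _ hGi, hproj _ hRi]
  set f : ((Σ i : Fin N, Fin (d i)) → ℝ) → ℝ := fun z =>
    lagrangianCost J K l p.1 (μ + σ • toAction z) lam - lagrangianCost J K l p.1 μ lam with hf
  -- The chain rule through `μ + σ z` produces the factor `σ`, which the `σ⁻¹` of the estimate
  -- removes at the end.
  set f' : ((Σ i : Fin N, Fin (d i)) → ℝ) → ℝ := fun z =>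
    σ * (pseudoGradient J (μ + σ • toAction z) + (couplingMap K).adjoint lam) p with hf'
  have hfeq : f = fun z => J p.1 (μ + σ • toAction z) - J p.1 μ +
      ⟪lam, couplingMap K (σ • toAction z)⟫ := funext fun z => lagrangianCost_sub J K l _ _ _ _
  have hfcont : Continuous f := by
    rw [hfeq]
    exact (((hJ p.1).continuous.comp hcont).sub continuous_const).add
      (continuous_const.inner ((couplingMap K).continuous.comp
        (continuous_toAction.const_smul σ)))
  have hfle : ∀ z, |f z| ≤ (σ * (B * (1 + ‖μ‖ + σ) + ‖couplingMap K‖ * ‖lam‖)) *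
      (1 + ‖toAction z‖) ^ 2 := by
    intro z
    refine (abs_lagrangianCost_sub_le hJ hB hbound K l p.1 μ _ lam).trans ?_
    rw [norm_smul, Real.norm_of_nonneg hσ.le]
    set r := ‖toAction z‖
    have hr : 0 ≤ r := norm_nonneg _
    have h1 : B * (1 + ‖μ‖ + σ * r) + ‖couplingMap K‖ * ‖lam‖ ≤
        (B * (1 + ‖μ‖ + σ) + ‖couplingMap K‖ * ‖lam‖) * (1 + r) := by
      have : 0 ≤ B * σ + B * (1 + ‖μ‖) * r + ‖couplingMap K‖ * ‖lam‖ * r := by positivity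
      linarith
    calc (B * (1 + ‖μ‖ + σ * r) + ‖couplingMap K‖ * ‖lam‖) * (σ * r)
        ≤ (B * (1 + ‖μ‖ + σ) + ‖couplingMap K‖ * ‖lam‖) * (1 + r) * (σ * (1 + r)) := by
          refine mul_le_mul h1 ?_ (by positivity) (by positivity)
          exact mul_le_mul_of_nonneg_left (by linarith) hσ.le
      _ = _ := by ring
  have hstein := integral_partialDeriv_stdGaussianPi p (f := f) (f' := f')
    (fun z y => by
      have h1 := hasDerivAt_toAction_update (d := d) z p y
      have h2 : HasDerivAt (fun y => σ • toAction (Function.update z p y))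
          (σ • (EuclideanSpace.single p (1 : ℝ) : Action d)) y := h1.const_smul σ
      have h3 := ((((hJ p.1).differentiable one_ne_zero)
        (μ + σ • toAction (Function.update z p y))).hasFDerivAt.comp_hasDerivAt y
        (h2.const_add μ))
      have h4 : HasDerivAt (fun y => ⟪lam, couplingMap K (σ • toAction (Function.update z p y))⟫)
          ⟪lam, couplingMap K (σ • (EuclideanSpace.single p (1 : ℝ) : Action d))⟫ y :=
        ((innerSL ℝ lam).comp (couplingMap K)).hasFDerivAt.comp_hasDerivAt y h2
      have h5 := (h3.sub_const (J p.1 μ)).add h4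
      rw [hfeq]
      refine h5.congr_deriv ?_
      have h6 : ((couplingMap K).adjoint lam) p =
          ⟪lam, couplingMap K (EuclideanSpace.single p (1 : ℝ))⟫ := by
        rw [← ContinuousLinearMap.adjoint_inner_left, EuclideanSpace.inner_single_right]
        simp
      simp only [hf', PiLp.add_apply, h6, map_smul, inner_smul_right, smul_eq_mul]
      rw [mul_add]
      rfl)
    (integrable_of_poly_bound hfcont.aestronglyMeasurable _ 2 hfle)
    (((EuclideanSpace.proj (𝕜 := ℝ) p).integrable_comp hRi).const_mul σ)
    (integrable_of_poly_bound ((continuous_apply p).mul hfcont).aestronglyMeasurable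
      (σ * (B * (1 + ‖μ‖ + σ) + ‖couplingMap K‖ * ‖lam‖)) 3 (fun z => by
        rw [norm_mul, Real.norm_eq_abs (f z)]
        have h1 : ‖z p‖ ≤ 1 + ‖toAction z‖ := by
          have := PiLp.norm_apply_le (toAction z) p
          exact this.trans (by linarith)
        calc ‖z p‖ * |f z| ≤ (1 + ‖toAction z‖) * ((σ * (B * (1 + ‖μ‖ + σ) +
              ‖couplingMap K‖ * ‖lam‖)) * (1 + ‖toAction z‖) ^ 2) :=
              mul_le_mul h1 (hfle z) (abs_nonneg _) (by positivity)
          _ = _ := by ring))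
  have e1 : ∀ z, gradEstimate J K l σ μ (μ + σ • toAction z) lam p = σ⁻¹ * (z p * f z) :=
    fun z => gradEstimate_apply K l hσ μ lam z p
  simp_rw [e1]
  rw [integral_const_mul, ← hstein, hf', integral_const_mul, ← mul_assoc,
    inv_mul_cancel₀ hσ.ne', one_mul]

end Bounds

end Game

/-! ### The game as a primal-dual system -/

section GameSystem

variable {N n : ℕ} {d : Fin N → ℕ} {J : Fin N → Action d → ℝ}
  {K : Matrix (Fin n) (Σ i : Fin N, Fin (d i)) ℝ} {l : Dual n}

theorem IsVGNE.unique (hmono : StronglyMonotone (pseudoGradient J)) {a b : Action d}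
    (ha : IsVGNE J K l a) (hb : IsVGNE J K l b) : a = b := by
  obtain ⟨ν, hν, hmono⟩ := hmono
  have h1 := ha.2 b hb.1
  have h2 := hb.2 a ha.1
  have h3 := hmono a b
  rw [inner_sub_left] at h3
  have h4 : ⟪pseudoGradient J a, b - a⟫ = -⟪pseudoGradient J a, a - b⟫ := by
    rw [← inner_neg_right, neg_sub]
  have h5 : ‖a - b‖ ^ 2 ≤ 0 := by
    by_contra hcon
    push Not at hcon
    have := mul_pos hν hcon
    linarith
  have h6 : ‖a - b‖ = 0 := by
    have := sq_nonneg ‖a - b‖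
    exact pow_eq_zero_iff two_ne_zero |>.1 (le_antisymm h5 this)
  exact sub_eq_zero.1 (norm_eq_zero.1 h6)

/-- Stationarity turns the variational inequality into a comparison of `⟪p, ·⟫` at a feasible point,
where it is nonpositive, and at `a`, where it is 0. -/
theorem isVGNE_of_multiplier {a : Action d} (ha : ∀ j, (couplingMap K a - l) j ≤ 0)
    {p : Dual n}
    (hp : p ∈ multiplierSet (couplingMap K) (pseudoGradient J a) (couplingMap K a - l)) :
    IsVGNE J K l a := by
  refine ⟨ha, fun b hb => ?_⟩
  have h1 : pseudoGradient J a = -(couplingMap K).adjoint p := by rw [hp.2.1, neg_neg]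
  have h2 : ⟪p, couplingMap K b - l⟫ ≤ 0 := inner_nonpos_of_nonneg_of_nonpos hp.1 hb
  rw [h1, inner_neg_left, ContinuousLinearMap.adjoint_inner_left, map_sub,
    ← sub_sub_sub_cancel_right _ _ l, inner_sub_right, hp.2.2]
  linarith

theorem exists_multiplier_point (hmono : StronglyMonotone (pseudoGradient J))
    (hslater : SlaterCondition K l) (hlip : ∃ L : NNReal, LipschitzWith L (pseudoGradient J)) :
    ∃ a : Action d, IsVGNE J K l a ∧
      (multiplierSet (couplingMap K) (pseudoGradient J a) (couplingMap K a - l)).Nonempty := by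
  obtain ⟨ν, hν, hmono⟩ := hmono
  obtain ⟨L, hL⟩ := hlip
  obtain ⟨a, ha, p, hp⟩ := exists_kkt_point (L := L) hν hmono
    (fun a b => by simpa [dist_eq_norm] using hL.dist_le_mul a b) hL.continuous (couplingMap K) l
    hslater
  exact ⟨a, isVGNE_of_multiplier ha hp, p, hp⟩

/-- The primal-dual system of the game. -/
theorem exists_primalDualSystem (hmono : StronglyMonotone (pseudoGradient J))
    (hslater : SlaterCondition K l) (hlip : ∃ L : NNReal, LipschitzWith L (pseudoGradient J))
    {a : Action d} (ha : IsVGNE J K l a) :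
    ∃ S : PrimalDualSystem (Action d) n, S.M = pseudoGradient J ∧ S.K = couplingMap K ∧
      S.l = l ∧ S.aStar = a := by
  -- Multipliers are produced at a constructed equilibrium, and uniqueness transports them to the
  -- given one.
  obtain ⟨b, hb, hne⟩ := exists_multiplier_point hmono hslater hlip
  rw [hb.unique hmono ha] at hne
  obtain ⟨ν, hν, hmono⟩ := hmono
  obtain ⟨L, hL⟩ := hlip
  obtain ⟨R, hR, hRle⟩ := exists_multiplier_bound (couplingMap K) l (pseudoGradient J a) a hslater
  obtain ⟨H, hH, hHle⟩ := exists_multiplier_error_bound (couplingMap K) (pseudoGradient J a)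
    (couplingMap K a - l) ha.1 hne
  exact ⟨{
    M := pseudoGradient J
    K := couplingMap K
    l := l
    aStar := a
    ν := ν
    L := L
    R := R
    H := H
    ν_pos := hν
    L_nonneg := L.2
    R_nonneg := hR
    H_nonneg := hH
    mono := hmono
    lip := fun a b => by simpa [dist_eq_norm] using hL.dist_le_mul a b
    feasible := ha.1
    nonempty := hne
    norm_le := hRle
    error_bound := hHle }, rfl, rfl, rfl, rfl⟩

theorem norm_toAction_le_pow (z : (Σ i : Fin N, Fin (d i)) → ℝ) :
    ‖toAction z‖ ≤ (1 + ‖toAction z‖) ^ 3 := by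
  have h : 0 ≤ ‖toAction z‖ := norm_nonneg _
  have : 1 + ‖toAction z‖ ≤ (1 + ‖toAction z‖) ^ 3 := le_self_pow₀ (by linarith) three_ne_zero
  linarith

theorem integrable_toAction :
    Integrable (toAction (d := d)) (stdGaussianPi (Σ i : Fin N, Fin (d i))) :=
  integrable_of_poly_bound continuous_toAction.aestronglyMeasurable 1 3 fun z => by
    rw [one_mul]; exact norm_toAction_le_pow z

theorem integral_toAction :
    ∫ z, toAction z ∂stdGaussianPi (Σ i : Fin N, Fin (d i)) = (0 : Action d) := by
  refine PiLp.ext fun p => ?_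
  have h := (EuclideanSpace.proj (𝕜 := ℝ) p).integral_comp_comm (integrable_toAction (d := d))
  exact h.symm.trans (integral_eval_stdGaussianPi p)

/-- Gaussian sampling provides a nearly unbiased primal direction of controlled size. -/
theorem exists_stepNoise (S : PrimalDualSystem (Action d) n) (hSM : S.M = pseudoGradient J)
    (hSK : S.K = couplingMap K) (hJ : ∀ i, ContDiff ℝ 1 (J i))
    (hgrow : ∀ i, (fun x => fderiv ℝ (J i) x) =O[Bornology.cobounded (Action d)] fun x => ‖x‖)
    {T : ℝ} (hT : 0 ≤ T) :
    ∃ B : ℝ, T ≤ B ∧ ∀ σ : ℝ, 0 < σ → σ ≤ T → ∀ (u : Action d) (x : Dual n),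
      S.StepNoise (stdGaussianPi (Σ i : Fin N, Fin (d i)))
        (fun z => (1 + ‖toAction z‖) ^ 3) B σ u x
        (fun z => gradEstimate J K l σ (S.aStar + u) (S.aStar + u + σ • toAction z) x)
        (fun z => σ • S.K (toAction z)) := by
  choose b hb0 hb using fun i => exists_fderiv_bound (hJ i) (hgrow i)
  set B₀ := ∑ i, b i with hB₀
  have hB₀0 : 0 ≤ B₀ := Finset.sum_nonneg fun i _ => hb0 i
  have hbound : ∀ i x, ‖fderiv ℝ (J i) x‖ ≤ B₀ * (1 + ‖x‖) := fun i x =>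
    (hb i x).trans (mul_le_mul_of_nonneg_right
      (Finset.single_le_sum (fun i _ => hb0 i) (Finset.mem_univ i)) (by positivity))
  set k := ‖couplingMap K‖ with hk
  have hk0 : 0 ≤ k := norm_nonneg _
  have hR := S.R_nonneg
  have hL := S.L_nonneg
  set I := ∫ z, ‖toAction z‖ ∂stdGaussianPi (Σ i : Fin N, Fin (d i)) with hI
  have hI0 : 0 ≤ I := integral_nonneg fun z => norm_nonneg _
  -- The summands serve, in turn, the range of `σ`, the growth of the costs, the coupling through
  -- the dual variable, and the smoothing bias.
  set B := T + B₀ * (1 + ‖S.aStar‖ + T) + k * (1 + S.R) + S.L * I with hB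
  have p1 : 0 ≤ B₀ * (1 + ‖S.aStar‖ + T) := by positivity
  have p2 : 0 ≤ k * (1 + S.R) := by positivity
  have p3 : 0 ≤ S.L * I := by positivity
  refine ⟨B, by linarith, fun σ hσ hσT u x => ?_⟩
  have hcont : Continuous fun z : (Σ i : Fin N, Fin (d i)) → ℝ =>
      S.aStar + u + σ • toAction z :=
    continuous_const.add (continuous_toAction.const_smul σ)
  have hlipS : ∀ z : (Σ i : Fin N, Fin (d i)) → ℝ,
      ‖S.M (S.aStar + u + σ • toAction z) - S.M (S.aStar + u)‖ ≤ S.L * σ * ‖toAction z‖ := by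
    intro z
    have := S.lip (S.aStar + u + σ • toAction z) (S.aStar + u)
    rwa [add_sub_cancel_left, norm_smul, Real.norm_of_nonneg hσ.le, ← mul_assoc] at this
  have hMcont : Continuous S.M :=
    (LipschitzWith.of_dist_le_mul (K := ⟨S.L, hL⟩) fun a b => by
      rw [dist_eq_norm, dist_eq_norm]; exact S.lip a b).continuous
  have hdiff : Integrable (fun z => S.M (S.aStar + u + σ • toAction z) - S.M (S.aStar + u))
      (stdGaussianPi _) :=
    ((integrable_toAction (d := d)).norm.const_mul (S.L * σ)).mono'
      ((hMcont.comp hcont).sub continuous_const).aestronglyMeasurable (ae_of_all _ hlipS)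
  have hMint : Integrable (fun z => pseudoGradient J (S.aStar + u + σ • toAction z))
      (stdGaussianPi _) := by
    refine (hdiff.add (integrable_const (S.M (S.aStar + u)))).congr (ae_of_all _ fun z => ?_)
    simp [hSM]
  have hd0 := S.dualDist_nonneg x
  refine ⟨?_, ?_, fun z => ?_, fun z => ?_, ?_, ?_⟩
  · exact ((continuous_gradEstimate (fun i => (hJ i).continuous) K l σ).comp
      (continuous_const.prodMk (hcont.prodMk continuous_const))).aestronglyMeasurable
  · exact ((S.K.continuous.comp continuous_toAction).const_smul σ).aestronglyMeasurable
  · refine (norm_gradEstimate_le hJ hB₀0 hbound K l hσ hσT _ x z).trans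
      (mul_le_mul_of_nonneg_right ?_ (by positivity))
    have h1 := norm_add_le S.aStar u
    have h2 := S.norm_le_dualDist_add x
    have h3 := mul_le_mul_of_nonneg_left h1 hB₀0
    have h4 := mul_le_mul_of_nonneg_left h2 hk0
    have p4 : 0 ≤ (T + S.L * I) * (1 + ‖u‖ + S.dualDist x) := by positivity
    have p5 : 0 ≤ B₀ * (‖S.aStar‖ + T) * (‖u‖ + S.dualDist x) + B₀ * S.dualDist x := by
      positivity
    have p6 : 0 ≤ k * (1 + S.R) * ‖u‖ + k * S.R * S.dualDist x + k := by positivity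
    rw [hB]
    linarith
  · rw [norm_smul, Real.norm_of_nonneg hσ.le, mul_assoc]
    refine mul_le_mul_of_nonneg_left ((S.K.le_opNorm _).trans ?_) hσ.le
    refine mul_le_mul ?_ (norm_toAction_le_pow z) (norm_nonneg _) (by linarith)
    have : 0 ≤ k * S.R := by positivity
    rw [hSK, hB]
    linarith
  · rw [integral_smul, S.K.integral_comp_comm integrable_toAction, integral_toAction, map_zero,
      smul_zero]
  -- Once the estimate is unbiased for the smoothed map, the bias is the mean displacement of `M`
  -- under the noise, at most `L σ E‖z‖`.
  · have e : ∫ z, gradEstimate J K l σ (S.aStar + u) (S.aStar + u + σ • toAction z) x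
        ∂stdGaussianPi _ - (S.M (S.aStar + u) + S.K.adjoint x) =
        ∫ z, (S.M (S.aStar + u + σ • toAction z) - S.M (S.aStar + u)) ∂stdGaussianPi _ := by
      rw [integral_gradEstimate hJ hB₀0 hbound K l hσ _ x hMint, integral_add hMint
        (integrable_const _), integral_sub (by rw [hSM]; exact hMint) (integrable_const _),
        hSM, hSK]
      simp
    rw [e]
    refine (norm_integral_le_integral_norm _).trans ?_
    refine (integral_mono hdiff.norm ((integrable_toAction (d := d)).norm.const_mul _)
      hlipS).trans ?_
    rw [integral_const_mul, ← hI]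
    have : σ * (S.L * I) ≤ σ * B := mul_le_mul_of_nonneg_left (by linarith) hσ.le
    linarith

end GameSystem

/-! ### Filtration and law of the noise -/

section Noise

variable {N : ℕ} {d : Fin N → ℕ} {Ω : Type*}

/-- The indices of the noise variables at positive times. -/
abbrev NoiseIndex {N : ℕ} (d : Fin N → ℕ) : Type := {t : ℕ // 1 ≤ t} × (Σ i : Fin N, Fin (d i))

/-- The information generated by the noise variables with index in `A`. -/
abbrev noiseSigma (ξ : ℕ → (Σ i : Fin N, Fin (d i)) → Ω → ℝ) (A : Set (NoiseIndex d)) :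
    MeasurableSpace Ω :=
  ⨆ q ∈ A, MeasurableSpace.comap (ξ q.1.1 q.2) inferInstance

theorem noiseSigma_mono (ξ : ℕ → (Σ i : Fin N, Fin (d i)) → Ω → ℝ) {A A' : Set (NoiseIndex d)}
    (h : A ⊆ A') : noiseSigma ξ A ≤ noiseSigma ξ A' :=
  biSup_mono fun _ hq => h hq

theorem measurable_noise {ξ : ℕ → (Σ i : Fin N, Fin (d i)) → Ω → ℝ} {A : Set (NoiseIndex d)}
    {t : ℕ} (ht : 1 ≤ t) (hA : ∀ p, ((⟨t, ht⟩, p) : NoiseIndex d) ∈ A) :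
    Measurable[noiseSigma ξ A] fun ω p => ξ t p ω := by
  refine @measurable_pi_lambda _ _ _ (noiseSigma ξ A) _ _ fun p => ?_
  refine Measurable.mono (comap_measurable (ξ t p)) ?_ le_rfl
  exact le_biSup (fun q : NoiseIndex d => MeasurableSpace.comap (ξ q.1.1 q.2) inferInstance) (hA p)

variable [mΩ : MeasurableSpace Ω] {P : Measure Ω}
  {ξ : ℕ → (Σ i : Fin N, Fin (d i)) → Ω → ℝ}

theorem IsStandardNoise.noiseSigma_le (h : IsStandardNoise P ξ) (A : Set (NoiseIndex d)) :
    noiseSigma ξ A ≤ mΩ :=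
  iSup₂_le fun q _ => (h.measurable q.1.1 q.1.2 q.2).comap_le

theorem IsStandardNoise.indep_noiseSigma (h : IsStandardNoise P ξ) {A A' : Set (NoiseIndex d)}
    (hA : Disjoint A A') : Indep (noiseSigma ξ A) (noiseSigma ξ A') P :=
  indep_iSup_of_disjoint
    (m := fun q : NoiseIndex d => MeasurableSpace.comap (ξ q.1.1 q.2) inferInstance)
    (fun q => (h.measurable q.1.1 q.1.2 q.2).comap_le) h.indep.iIndep hA

theorem IsStandardNoise.map_eq [IsProbabilityMeasure P] (h : IsStandardNoise P ξ) {t : ℕ}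
    (ht : 1 ≤ t) : P.map (fun ω p => ξ t p ω) = stdGaussianPi (Σ i : Fin N, Fin (d i)) := by
  have hinj : Function.Injective fun p : Σ i : Fin N, Fin (d i) =>
      ((⟨t, ht⟩, p) : NoiseIndex d) := fun p q hpq => (Prod.mk.inj hpq).2
  have h1 : iIndepFun (fun p : Σ i : Fin N, Fin (d i) => ξ t p) P :=
    h.indep.precomp (g := fun p => ((⟨t, ht⟩, p) : NoiseIndex d)) hinj
  rw [(iIndepFun_iff_map_fun_eq_pi_map fun p => (h.measurable t ht p).aemeasurable).1 h1]
  simp_rw [h.law t ht]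

end Noise

/-! ### Averaging over fresh noise -/

section Expectation

variable {Ω X Z : Type*} [MeasurableSpace Ω] [MeasurableSpace X] [MeasurableSpace Z]
  {P : Measure Ω} {ρ : Measure Z}

/-- Freezing the past: an average over fresh noise is bounded by the mean of pointwise bounds. -/
theorem integral_le_of_indepFun [IsProbabilityMeasure P] {x : Ω → X} {z : Ω → Z}
    (hx : Measurable x) (hz : Measurable z)
    (hind : IndepFun x z P) (hlaw : P.map z = ρ) {F : X × Z → ℝ} (hF : Measurable F)
    (hFi : Integrable (fun ω => F (x ω, z ω)) P) {R : Ω → ℝ} (hR : Integrable R P)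
    (hle : ∀ ω, ∫ y, F (x ω, y) ∂ρ ≤ R ω) : ∫ ω, F (x ω, z ω) ∂P ≤ ∫ ω, R ω ∂P := by
  have hprob : IsProbabilityMeasure ρ := hlaw ▸ Measure.isProbabilityMeasure_map hz.aemeasurable
  have hprob' : IsProbabilityMeasure (P.map x) := Measure.isProbabilityMeasure_map hx.aemeasurable
  have hmap : P.map (fun ω => (x ω, z ω)) = (P.map x).prod ρ := by
    rw [← hlaw]
    exact (indepFun_iff_map_prod_eq_prod_map_map hx.aemeasurable hz.aemeasurable).1 hind
  have hxz : AEMeasurable (fun ω => (x ω, z ω)) P := (hx.prodMk hz).aemeasurable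
  have hFi' : Integrable F ((P.map x).prod ρ) := by
    rw [← hmap, integrable_map_measure hF.aestronglyMeasurable hxz]
    exact hFi
  have e1 : ∫ ω, F (x ω, z ω) ∂P = ∫ ω, ∫ y, F (x ω, y) ∂ρ ∂P := by
    rw [← integral_map (φ := fun ω => (x ω, z ω)) hxz hF.aestronglyMeasurable, hmap,
      integral_prod _ hFi', integral_map hx.aemeasurable hFi'.integral_prod_left.1]
  have hi : Integrable (fun ω => ∫ y, F (x ω, y) ∂ρ) P :=
    (integrable_map_measure hFi'.integral_prod_left.1 hx.aemeasurable).1 hFi'.integral_prod_left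
  rw [e1]
  exact integral_mono hi hR hle

theorem integrable_of_le_mul_indepFun {x : Ω → X} {z : Ω → Z} (hind : IndepFun x z P)
    {F : Ω → ℝ} (hF : AEStronglyMeasurable F P) {U : X → ℝ} {V : Z → ℝ} (hU : Measurable U)
    (hV : Measurable V) (hUi : Integrable (fun ω => U (x ω)) P)
    (hVi : Integrable (fun ω => V (z ω)) P) (hle : ∀ ω, ‖F ω‖ ≤ U (x ω) * V (z ω)) :
    Integrable F P :=
  ((hind.comp hU hV).integrable_mul hUi hVi).mono' hF (ae_of_all _ hle)

end Expectation

theorem sampling_eq {N : ℕ} {d : Fin N → ℕ} {Ω : Type*} {σ : ℕ → ℝ}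
    {μ a : ℕ → Ω → Action d} {ξ : ℕ → (Σ i : Fin N, Fin (d i)) → Ω → ℝ} {t : ℕ} {ω : Ω}
    (h : ∀ p, a t ω p = μ t ω p + σ t * ξ t p ω) :
    a t ω = μ t ω + σ t • toAction fun p => ξ t p ω :=
  PiLp.ext fun p => by simpa [toAction] using h p

/-! ### Adaptedness of the run -/

section Run

variable {N n : ℕ} {d : Fin N → ℕ} {J : Fin N → Action d → ℝ}
  {K : Matrix (Fin n) (Σ i : Fin N, Fin (d i)) ℝ} {l : Dual n}
  {Ω : Type*} [MeasurableSpace Ω] {P : Measure Ω} {γ ε σ : ℕ → ℝ}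
  {μ a : ℕ → Ω → Action d} {lam : ℕ → Ω → Dual n}

theorem IsPayoffRun.lam_nonneg (h : IsPayoffRun P J K l γ ε σ μ a lam) {t : ℕ} (ht : 1 ≤ t)
    (ω : Ω) (j : Fin n) : 0 ≤ lam t ω j := by
  induction t, ht using Nat.le_induction with
  | base =>
    obtain ⟨lam₁, h0, h1⟩ := h.dual_init
    rw [h1 ω]
    exact h0 j
  | succ t ht _ =>
    rw [h.dual_step t ht ω]
    exact (projNonneg_isNearest _).1 j

/-- The state at time `t` depends only on the noise before `t`. -/
theorem IsPayoffRun.adapted (h : IsPayoffRun P J K l γ ε σ μ a lam)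
    (hJ : ∀ i, Continuous (J i)) {ξ : ℕ → (Σ i : Fin N, Fin (d i)) → Ω → ℝ}
    (hs : ∀ t, 1 ≤ t → ∀ ω p, a t ω p = μ t ω p + σ t * ξ t p ω) {t : ℕ} (ht : 1 ≤ t) :
    Measurable[noiseSigma ξ {q : NoiseIndex d | q.1.1 < t}] fun ω => (μ t ω, lam t ω) := by
  induction t, ht using Nat.le_induction with
  | base =>
    obtain ⟨μ₁, h1⟩ := h.primal_init
    obtain ⟨lam₁, -, h2⟩ := h.dual_init
    simp_rw [h1, h2]
    exact measurable_const
  | succ t ht ih =>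
    have hle : noiseSigma ξ {q : NoiseIndex d | q.1.1 < t} ≤
        noiseSigma ξ {q : NoiseIndex d | q.1.1 < t + 1} :=
      noiseSigma_mono ξ fun q hq => Nat.lt_succ_of_lt hq
    have hx := ih.mono hle le_rfl
    have hz : Measurable[noiseSigma ξ {q : NoiseIndex d | q.1.1 < t + 1}] fun ω p => ξ t p ω :=
      measurable_noise ht fun p => t.lt_succ_self
    -- The new state is a continuous function of the old state and the noise at time `t`, which
    -- belongs to the past of `t + 1`.
    have hstep : (fun ω => (μ (t + 1) ω, lam (t + 1) ω)) =
        (fun w : (Action d × Dual n) × ((Σ i : Fin N, Fin (d i)) → ℝ) =>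
          (w.1.1 - γ t • gradEstimate J K l (σ t) w.1.1 (w.1.1 + σ t • toAction w.2) w.1.2,
            projNonneg (w.1.2 - γ t • (-(couplingMap K (w.1.1 + σ t • toAction w.2) - l) +
              ε t • w.1.2)))) ∘ fun ω => ((μ t ω, lam t ω), fun p => ξ t p ω) := by
      funext ω
      have ha := sampling_eq (hs t ht ω)
      simp only [Function.comp_apply]
      rw [h.primal_step t ht, h.dual_step t ht, ha]
      rfl
    have hca : Continuous fun w : (Action d × Dual n) × ((Σ i : Fin N, Fin (d i)) → ℝ) =>
        w.1.1 + σ t • toAction w.2 :=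
      (continuous_fst.comp continuous_fst).add
        ((continuous_toAction.comp continuous_snd).const_smul (σ t))
    have hc1 : Continuous fun w : (Action d × Dual n) × ((Σ i : Fin N, Fin (d i)) → ℝ) =>
        w.1.1 := continuous_fst.comp continuous_fst
    have hc2 : Continuous fun w : (Action d × Dual n) × ((Σ i : Fin N, Fin (d i)) → ℝ) =>
        w.1.2 := continuous_snd.comp continuous_fst
    have hcont : Continuous
        (fun w : (Action d × Dual n) × ((Σ i : Fin N, Fin (d i)) → ℝ) =>
          (w.1.1 - γ t • gradEstimate J K l (σ t) w.1.1 (w.1.1 + σ t • toAction w.2) w.1.2,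
            projNonneg (w.1.2 - γ t • (-(couplingMap K (w.1.1 + σ t • toAction w.2) - l) +
              ε t • w.1.2)))) := by
      refine (hc1.sub (((continuous_gradEstimate hJ K l (σ t)).comp
        (hc1.prodMk (hca.prodMk hc2))).const_smul (γ t))).prodMk ?_
      exact lipschitzWith_projNonneg.continuous.comp (hc2.sub (((((couplingMap K).continuous.comp
        hca).sub continuous_const).neg.add (hc2.const_smul (ε t))).const_smul (γ t)))
    rw [hstep]
    exact hcont.measurable.comp (hx.prodMk hz)

end Run

namespace PrimalDualSystem

variable {n : ℕ} {V : Type*} [NormedAddCommGroup V] [InnerProductSpace ℝ V]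
  [FiniteDimensional ℝ V] (S : PrimalDualSystem V n) {X : Type*} [TopologicalSpace X]

theorem continuous_lyapunov_comp (κ : ℝ) {u : X → V} {x : X → Dual n} (hu : Continuous u)
    (hx : Continuous x) : Continuous fun w => S.lyapunov κ (u w) (x w) :=
  (S.continuous_lyapunov κ).comp (hu.prodMk hx)

theorem continuous_stepValue (κ γ ε : ℝ) {u m : X → V} {x s : X → Dual n} (hu : Continuous u)
    (hm : Continuous m) (hx : Continuous x) (hs : Continuous s) :
    Continuous fun w => S.stepValue κ γ ε (u w) (x w) (m w) (s w) := by
  have hdir : Continuous fun w => S.dualDir ε (u w) (x w) (s w) :=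
    continuous_const.add (((S.K.continuous.comp hu).add hs).sub (hx.const_smul ε))
  exact S.continuous_lyapunov_comp κ (hu.sub (hm.const_smul γ))
    (lipschitzWith_projNonneg.continuous.comp (hx.add (hdir.const_smul γ)))

end PrimalDualSystem

/-! ### Moment recursions along a run -/

section Rate

variable {N n : ℕ} {d : Fin N → ℕ} {J : Fin N → Action d → ℝ}
  {K : Matrix (Fin n) (Σ i : Fin N, Fin (d i)) ℝ} {l : Dual n}

/-- The Lyapunov function after a step of the payoff-based algorithm, as a function of the state
and of the sampling noise. -/
def sampledValue (J : Fin N → Action d → ℝ) (K : Matrix (Fin n) (Σ i : Fin N, Fin (d i)) ℝ)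
    (l : Dual n) (S : PrimalDualSystem (Action d) n) (κ γ ε σ : ℝ)
    (w : (Action d × Dual n) × ((Σ i : Fin N, Fin (d i)) → ℝ)) : ℝ :=
  S.stepValue κ γ ε (w.1.1 - S.aStar) w.1.2
    (gradEstimate J K l σ w.1.1 (w.1.1 + σ • toAction w.2) w.1.2) (σ • S.K (toAction w.2))

theorem continuous_sampledValue (hJ : ∀ i, Continuous (J i)) (S : PrimalDualSystem (Action d) n)
    (κ γ ε σ : ℝ) : Continuous (sampledValue J K l S κ γ ε σ) := by
  have hc1 : Continuous fun w : (Action d × Dual n) × ((Σ i : Fin N, Fin (d i)) → ℝ) =>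
      w.1.1 := continuous_fst.comp continuous_fst
  have hc2 : Continuous fun w : (Action d × Dual n) × ((Σ i : Fin N, Fin (d i)) → ℝ) =>
      w.1.2 := continuous_snd.comp continuous_fst
  have hcz : Continuous fun w : (Action d × Dual n) × ((Σ i : Fin N, Fin (d i)) → ℝ) =>
      toAction w.2 := continuous_toAction.comp continuous_snd
  have hca : Continuous fun w : (Action d × Dual n) × ((Σ i : Fin N, Fin (d i)) → ℝ) =>
      w.1.1 + σ • toAction w.2 := hc1.add (hcz.const_smul σ)
  have hu : Continuous fun w : (Action d × Dual n) × ((Σ i : Fin N, Fin (d i)) → ℝ) =>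
      w.1.1 - S.aStar := hc1.sub continuous_const
  have hm : Continuous fun w : (Action d × Dual n) × ((Σ i : Fin N, Fin (d i)) → ℝ) =>
      gradEstimate J K l σ w.1.1 (w.1.1 + σ • toAction w.2) w.1.2 :=
    (continuous_gradEstimate hJ K l σ).comp (hc1.prodMk (hca.prodMk hc2))
  have hs : Continuous fun w : (Action d × Dual n) × ((Σ i : Fin N, Fin (d i)) → ℝ) =>
      σ • S.K (toAction w.2) := (S.K.continuous.comp hcz).const_smul σ
  exact S.continuous_stepValue κ γ ε hu hm hc2 hs

variable {Ω : Type*} [MeasurableSpace Ω] {P : Measure Ω} {γ ε σ : ℕ → ℝ}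
  {μ a : ℕ → Ω → Action d} {lam : ℕ → Ω → Dual n} {S : PrimalDualSystem (Action d) n}
  {ξ : ℕ → (Σ i : Fin N, Fin (d i)) → Ω → ℝ}

/-- Because the constraint is affine, its sampled value is `g + K u + σ K z`. The algorithm is
therefore an instance of the abstract step, with centered constraint error `σ K z`. -/
theorem IsPayoffRun.lyapunov_succ (h : IsPayoffRun P J K l γ ε σ μ a lam)
    (hs : ∀ t, 1 ≤ t → ∀ ω p, a t ω p = μ t ω p + σ t * ξ t p ω)
    (hSK : S.K = couplingMap K) (hSl : S.l = l) (κ : ℝ) {t : ℕ} (ht : 1 ≤ t) (ω : Ω) :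
    S.lyapunov κ (μ (t + 1) ω - S.aStar) (lam (t + 1) ω) =
      sampledValue J K l S κ (γ t) (ε t) (σ t) ((μ t ω, lam t ω), fun p => ξ t p ω) := by
  have ha := sampling_eq (hs t ht ω)
  rw [h.primal_step t ht, h.dual_step t ht, ha, sampledValue, PrimalDualSystem.stepValue]
  congr 1
  · simp only; abel
  · congr 1
    rw [sub_eq_add_neg, ← smul_neg, PrimalDualSystem.dualDir, PrimalDualSystem.g, constraintFun_eq,
      hSK, hSl, map_add, map_smul, map_sub]
    congr 2
    abel

theorem IsPayoffRun.measurable_state (h : IsPayoffRun P J K l γ ε σ μ a lam)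
    (hJ : ∀ i, Continuous (J i)) (hξ : IsStandardNoise P ξ)
    (hs : ∀ t, 1 ≤ t → ∀ ω p, a t ω p = μ t ω p + σ t * ξ t p ω) {t : ℕ} (ht : 1 ≤ t) :
    Measurable fun ω => (μ t ω, lam t ω) :=
  (h.adapted hJ hs ht).mono (hξ.noiseSigma_le _) le_rfl

theorem IsStandardNoise.measurable_pi (hξ : IsStandardNoise P ξ) {t : ℕ} (ht : 1 ≤ t) :
    Measurable fun ω p => ξ t p ω :=
  measurable_pi_lambda _ fun p => hξ.measurable t ht p

theorem IsPayoffRun.indepFun_noise (h : IsPayoffRun P J K l γ ε σ μ a lam)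
    (hJ : ∀ i, Continuous (J i)) (hξ : IsStandardNoise P ξ)
    (hs : ∀ t, 1 ≤ t → ∀ ω p, a t ω p = μ t ω p + σ t * ξ t p ω) {t : ℕ} (ht : 1 ≤ t) :
    IndepFun (fun ω => (μ t ω, lam t ω)) (fun ω p => ξ t p ω) P := by
  have hdisj : Disjoint {q : NoiseIndex d | q.1.1 < t} {q : NoiseIndex d | q.1.1 = t} :=
    Set.disjoint_left.2 fun q hq hq' => (ne_of_lt hq) hq'
  rw [IndepFun_iff_Indep]
  exact indep_of_indep_of_le_left (indep_of_indep_of_le_right (hξ.indep_noiseSigma hdisj)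
    (measurable_noise ht fun p => rfl).comap_le) (h.adapted hJ hs ht).comap_le

theorem IsStandardNoise.integrable_pow [IsProbabilityMeasure P] (hξ : IsStandardNoise P ξ)
    {t : ℕ} (ht : 1 ≤ t) (k : ℕ) :
    Integrable (fun ω => (1 + ‖toAction fun p => ξ t p ω‖) ^ k) P := by
  have h := integrable_one_add_norm_pow_stdGaussianPi (ι := Σ i : Fin N, Fin (d i)) k
  rw [← hξ.map_eq ht] at h
  exact h.comp_measurable (hξ.measurable_pi ht)

theorem continuous_centered_lyapunov (S : PrimalDualSystem (Action d) n) (κ : ℝ) :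
    Continuous fun w : Action d × Dual n => S.lyapunov κ (w.1 - S.aStar) w.2 :=
  S.continuous_lyapunov_comp κ (continuous_fst.sub continuous_const) continuous_snd

theorem IsPayoffRun.measurable_lyapunov (h : IsPayoffRun P J K l γ ε σ μ a lam)
    (hJ : ∀ i, Continuous (J i)) (hξ : IsStandardNoise P ξ)
    (hs : ∀ t, 1 ≤ t → ∀ ω p, a t ω p = μ t ω p + σ t * ξ t p ω) (κ : ℝ) {t : ℕ} (ht : 1 ≤ t) :
    Measurable fun ω => S.lyapunov κ (μ t ω - S.aStar) (lam t ω) := by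
  have hx : Measurable fun ω => (μ t ω, lam t ω) := h.measurable_state hJ hξ hs ht
  have hW : Measurable fun w : Action d × Dual n => S.lyapunov κ (w.1 - S.aStar) w.2 :=
    (continuous_centered_lyapunov S κ).measurable
  have hc := hW.comp hx
  rw [Function.comp_def] at hc
  exact hc

/-- Along a step of a run the Lyapunov function grows at most by a power of the noise. -/
theorem IsPayoffRun.lyapunov_succ_sq_le
    (h : IsPayoffRun P J K l γ ε σ μ a lam)
    (hs : ∀ t, 1 ≤ t → ∀ ω p, a t ω p = μ t ω p + σ t * ξ t p ω)
    (hSK : S.K = couplingMap K) (hSl : S.l = l) {κ B : ℝ} (hκ : 0 ≤ κ) (hκK : κ * ‖S.K‖ ≤ 1)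
    {t : ℕ} (ht : 1 ≤ t) (hγ : 0 ≤ γ t) (hε : 0 ≤ ε t ∧ ε t ≤ B) (hσ : 0 ≤ σ t ∧ σ t ≤ B)
    (hnoise : ∀ (u : Action d) (x : Dual n),
      S.StepNoise (stdGaussianPi (Σ i : Fin N, Fin (d i)))
        (fun z => (1 + ‖toAction z‖) ^ 3) B (σ t) u x
        (fun z => gradEstimate J K l (σ t) (S.aStar + u) (S.aStar + u + σ t • toAction z) x)
        (fun z => σ t • S.K (toAction z))) :
    ∃ C : ℝ, ∀ ω, S.lyapunov κ (μ (t + 1) ω - S.aStar) (lam (t + 1) ω) ^ 2 ≤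
      C ^ 2 * (1 + S.lyapunov κ (μ t ω - S.aStar) (lam t ω)) ^ 2 *
        (1 + ‖toAction fun p => ξ t p ω‖) ^ 12 := by
  obtain ⟨C, hC0, hC⟩ := S.stepValue_le_crude hκ hκK B (γ t) hγ
  refine ⟨C, fun ω => ?_⟩
  have h0 := S.lyapunov_nonneg hκ hκK (μ (t + 1) ω - S.aStar) (lam (t + 1) ω)
  rw [h.lyapunov_succ hs hSK hSl κ ht ω] at h0 ⊢
  have hn := hnoise (μ t ω - S.aStar) (lam t ω)
  have hP1 : 1 ≤ (1 + ‖toAction fun p => ξ t p ω‖) ^ 3 := one_le_pow₀ (by simp)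
  have hm := hn.m_le fun p => ξ t p ω
  rw [add_sub_cancel] at hm
  have hle := hC (ε t) (σ t) hε.1 hε.2 hσ.1 hσ.2
    (μ t ω - S.aStar) (lam t ω) (h.lam_nonneg ht ω) _ _ _ hP1 hm (hn.s_le fun p => ξ t p ω)
  refine (pow_le_pow_left₀ h0 hle 2).trans (le_of_eq ?_)
  ring

/-- All second moments of the Lyapunov function along a run are finite. -/
theorem IsPayoffRun.integrable_lyapunov_sq [IsProbabilityMeasure P]
    (h : IsPayoffRun P J K l γ ε σ μ a lam) (hJ : ∀ i, Continuous (J i))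
    (hξ : IsStandardNoise P ξ) (hs : ∀ t, 1 ≤ t → ∀ ω p, a t ω p = μ t ω p + σ t * ξ t p ω)
    (hSK : S.K = couplingMap K) (hSl : S.l = l) {κ B : ℝ} (hκ : 0 ≤ κ) (hκK : κ * ‖S.K‖ ≤ 1)
    (hγ : ∀ t, 1 ≤ t → 0 ≤ γ t) (hε : ∀ t, 1 ≤ t → 0 ≤ ε t ∧ ε t ≤ B)
    (hσ : ∀ t, 1 ≤ t → 0 ≤ σ t ∧ σ t ≤ B)
    (hnoise : ∀ t, 1 ≤ t → ∀ (u : Action d) (x : Dual n),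
      S.StepNoise (stdGaussianPi (Σ i : Fin N, Fin (d i)))
        (fun z => (1 + ‖toAction z‖) ^ 3) B (σ t) u x
        (fun z => gradEstimate J K l (σ t) (S.aStar + u) (S.aStar + u + σ t • toAction z) x)
        (fun z => σ t • S.K (toAction z))) {t : ℕ} (ht : 1 ≤ t) :
    Integrable (fun ω => S.lyapunov κ (μ t ω - S.aStar) (lam t ω) ^ 2) P := by
  induction t, ht using Nat.le_induction with
  | base =>
    obtain ⟨μ₁, h1⟩ := h.primal_init
    obtain ⟨lam₁, -, h2⟩ := h.dual_init
    simp_rw [h1, h2]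
    exact integrable_const _
  | succ t ht ih =>
    obtain ⟨C, hC⟩ := h.lyapunov_succ_sq_le hs hSK hSl hκ hκK ht (hγ t ht) (hε t ht) (hσ t ht)
      (hnoise t ht)
    have hmeas : AEStronglyMeasurable (fun ω =>
        S.lyapunov κ (μ (t + 1) ω - S.aStar) (lam (t + 1) ω) ^ 2) P :=
      ((h.measurable_lyapunov hJ hξ hs κ (ht.trans t.le_succ)).pow_const 2).aestronglyMeasurable
    have hU : Measurable fun w : Action d × Dual n =>
        C ^ 2 * (1 + S.lyapunov κ (w.1 - S.aStar) w.2) ^ 2 :=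
      (((continuous_centered_lyapunov S κ).measurable.const_add 1).pow_const 2).const_mul _
    have hV : Measurable fun z : (Σ i : Fin N, Fin (d i)) → ℝ => (1 + ‖toAction z‖) ^ 12 :=
      ((continuous_const.add continuous_toAction.norm).pow 12).measurable
    have hUi : Integrable (fun ω => C ^ 2 *
        (1 + S.lyapunov κ (μ t ω - S.aStar) (lam t ω)) ^ 2) P := by
      -- Only `W²` is known to be integrable at this stage, so `(1 + W)²` is dominated by `2 + 2W²`.
      -- The noise factor is independent of the state, and hence the product is integrable.
      have hi : Integrable (fun ω => C ^ 2 *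
          (2 + 2 * S.lyapunov κ (μ t ω - S.aStar) (lam t ω) ^ 2)) P :=
        ((integrable_const _).add (ih.const_mul 2)).const_mul _
      refine hi.mono' (hU.comp (h.measurable_state hJ hξ hs ht)).aestronglyMeasurable
        (ae_of_all _ fun ω => ?_)
      rw [Real.norm_of_nonneg (by positivity)]
      refine mul_le_mul_of_nonneg_left ?_ (sq_nonneg _)
      nlinarith [sq_nonneg (1 - S.lyapunov κ (μ t ω - S.aStar) (lam t ω))]
    exact integrable_of_le_mul_indepFun (h.indepFun_noise hJ hξ hs ht) hmeas hU hV hUi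
      (hξ.integrable_pow ht 12) fun ω => by
        rw [Real.norm_of_nonneg (sq_nonneg _)]
        exact hC ω

/-- A pointwise bound for the mean of a function of the next noise gives a bound for the
expectation along the run. -/
theorem integral_le_linear_of_indepFun [IsProbabilityMeasure P] {X Z : Type*} [MeasurableSpace X]
    [MeasurableSpace Z] {ρ : Measure Z} {x : Ω → X} {z : Ω → Z} (hx : Measurable x)
    (hz : Measurable z) (hind : IndepFun x z P) (hlaw : P.map z = ρ) {F : X × Z → ℝ}
    (hF : Measurable F) {W f g : Ω → ℝ} (hW : Integrable W P) (hWF : ∀ ω, W ω = F (x ω, z ω))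
    (hf : Integrable f P) (hg : Integrable g P) {α β C : ℝ}
    (hle : ∀ ω, ∫ y, F (x ω, y) ∂ρ ≤ α * f ω + β * g ω + C) :
    ∫ ω, W ω ∂P ≤ α * ∫ ω, f ω ∂P + β * ∫ ω, g ω ∂P + C := by
  have hR : Integrable (fun ω => α * f ω + β * g ω) P := (hf.const_mul _).add (hg.const_mul _)
  have h := integral_le_of_indepFun hx hz hind hlaw hF (hW.congr (ae_of_all _ hWF))
    (hR.add (integrable_const C)) hle
  rw [integral_congr_ae (ae_of_all _ hWF)]
  refine h.trans (le_of_eq ?_)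
  simp only [Pi.add_apply]
  rw [integral_add hR (integrable_const C), integral_add (hf.const_mul _) (hg.const_mul _),
    integral_const_mul, integral_const_mul]
  simp

/-- Pointwise bounds for the mean of the next value of the Lyapunov function and of its square
give a recursion for their expectations. -/
theorem IsPayoffRun.expected_recursion [IsProbabilityMeasure P]
    (h : IsPayoffRun P J K l γ ε σ μ a lam) (hJ : ∀ i, Continuous (J i))
    (hξ : IsStandardNoise P ξ) (hs : ∀ t, 1 ≤ t → ∀ ω p, a t ω p = μ t ω p + σ t * ξ t p ω)
    (hSK : S.K = couplingMap K) (hSl : S.l = l) {κ : ℝ} {t : ℕ} (ht : 1 ≤ t)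
    (hW : ∀ t, 1 ≤ t → Integrable (fun ω => S.lyapunov κ (μ t ω - S.aStar) (lam t ω)) P)
    (hW2 : ∀ t, 1 ≤ t → Integrable (fun ω => S.lyapunov κ (μ t ω - S.aStar) (lam t ω) ^ 2) P)
    {α β C α' β' C' : ℝ}
    (hle : ∀ ω, (∫ z, sampledValue J K l S κ (γ t) (ε t) (σ t) ((μ t ω, lam t ω), z)
        ∂stdGaussianPi _ ≤ α * S.lyapunov κ (μ t ω - S.aStar) (lam t ω) +
          β * S.lyapunov κ (μ t ω - S.aStar) (lam t ω) ^ 2 + C) ∧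
      (∫ z, sampledValue J K l S κ (γ t) (ε t) (σ t) ((μ t ω, lam t ω), z) ^ 2
        ∂stdGaussianPi _ ≤ α' * S.lyapunov κ (μ t ω - S.aStar) (lam t ω) ^ 2 +
          β' * S.lyapunov κ (μ t ω - S.aStar) (lam t ω) + C')) :
    (∫ ω, S.lyapunov κ (μ (t + 1) ω - S.aStar) (lam (t + 1) ω) ∂P ≤
      α * ∫ ω, S.lyapunov κ (μ t ω - S.aStar) (lam t ω) ∂P +
        β * ∫ ω, S.lyapunov κ (μ t ω - S.aStar) (lam t ω) ^ 2 ∂P + C) ∧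
    (∫ ω, S.lyapunov κ (μ (t + 1) ω - S.aStar) (lam (t + 1) ω) ^ 2 ∂P ≤
      α' * ∫ ω, S.lyapunov κ (μ t ω - S.aStar) (lam t ω) ^ 2 ∂P +
        β' * ∫ ω, S.lyapunov κ (μ t ω - S.aStar) (lam t ω) ∂P + C') := by
  have hx := h.measurable_state hJ hξ hs ht
  have hz := hξ.measurable_pi ht
  have hind := h.indepFun_noise hJ hξ hs ht
  have hlaw := hξ.map_eq ht
  have hF : Measurable (sampledValue J K l S κ (γ t) (ε t) (σ t)) :=
    (continuous_sampledValue hJ S κ (γ t) (ε t) (σ t)).measurable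
  have hsucc := h.lyapunov_succ hs hSK hSl κ ht
  have ht' : 1 ≤ t + 1 := ht.trans t.le_succ
  exact ⟨integral_le_linear_of_indepFun hx hz hind hlaw hF (hW (t + 1) ht') hsucc (hW t ht)
      (hW2 t ht) fun ω => (hle ω).1,
    integral_le_linear_of_indepFun hx hz hind hlaw (hF.pow_const 2) (hW2 (t + 1) ht')
      (fun ω => by rw [hsucc]) (hW2 t ht) (hW t ht) fun ω => (hle ω).2⟩

/-- The expected step of the payoff-based algorithm. -/
theorem exists_expected_sampledValue (S : PrimalDualSystem (Action d) n) {κ : ℝ} (hκ0 : 0 < κ)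
    (hκK : κ * ‖S.K‖ ≤ 1) (hκ1 : κ * (2 * S.L ^ 2 + 5 * ‖S.K‖ ^ 2) ≤ S.ν / 2)
    (hκ2 : κ * (2 * ‖S.K‖ ^ 2 + 1) ≤ 1 / 2) {B Q : ℝ} (hB : 0 ≤ B) (hQ : 0 ≤ Q) :
    ∃ c C δ : ℝ, 0 < c ∧ 0 ≤ C ∧ 0 < δ ∧ ∀ γ ε σ : ℝ, 0 ≤ γ → γ ≤ δ → 0 ≤ ε → ε ≤ δ →
      γ ≤ δ * ε → 0 ≤ σ → σ ≤ B → ε ≤ B → σ ^ 2 ≤ Q * γ → ε ^ 2 ≤ Q * γ →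
      ∀ (μ : Action d) (x : Dual n), (∀ j, 0 ≤ x j) →
      S.StepNoise (stdGaussianPi (Σ i : Fin N, Fin (d i)))
        (fun z => (1 + ‖toAction z‖) ^ 3) B σ (μ - S.aStar) x
        (fun z => gradEstimate J K l σ (S.aStar + (μ - S.aStar))
          (S.aStar + (μ - S.aStar) + σ • toAction z) x)
        (fun z => σ • S.K (toAction z)) →
      ∫ z, sampledValue J K l S κ γ ε σ ((μ, x), z) ∂stdGaussianPi _ ≤
        (1 - c * γ) * S.lyapunov κ (μ - S.aStar) x +
          C * γ * S.lyapunov κ (μ - S.aStar) x ^ 2 + C * γ ^ 2 ∧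
      ∫ z, sampledValue J K l S κ γ ε σ ((μ, x), z) ^ 2 ∂stdGaussianPi _ ≤
        (1 - c * (γ * ε)) * S.lyapunov κ (μ - S.aStar) x ^ 2 +
          C * γ ^ 2 * S.lyapunov κ (μ - S.aStar) x + C * γ ^ 4 := by
  have hpowi := fun k => integrable_one_add_norm_pow_stdGaussianPi
    (ι := Σ i : Fin N, Fin (d i)) k
  have hP2 : Integrable (fun z : (Σ i : Fin N, Fin (d i)) → ℝ => ((1 + ‖toAction z‖) ^ 3) ^ 2)
      (stdGaussianPi _) := by
    simp_rw [← pow_mul]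
    exact hpowi 6
  have hP4 : Integrable (fun z : (Σ i : Fin N, Fin (d i)) → ℝ => ((1 + ‖toAction z‖) ^ 3) ^ 4)
      (stdGaussianPi _) := by
    simp_rw [← pow_mul]
    exact hpowi 12
  obtain ⟨c, C, δ, hc, hC, hδ, hstep⟩ := S.exists_expected_step hκ0 hκK hκ1 hκ2
    (stdGaussianPi (Σ i : Fin N, Fin (d i))) (P := fun z => (1 + ‖toAction z‖) ^ 3)
    (fun z => one_le_pow₀ (by simp)) (hpowi 3) hP2 hP4 (B := B) (Q := Q) hB hQ
  refine ⟨c, C, δ, hc, hC, hδ, ?_⟩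
  intro γ ε σ h1 h2 h3 h4 h5 h6 h7 h8 h9 h10 μ x hx hn
  have h := hstep γ ε σ h1 h2 h3 h4 h5 h6 h7 h8 h9 h10 (μ - S.aStar) x hx _ _ hn
  simp only [add_sub_cancel] at h
  exact h

end Rate

/-! ### Bounds for the parameter schedules -/

section Schedule

theorem div_rpow_le_self {c s : ℝ} (hc : 0 ≤ c) (hs : 0 ≤ s) {t : ℕ} (ht : 1 ≤ t) :
    c / (t : ℝ) ^ s ≤ c :=
  div_le_self hc (Real.one_le_rpow (by exact_mod_cast ht) hs)

/-- An exponent of at least `2/7` is what makes the square of order `γ`; this covers the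
regularization, with equality, and the sampling deviation. -/
theorem sq_div_rpow_le {c G s : ℝ} (hG : 0 < G) (hs : 2 / 7 ≤ s) {t : ℕ} (ht : 1 ≤ t) :
    (c / (t : ℝ) ^ s) ^ 2 ≤ c ^ 2 / G * (G / (t : ℝ) ^ (4 / 7 : ℝ)) := by
  have ht1 : (1 : ℝ) ≤ t := by exact_mod_cast ht
  have ht0 : (0 : ℝ) < t := by linarith
  have h1 : (t : ℝ) ^ (4 / 7 : ℝ) ≤ ((t : ℝ) ^ s) ^ 2 := by
    rw [← Real.rpow_natCast, ← Real.rpow_mul ht0.le]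
    exact Real.rpow_le_rpow_of_exponent_le ht1 (by push_cast; linarith)
  have h2 : c ^ 2 / G * (G / (t : ℝ) ^ (4 / 7 : ℝ)) = c ^ 2 / (t : ℝ) ^ (4 / 7 : ℝ) := by
    field_simp
  rw [h2, div_pow]
  exact div_le_div_of_nonneg_left (sq_nonneg _) (Real.rpow_pos_of_pos ht0 _) h1

end Schedule

/-! ### Convergence rate of the algorithm -/

section Convergence

variable {N n : ℕ} {d : Fin N → ℕ} {J : Fin N → Action d → ℝ}
  {K : Matrix (Fin n) (Σ i : Fin N, Fin (d i)) ℝ} {l : Dual n}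

/-- The squared primal error is at most twice the Lyapunov function, so both finiteness and the rate
are inherited from the moments of the latter. -/
theorem IsPayoffRun.rate {Ω : Type*} [MeasurableSpace Ω] {P : Measure Ω} [IsProbabilityMeasure P]
    {μ a : ℕ → Ω → Action d} {lam : ℕ → Ω → Dual n} (S : PrimalDualSystem (Action d) n)
    (hSM : S.M = pseudoGradient J) (hSK : S.K = couplingMap K) (hSl : S.l = l)
    (hJ : ∀ i, ContDiff ℝ 1 (J i))
    (hgrow : ∀ i, (fun x => fderiv ℝ (J i) x) =O[Bornology.cobounded (Action d)] fun x => ‖x‖)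
    {G E T s : ℝ} (hG : 0 < G) (hE : 0 < E) (hT : 0 < T) (hs : 2 / 7 ≤ s)
    (h : IsPayoffRun P J K l (fun t => G / (t : ℝ) ^ (4 / 7 : ℝ))
      (fun t => E / (t : ℝ) ^ (2 / 7 : ℝ)) (fun t => T / (t : ℝ) ^ s) μ a lam) :
    (∀ t, 1 ≤ t → Integrable (fun ω => ‖μ t ω - S.aStar‖ ^ 2) P) ∧
      (fun t : ℕ => ∫ ω, ‖μ t ω - S.aStar‖ ^ 2 ∂P) =O[atTop]
        (fun t : ℕ => 1 / (t : ℝ) ^ (4 / 7 : ℝ)) := by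
  obtain ⟨ξ, hξ, hsamp⟩ := h.sampling
  have hJc : ∀ i, Continuous (J i) := fun i => (hJ i).continuous
  obtain ⟨κ, hκ0, hκK, hκ1, hκ2⟩ := S.exists_cross_weight
  -- Enlarging the range to `T + E` makes the single constant `B` dominate both the sampling
  -- deviations and the regularization parameters.
  obtain ⟨B, hTB, hB⟩ := exists_stepNoise S hSM hSK (l := l) hJ hgrow (T := T + E) (by positivity)
  have hpow : ∀ t : ℕ, 1 ≤ t → ∀ r : ℝ, 0 < (t : ℝ) ^ r := fun t ht r =>
    Real.rpow_pos_of_pos (by exact_mod_cast ht) r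
  have hγ : ∀ t : ℕ, 1 ≤ t → 0 ≤ G / (t : ℝ) ^ (4 / 7 : ℝ) := fun t ht =>
    (div_pos hG (hpow t ht _)).le
  have hε : ∀ t : ℕ, 1 ≤ t → 0 ≤ E / (t : ℝ) ^ (2 / 7 : ℝ) ∧ E / (t : ℝ) ^ (2 / 7 : ℝ) ≤ B :=
    fun t ht => ⟨(div_pos hE (hpow t ht _)).le,
      (div_rpow_le_self hE.le (by norm_num) ht).trans (by linarith)⟩
  have hσ0 : ∀ t : ℕ, 1 ≤ t → 0 < T / (t : ℝ) ^ s := fun t ht => div_pos hT (hpow t ht _)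
  have hσT : ∀ t : ℕ, 1 ≤ t → T / (t : ℝ) ^ s ≤ T + E := fun t ht =>
    (div_rpow_le_self hT.le (by linarith) ht).trans (by linarith)
  have hσ : ∀ t : ℕ, 1 ≤ t → 0 ≤ T / (t : ℝ) ^ s ∧ T / (t : ℝ) ^ s ≤ B := fun t ht =>
    ⟨(hσ0 t ht).le, (hσT t ht).trans hTB⟩
  have hnoise := fun (t : ℕ) (ht : 1 ≤ t) => hB _ (hσ0 t ht) (hσT t ht)
  have hW2 : ∀ t, 1 ≤ t →
      Integrable (fun ω => S.lyapunov κ (μ t ω - S.aStar) (lam t ω) ^ 2) P := fun t ht =>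
    h.integrable_lyapunov_sq hJc hξ hsamp hSK hSl hκ0.le hκK hγ hε hσ hnoise ht
  have hW1 : ∀ t, 1 ≤ t →
      Integrable (fun ω => S.lyapunov κ (μ t ω - S.aStar) (lam t ω)) P := fun t ht =>
    ((memLp_two_iff_integrable_sq (h.measurable_lyapunov hJc hξ hsamp κ ht).aestronglyMeasurable).2
      (hW2 t ht)).integrable one_le_two
  have hu : ∀ t ω, ‖μ t ω - S.aStar‖ ^ 2 ≤ 2 * S.lyapunov κ (μ t ω - S.aStar) (lam t ω) :=
    fun t ω => by
      have := S.lyapunov_lower hκ0.le hκK (μ t ω - S.aStar) (lam t ω)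
      have h2 := sq_nonneg (S.dualDist (lam t ω))
      linarith
  have hui : ∀ t, 1 ≤ t → Integrable (fun ω => ‖μ t ω - S.aStar‖ ^ 2) P := fun t ht =>
    ((hW1 t ht).const_mul 2).mono'
      (((measurable_fst.comp (h.measurable_state hJc hξ hsamp ht)).sub_const
        S.aStar).norm.pow_const 2).aestronglyMeasurable
      (ae_of_all _ fun ω => by rw [Real.norm_of_nonneg (sq_nonneg _)]; exact hu t ω)
  refine ⟨hui, ?_⟩
  obtain ⟨c, C, δ, hc, hC, hδ, hstep⟩ := exists_expected_sampledValue (J := J) (K := K)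
    (l := l) S hκ0 hκK hκ1 hκ2 (B := B) (Q := (E ^ 2 + T ^ 2) / G) (by linarith) (by positivity)
  have hmain : ∀ᶠ t : ℕ in atTop,
      (∫ ω, S.lyapunov κ (μ (t + 1) ω - S.aStar) (lam (t + 1) ω) ∂P ≤
        (1 - c * (G / (t : ℝ) ^ (4 / 7 : ℝ))) *
            ∫ ω, S.lyapunov κ (μ t ω - S.aStar) (lam t ω) ∂P +
          C * (G / (t : ℝ) ^ (4 / 7 : ℝ)) *
            ∫ ω, S.lyapunov κ (μ t ω - S.aStar) (lam t ω) ^ 2 ∂P +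
          C * (G / (t : ℝ) ^ (4 / 7 : ℝ)) ^ 2) ∧
      (∫ ω, S.lyapunov κ (μ (t + 1) ω - S.aStar) (lam (t + 1) ω) ^ 2 ∂P ≤
        (1 - c * (G / (t : ℝ) ^ (4 / 7 : ℝ) * (E / (t : ℝ) ^ (2 / 7 : ℝ)))) *
            ∫ ω, S.lyapunov κ (μ t ω - S.aStar) (lam t ω) ^ 2 ∂P +
          C * (G / (t : ℝ) ^ (4 / 7 : ℝ)) ^ 2 *
            ∫ ω, S.lyapunov κ (μ t ω - S.aStar) (lam t ω) ∂P +
          C * (G / (t : ℝ) ^ (4 / 7 : ℝ)) ^ 4) := by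
    filter_upwards [eventually_ge_atTop 1,
      eventually_div_rpow_le G δ (4 / 7) hδ (by norm_num),
      eventually_div_rpow_le E δ (2 / 7) hδ (by norm_num),
      eventually_step_le_regularization G E δ hE hδ] with t ht hγδ hεδ hγε
    have hq1 : (T / (t : ℝ) ^ s) ^ 2 ≤ (E ^ 2 + T ^ 2) / G * (G / (t : ℝ) ^ (4 / 7 : ℝ)) := by
      refine (sq_div_rpow_le hG hs ht).trans (mul_le_mul_of_nonneg_right ?_ (hγ t ht))
      exact div_le_div_of_nonneg_right (by linarith [sq_nonneg E]) hG.le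
    have hq2 : (E / (t : ℝ) ^ (2 / 7 : ℝ)) ^ 2 ≤
        (E ^ 2 + T ^ 2) / G * (G / (t : ℝ) ^ (4 / 7 : ℝ)) := by
      refine (sq_div_rpow_le hG le_rfl ht).trans (mul_le_mul_of_nonneg_right ?_ (hγ t ht))
      exact div_le_div_of_nonneg_right (by linarith [sq_nonneg T]) hG.le
    have hone := fun ω => hstep _ _ _ (hγ t ht) hγδ (hε t ht).1 hεδ hγε
      (hσ t ht).1 (hσ t ht).2 (hε t ht).2 hq1 hq2 (μ t ω) (lam t ω)
      (h.lam_nonneg ht ω) (hnoise t ht (μ t ω - S.aStar) (lam t ω))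
    exact h.expected_recursion hJc hξ hsamp hSK hSl ht hW1 hW2 hone
  obtain ⟨A, hA⟩ := coupled_recursion_bound hG hE hc hC
    (w := fun t => ∫ ω, S.lyapunov κ (μ t ω - S.aStar) (lam t ω) ∂P)
    (f := fun t => ∫ ω, S.lyapunov κ (μ t ω - S.aStar) (lam t ω) ^ 2 ∂P) (fun t => rfl)
    (fun t => rfl) (hmain.mono fun t ht => ht.1) (hmain.mono fun t ht => ht.2)
  refine IsBigO.of_bound (2 * A) ?_
  filter_upwards [hA, eventually_ge_atTop 1] with t ht ht1
  rw [Real.norm_of_nonneg (integral_nonneg fun ω => sq_nonneg _),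
    Real.norm_of_nonneg (one_div_pos.2 (hpow t ht1 _)).le]
  have h1 := integral_mono (hui t ht1) ((hW1 t ht1).const_mul 2) (hu t)
  rw [integral_const_mul] at h1
  linarith

end Convergence

end PayoffGNE

end

/-! ### The main theorem -/

theorem corollary1 {N n : ℕ} {d : Fin N → ℕ}
    (J : Fin N → PayoffGNE.Action d → ℝ)
    (K : Matrix (Fin n) (Σ i : Fin N, Fin (d i)) ℝ) (l : PayoffGNE.Dual n)
    (hconvex : PayoffGNE.IsConvexGame J)
    (hmono : PayoffGNE.StronglyMonotone (PayoffGNE.pseudoGradient J))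
    (hslater : PayoffGNE.SlaterCondition K l)
    (hgrowth : PayoffGNE.QuadraticGrowth J) :
    (∃! aStar : PayoffGNE.Action d, PayoffGNE.IsVGNE J K l aStar) ∧
    ∀ aStar : PayoffGNE.Action d, PayoffGNE.IsVGNE J K l aStar →
      ∀ G E S s : ℝ, 0 < G → 0 < E → 0 < S → 4 / 7 ≤ s →
      ∀ {Ω : Type*} [MeasurableSpace Ω] (P : Measure Ω) [IsProbabilityMeasure P]
        (μ a : ℕ → Ω → PayoffGNE.Action d) (lam : ℕ → Ω → PayoffGNE.Dual n),
        PayoffGNE.IsPayoffRun P J K l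
          (fun t => G / (t : ℝ) ^ (4 / 7 : ℝ)) (fun t => E / (t : ℝ) ^ (2 / 7 : ℝ))
          (fun t => S / (t : ℝ) ^ s) μ a lam →
        (∀ t, 1 ≤ t → Integrable (fun ω => ‖μ t ω - aStar‖ ^ 2) P) ∧
        (fun t : ℕ => ∫ ω, ‖μ t ω - aStar‖ ^ 2 ∂P) =O[atTop]
          (fun t : ℕ => 1 / (t : ℝ) ^ (4 / 7 : ℝ)) := by
  refine ⟨?_, ?_⟩
  · obtain ⟨a, ha, -⟩ := PayoffGNE.exists_multiplier_point hmono hslater hgrowth.lipschitz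
    exact ⟨a, ha, fun b hb => hb.unique hmono ha⟩
  · intro aStar haStar G E T s hG hE hT hs Ω _ P _ μ a lam h
    obtain ⟨S, hSM, hSK, hSl, rfl⟩ :=
      PayoffGNE.exists_primalDualSystem hmono hslater hgrowth.lipschitz haStar
    exact h.rate S hSM hSK hSl (fun i => (hconvex i).1) hgrowth.gradient hG hE hT
      (by linarith)
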